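/- Let $\mathcal S,\mathcal A$ be finite nonempty sets, $S=|\mathcal S|$, $A=|\mathcal A|$, $\gamma\in(0,1)$, $r:\mathcal S\times\mathcal A\to[0,1]$ a known reward, $\delta>0$, $\underline\alpha\in(0,1)$, and $s_1\in\mathcal S$ an initial state. The unknown transition kernel $P^c$ is random, with independent rows $P^c_{s,a}\sim\mathrm{Dir}(1,\dots,1)$. For a stationary deterministic policy $\pi:\mathcal S\to\mathcal A$ let $V^\pi(s)$ be its expected total $\gamma$-discounted reward under $P^c$ from $s$, and let $V^*(s)$ be the supremum of this quantity over all Markovian (possibly randomized and time-dependent) policies. For $\phi(s,a)\in(0,\infty)^{\mathcal S}$ and $\alpha(s,a)\in(0,1)$ let $\rho^{\alpha}_{\phi(s,a)}(P^\top V)$ be the quantile $\inf\{z:\mathbb P(P^\top V\le z)\ge\alpha(s,a)\}$ for $P\sim\mathrm{Dir}(\phi(s,a))$. Let $V^\pi_{\phi,\alpha}$ and $V^*_{\phi,\alpha}$ be the unique solutions of $$V(s)=r(s,\pi(s))+\gamma\rho^\alpha_{\phi(s,\pi(s))}(P^\top V),\qquad V(s)=\max_{a}\{r(s,a)+\gamma\rho^\alpha_{\phi(s,a)}(P^\top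 V)\},$$ respectively; a policy is optimal for $(\phi,\alpha)$ if it attains the maximum in the second equation at $V=V^*_{\phi,\alpha}$ in every state. The algorithm AQ-BRMDP interacts with $P^c$ for time steps $t=1,\dots,T$, $T\ge1$. Pseudo-episode $k=1$ starts at $t=1$; after each step, independently of everything else, the current pseudo-episode continues with probability $\gamma$, and otherwise the next one starts. At the start of pseudo-episode $k$ let $N_k(s,a,s')$ be the number of transitions $(s,a,s')$ observed so far, $N_k(s,a)=\sum_{s'}N_k(s,a,s')$, $N_k^+=\max\{N_k,1\}$, $r_k(s,a)=N_k^+(s,a)\big/\tfrac1{SA}\sum_{x,b}N_k^+(x,b)$, $\phi_k(s,a,s')=1+N_k(s,a,s')$ and $$\alpha_k(s,a)=\max\Big\{1-\delta\,r_k(s,a)\frac{\ln(2k)}{\sqrt k},\ \underline\alpha\Big\}.$$ A policy $\pi_k$ that is optimal for $(\phi_k,\alpha_k)$ (ties broken arbitrarily as a function of $k$ and the interaction history) is followed throughout pseudo-episode $k$. Let $k(t)$ be the pseudo-episode containing $t$, and $$BR(T)=\mathbb E\sum_{t=1}^T\big(V^*(s_t)-V^{\pi_{k(t)}}(s_t)\big),\qquad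 BR\text{-}R(T)=\mathbb E\sum_{t=1}^T\big(V^*_{\phi_{k(t)},\underline\alpha}(s_t)-V^{\pi_{k(t)}}_{\phi_{k(t)},\underline\alpha}(s_t)\big),$$ the expectation being over $P^c$, the trajectory and the pseudo-episode lengths. Both expectations exist, and the following bounds hold. **Explicit bounds.** Let $u_T=\max\{e,T/(1-\gamma)^2\}$, $\ell_T=\ln u_T+\ln\ln u_T$, $m_T=\lceil(\ell_T+2)/(1-\gamma)\rceil$, $\mathfrak T_T=\frac{4\gamma}{1-\gamma}(\ell_T+4)^2$, $\bar T=T+m_T$, $M_T=\frac{2(S+1)(\bar T+SA)\sqrt{\bar T}}{SA\,\delta\ln2}$. For every $T\ge1$, $$\begin{aligned}BR(T)\le{}&\frac{\gamma m_T}{1-\gamma}\Big(\sqrt{16SA\bar T\ln\tfrac1{1-\underline\alpha}}+\sqrt{16SA(\bar T+S^2A)\big(\ln(1+\tfrac{SA\,M_T}{\bar T+S^2A})+2\big)}+\sqrt{16SA\bar T\ln(2SA\,T^3m_T)}\Big)\\&+\frac{\gamma SA}{1-\gamma}m_T^2\lceil\log_2m_T\rceil+\frac{\pi^2}{6(1-\gamma)}+\mathfrak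 T_T+\frac{2\delta SA\sqrt T\ln(2T)}{(1-\gamma)^2},\end{aligned}$$ $$\begin{aligned}BR\text{-}R(T)\le{}&\frac{\gamma m_T}{1-\gamma}\Big(\sqrt{16SA\bar T\ln\tfrac1{1-\underline\alpha}}+\sqrt{16SA(\bar T+S^2A)\big(\ln(1+\tfrac{SA\,M_T}{\bar T+S^2A})+2\big)}+\sqrt{16SA\bar T\ln\tfrac1{\underline\alpha}}+2\sqrt{16SA\bar T\ln(2SA\,T^3m_T)}\Big)\\&+\frac{2\gamma SA}{1-\gamma}m_T^2\lceil\log_2m_T\rceil+\frac{\pi^2}{3(1-\gamma)}+2\mathfrak T_T.\end{aligned}$$ **Order bounds.** There are universal constants $C>0$ and $p\in\mathbb N$ such that, with $\Lambda=1+\ln S+\ln A+\ln T+\ln(1+\tfrac1\delta)+\ln\tfrac1{1-\gamma}$, whenever $T\ge S^2A$, $$BR(T)\le C\Lambda^p\left(\frac{\gamma\sqrt{SAT\ln\frac e{1-\underline\alpha}}}{(1-\gamma)^2}+\frac{\delta SA\sqrt T}{(1-\gamma)^2}+\frac{SA}{(1-\gamma)^3}\right),$$ $$BR\text{-}R(T)\le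 C\Lambda^p\left(\frac{\gamma\sqrt{SAT\ln\frac1{\min\{\underline\alpha,1-\underline\alpha\}}}}{(1-\gamma)^2}+\frac{SA}{(1-\gamma)^3}\right).$$ -/

import Mathlib

open MeasureTheory ProbabilityTheory

universe u v

noncomputable section

namespace AQBRMDP

variable {S : Type u} {A : Type v} [Fintype S] [DecidableEq S] [Fintype A] [DecidableEq A]

/-! ### Dirichlet distribution and quantiles -/

/-- The Dirichlet distribution with positive parameter vector `η`, as a measure on `S → ℝ`
carried by the probability simplex: the law of `g / ∑ g` for independent `g s ∼ Gamma(η s, 1)`. -/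
def dirichlet (η : S → ℝ) : Measure (S → ℝ) :=
  (Measure.pi fun s => gammaMeasure (η s) 1).map fun g s => g s / ∑ s', g s'

/-- The (left) `α`-quantile `inf {z | α ≤ ℙ(X ≤ z)}` of a random variable `X`. -/
def quantile {Ω : Type*} [MeasurableSpace Ω] (μ : Measure Ω) (α : ℝ) (X : Ω → ℝ) : ℝ :=
  sInf {z : ℝ | α ≤ μ.real {ω | X ω ≤ z}}

/-- `ρ^α_η(Pᵀ V)`: the `α`-quantile of `∑ s', P s' * V s'` for `P ∼ Dir(η)`. -/
def rho (η : S → ℝ) (α : ℝ) (V : S → ℝ) : ℝ :=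
  quantile (dirichlet η) α fun p => ∑ s', p s' * V s'

/-! ### The true MDP

A transition kernel is `P : S → A → S → ℝ`, where `P s a s'` is the probability of moving to `s'`.
A Markovian randomized policy is `π : ℕ → S → A → ℝ`, with each `π t s` in the simplex over `A`. -/

/-- Law of the state at time `t` under kernel `P` and Markov policy `π`, started from `s`. -/
def stateLaw (P : S → A → S → ℝ) (π : ℕ → S → A → ℝ) (s : S) : ℕ → S → ℝ
  | 0 => fun x => if x = s then 1 else 0
  | t + 1 => fun y => ∑ x, stateLaw P π s t x * ∑ a, π t x a * P x a y

/-- Value of a Markov policy: the expected total discounted reward. -/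
def markovValue (γ : ℝ) (r : S → A → ℝ) (P : S → A → S → ℝ) (π : ℕ → S → A → ℝ) (s : S) : ℝ :=
  ∑' t : ℕ, γ ^ t * ∑ x, stateLaw P π s t x * ∑ a, π t x a * r x a

/-- `V^π`: value of a stationary deterministic policy. -/
def trueValue (γ : ℝ) (r : S → A → ℝ) (P : S → A → S → ℝ) (π : S → A) (s : S) : ℝ :=
  markovValue γ r P (fun _ x a => if a = π x then 1 else 0) s

/-- `V^*`: supremum of the values of all Markov (possibly randomized, time-dependent) policies. -/
def trueOptValue (γ : ℝ) (r : S → A → ℝ) (P : S → A → S → ℝ) (s : S) : ℝ :=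
  ⨆ π : {π : ℕ → S → A → ℝ // ∀ t x, π t x ∈ stdSimplex ℝ A}, markovValue γ r P π.1 s

/-! ### Quantile Bayesian-risk MDPs

`φ s a` is the Dirichlet parameter of the row `(s, a)`, and `α s a` is its quantile level. -/

/-- One-step Bayesian-risk backup of the action `a` in state `s`. -/
def brQ (γ : ℝ) (r : S → A → ℝ) (φ : S → A → S → ℝ) (α : S → A → ℝ) (V : S → ℝ)
    (s : S) (a : A) : ℝ :=
  r s a + γ * rho (φ s a) (α s a) V

/-- `V^π_{φ,α}`: the solution of the Bellman equation of the policy `π`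
(it is unique, the Bellman operator being a contraction). -/
def brValue (γ : ℝ) (r : S → A → ℝ) (φ : S → A → S → ℝ) (α : S → A → ℝ) (π : S → A) : S → ℝ :=
  Classical.epsilon fun V : S → ℝ => ∀ s, V s = brQ γ r φ α V s (π s)

/-- `V^*_{φ,α}`: the solution of the Bellman optimality equation (again unique). -/
def brOptValue (γ : ℝ) (r : S → A → ℝ) (φ : S → A → S → ℝ) (α : S → A → ℝ) : S → ℝ :=
  Classical.epsilon fun V : S → ℝ => ∀ s, V s = ⨆ a, brQ γ r φ α V s a

/-- `π` is an optimal policy of the `α`-quantile BR-MDP: it is greedy for `V^*_{φ,α}`. -/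
def IsBROptimal (γ : ℝ) (r : S → A → ℝ) (φ : S → A → S → ℝ) (α : S → A → ℝ) (π : S → A) : Prop :=
  ∀ s a, brQ γ r φ α (brOptValue γ r φ α) s a ≤ brQ γ r φ α (brOptValue γ r φ α) s (π s)

/-! ### Posterior and adaptive quantile schedule

The interaction history is the list of observed transitions `(s, a, s')`. -/

/-- Posterior parameters under the `Dir(1, …, 1)` prior. -/
def posterior (H : List (S × A × S)) (s : S) (a : A) (s' : S) : ℝ :=
  1 + (H.count (s, a, s') : ℝ)

/-- Number of visits to `(s, a)`. -/
def visits (H : List (S × A × S)) (s : S) (a : A) : ℕ :=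
  ∑ s', H.count (s, a, s')

/-- Adjusted visit count `N⁺(s, a) = max {N(s, a), 1}`. -/
def visitsPlus (H : List (S × A × S)) (s : S) (a : A) : ℝ :=
  max (visits H s a : ℝ) 1

/-- Relative visit count: the adjusted visit count divided by its average over all pairs. -/
def relVisits (H : List (S × A × S)) (s : S) (a : A) : ℝ :=
  visitsPlus H s a /
    ((1 / ((Fintype.card S : ℝ) * Fintype.card A)) * ∑ x, ∑ b, visitsPlus H x b)

/-- The adaptive quantile schedule `α_k(s, a) = max {1 - δ r_k(s, a) ln(2k) / √k, α̲}`. -/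
def schedule (δ αlo : ℝ) (k : ℕ) (H : List (S × A × S)) (s : S) (a : A) : ℝ :=
  max (1 - δ * relVisits H s a * (Real.log (2 * k) / Real.sqrt k)) αlo

/-- `pol k H` is the policy computed at the start of pseudo-episode `k` from the history `H`.
It has to be optimal for the `α_k`-quantile BR-MDP under the posterior; ties are broken
arbitrarily. -/
def IsAQPolicy (γ : ℝ) (r : S → A → ℝ) (δ αlo : ℝ)
    (pol : ℕ → List (S × A × S) → S → A) : Prop :=
  ∀ k, 1 ≤ k → ∀ H, IsBROptimal γ r (posterior H) (schedule δ αlo k H) (pol k H)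

/-! ### The run of the algorithm -/

/-- Situation at a time step, after a possible start of a new pseudo-episode. -/
structure AlgState (S : Type u) (A : Type v) where
  /-- current state of the environment -/
  state : S
  /-- interaction history so far -/
  hist : List (S × A × S)
  /-- index of the current pseudo-episode -/
  ep : ℕ
  /-- history at the start of the current pseudo-episode -/
  epHist : List (S × A × S)

/-- First time step, at which pseudo-episode 1 starts with an empty history. -/
def AlgState.start (s₁ : S) : AlgState S A := ⟨s₁, [], 1, []⟩

/-- Policy `π_k` in force. -/
def AlgState.policy (pol : ℕ → List (S × A × S) → S → A) (c : AlgState S A) : S → A :=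
  pol c.ep c.epHist

/-- Action taken. -/
def AlgState.action (pol : ℕ → List (S × A × S) → S → A) (c : AlgState S A) : A :=
  c.policy pol c.state

/-- Effect of one interaction with outcome `o = (next state, indicator X)`; the current
pseudo-episode continues if `X` is `true`, and a new one starts if `X` is `false`. -/
def AlgState.next (pol : ℕ → List (S × A × S) → S → A) (c : AlgState S A) (o : S × Bool) :
    AlgState S A :=
  let H := c.hist ++ [(c.state, c.action pol, o.1)]
  if o.2 then ⟨o.1, H, c.ep, c.epHist⟩ else ⟨o.1, H, c.ep + 1, H⟩

/-- Conditional probability of the outcome `o`: the next state is drawn from `P` and,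
independently, the indicator is Bernoulli with parameter `γ`. -/
def AlgState.outcomeProb (γ : ℝ) (P : S → A → S → ℝ) (pol : ℕ → List (S × A × S) → S → A)
    (c : AlgState S A) (o : S × Bool) : ℝ :=
  P c.state (c.action pol) o.1 * if o.2 then γ else 1 - γ

/-- Situation after the first `t` of the outcomes `ω`, that is, at the `(t+1)`-st time step. -/
def stateAt (pol : ℕ → List (S × A × S) → S → A) (s₁ : S) {T : ℕ} (ω : Fin T → S × Bool) (t : ℕ) :
    AlgState S A :=
  ((List.ofFn ω).take t).foldl (AlgState.next pol) (AlgState.start s₁)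

/-- Probability, given the true kernel `P`, of the sequence of outcomes `ω`. -/
def pathProb (γ : ℝ) (P : S → A → S → ℝ) (pol : ℕ → List (S × A × S) → S → A) (s₁ : S) {T : ℕ}
    (ω : Fin T → S × Bool) : ℝ :=
  ∏ t : Fin T, (stateAt pol s₁ ω t).outcomeProb γ P pol (ω t)

/-- Prior law of the true kernel: independent `Dir(1, …, 1)` rows. -/
def kernelPrior (S : Type u) (A : Type v) [Fintype S] [Fintype A] : Measure (S → A → S → ℝ) :=
  Measure.pi fun _ => Measure.pi fun _ => dirichlet fun _ => 1

/-! ### Bayesian regrets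

Summing over pseudo-episodes and over the steps in each of them is summing over the time steps,
each with the policy and the posterior of the pseudo-episode that it belongs to. -/

/-- Expected regret against the true optimum over `T` interactions, given the true kernel. -/
def condRegret (γ : ℝ) (r : S → A → ℝ) (pol : ℕ → List (S × A × S) → S → A) (s₁ : S) (T : ℕ)
    (P : S → A → S → ℝ) : ℝ :=
  ∑ ω : Fin T → S × Bool, pathProb γ P pol s₁ ω *
    ∑ t : Fin T, (trueOptValue γ r P (stateAt pol s₁ ω t).state -
      trueValue γ r P ((stateAt pol s₁ ω t).policy pol) (stateAt pol s₁ ω t).state)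

/-- Expected regret against the robust optimum over `T` interactions, given the true kernel. -/
def condRobustRegret (γ : ℝ) (r : S → A → ℝ) (αlo : ℝ) (pol : ℕ → List (S × A × S) → S → A)
    (s₁ : S) (T : ℕ) (P : S → A → S → ℝ) : ℝ :=
  ∑ ω : Fin T → S × Bool, pathProb γ P pol s₁ ω *
    ∑ t : Fin T,
      (brOptValue γ r (posterior (stateAt pol s₁ ω t).epHist) (fun _ _ => αlo)
          (stateAt pol s₁ ω t).state -
        brValue γ r (posterior (stateAt pol s₁ ω t).epHist) (fun _ _ => αlo)
          ((stateAt pol s₁ ω t).policy pol) (stateAt pol s₁ ω t).state)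

/-- Bayesian regret `BR(T)` relative to the true optimum. -/
def bayesRegret (γ : ℝ) (r : S → A → ℝ) (pol : ℕ → List (S × A × S) → S → A) (s₁ : S) (T : ℕ) : ℝ :=
  ∫ P, condRegret γ r pol s₁ T P ∂(kernelPrior S A)

/-- Bayesian regret `BR-R(T)` relative to the robust optimum. -/
def bayesRobustRegret (γ : ℝ) (r : S → A → ℝ) (αlo : ℝ) (pol : ℕ → List (S × A × S) → S → A)
    (s₁ : S) (T : ℕ) : ℝ :=
  ∫ P, condRobustRegret γ r αlo pol s₁ T P ∂(kernelPrior S A)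

/-! ### Quantities in the explicit bounds (`nS`, `nA`: numbers of states and actions) -/

/-- `log u_T + log log u_T` with `u_T = max {e, T / (1-γ)²}`. -/
def logTerm (γ : ℝ) (T : ℕ) : ℝ :=
  Real.log (max (Real.exp 1) (T / (1 - γ) ^ 2)) +
    Real.log (Real.log (max (Real.exp 1) (T / (1 - γ) ^ 2)))

/-- `m_T`. -/
def mT (γ : ℝ) (T : ℕ) : ℕ := ⌈1 / (1 - γ) * (logTerm γ T + 2)⌉₊

/-- `𝔗_T`. -/
def tailT (γ : ℝ) (T : ℕ) : ℝ := 4 * γ / (1 - γ) * (logTerm γ T + 4) ^ 2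

/-- `T + m_T`. -/
def Tbar (γ : ℝ) (T : ℕ) : ℝ := T + mT γ T

/-- `M_T`. -/
def MT (nS nA γ δ : ℝ) (T : ℕ) : ℝ :=
  2 * (nS + 1) * (Tbar γ T + nS * nA) * Real.sqrt (Tbar γ T) / (nS * nA * δ * Real.log 2)

/-- Explicit bound on `BR(T)`. -/
def regretBound (nS nA γ δ αlo : ℝ) (T : ℕ) : ℝ :=
  γ * mT γ T / (1 - γ) *
      (Real.sqrt (16 * nS * nA * Tbar γ T * Real.log (1 / (1 - αlo))) +
        Real.sqrt (16 * nS * nA * (Tbar γ T + nS ^ 2 * nA) *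
          (Real.log (1 + nS * nA * MT nS nA γ δ T / (Tbar γ T + nS ^ 2 * nA)) + 2)) +
        Real.sqrt (16 * nS * nA * Tbar γ T * Real.log (2 * nS * nA * (T : ℝ) ^ 3 * mT γ T))) +
    γ * nS * nA / (1 - γ) * (mT γ T : ℝ) ^ 2 * (⌈Real.logb 2 (mT γ T)⌉ : ℝ) +
    Real.pi ^ 2 / (6 * (1 - γ)) + tailT γ T +
    2 * δ * nS * nA * Real.sqrt T * Real.log (2 * T) / (1 - γ) ^ 2

/-- Explicit bound on `BR-R(T)`. -/
def robustRegretBound (nS nA γ δ αlo : ℝ) (T : ℕ) : ℝ :=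
  γ * mT γ T / (1 - γ) *
      (Real.sqrt (16 * nS * nA * Tbar γ T * Real.log (1 / (1 - αlo))) +
        Real.sqrt (16 * nS * nA * (Tbar γ T + nS ^ 2 * nA) *
          (Real.log (1 + nS * nA * MT nS nA γ δ T / (Tbar γ T + nS ^ 2 * nA)) + 2)) +
        Real.sqrt (16 * nS * nA * Tbar γ T * Real.log (1 / αlo)) +
        2 * Real.sqrt (16 * nS * nA * Tbar γ T * Real.log (2 * nS * nA * (T : ℝ) ^ 3 * mT γ T))) +
    2 * γ * nS * nA / (1 - γ) * (mT γ T : ℝ) ^ 2 * (⌈Real.logb 2 (mT γ T)⌉ : ℝ) +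
    Real.pi ^ 2 / (3 * (1 - γ)) + 2 * tailT γ T

/-- Sum of the logarithms of `S, A, T, 1/δ, 1/(1-γ)`; the factors suppressed by `Õ` are
universal constants times powers of it. For `1/δ` it is `log (1 + 1/δ)`, as `δ` may exceed `1`. -/
def logFactor (nS nA γ δ : ℝ) (T : ℕ) : ℝ :=
  1 + Real.log nS + Real.log nA + Real.log T + Real.log (1 + 1 / δ) + Real.log (1 / (1 - γ))

end AQBRMDP

end

/-! Let V_k be the optimal value of the quantile BR-MDP solved at the start of pseudo-episode k. As
π_k is greedy, V_k is also the risk value of π_k at the levels α_k (`adaptiveValue`).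

Optimism. Split V* − V^{π_k} = (V* − V_k) + (V_k − V^{π_k}). If no row of the true kernel puts
P_{s,a}·V_k above its quantile, then V_k is a supersolution of the true optimality equation and the
first bracket is nonpositive (`regret_le`). Given the history at the start of the pseudo-episode,
the rows follow their Dirichlet posteriors, so the row (s,a) fails with probability at most 1 −
α_k(s,a) ≤ δ r_k(s,a) ln(2k)/√k. Since r_k averages to one over the pairs, these bounds sum to δSA
ln(2k)/√k. A failure costs at most 1/(1−γ) per step, and a pseudo-episode lasts 1/(1−γ) steps on
average; this is the δ-term. For the robust regret no such event is needed: risk values are monotone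
in the level, so V*_{α̲} ≤ V_k, and (V_k − V^{π_k}) + (V^{π_k} − V^{π_k}_{α̲}) remains to be bounded
(`robustGap_le`).

Simulation. Rewards cancel in each remaining gap X, so X(s) = γ·(one-step error) + γ P·X. The run
performs this recursion by itself: it stays in the pseudo-episode with probability γ and then moves
by P. Unrolling along the run for m steps leaves a residual of order γ^m, and every step of the run
is charged by at most m earlier ones (`sum_transition_pow_valueGap_le`). The one-step error compares
a quantile with P·V. Both lie within (1−γ)^{-1}√(log(·)/n) of the posterior mean, n = N_k + S: the
quantile always, by the Dirichlet tail bounds, and P·V outside an event of probability e^{-L} per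
row.

Counting. The widths involve counts frozen at the start of the pseudo-episode. As long as the count
of the pair has at most doubled, they are comparable with widths in the current count, which
telescope and are summed over pairs by concavity (`sum_const_width_le`, `sum_log_width_le`). The
other steps are either among the first m of their pseudo-episode, and then number at most m⌈log₂ m⌉
per pair (`sum_doubled_le`), or late, with probability at most γ^m (`transition_pow_late_le`). The
adaptive level is most extreme at rarely visited pairs, but costs only an additional log(1 +
M/(N+S)) there (`scheduleLog_le`).

Expectations over the run are powers of the operator `transition` applied to functions of the
situation. Bayes' rule for one transition (`kernelPosterior_withDensity`), iterated in
`integral_transition_pow_mono`, allows posterior bounds to be inserted at any time. All Dirichlet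
facts come from the representation by independent gamma variables. The order bounds follow by
estimating m_T by a multiple of Λ/(1−γ) if T ≥ m_T, and from the trivial bound T/(1−γ) otherwise. -/

noncomputable section

namespace AQBRMDP

open scoped ENNReal

/-! ### Densities of product measures -/

section ProductDensity

variable {ι : Type*} [Fintype ι] {X : ι → Type*} [∀ i, MeasurableSpace (X i)]

lemma lintegral_prod_pi (μ : ∀ i, Measure (X i)) [∀ i, IsProbabilityMeasure (μ i)]
    (f : ∀ i, X i → ℝ≥0∞) (hf : ∀ i, Measurable (f i)) :
    ∫⁻ x, ∏ i, f i (x i) ∂(Measure.pi μ) = ∏ i, ∫⁻ x, f i x ∂(μ i) := by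
  refine (lintegral_prod_eq_prod_lintegral_of_indepFun (μ := Measure.pi μ) Finset.univ
    (fun i (x : ∀ i, X i) => f i (x i)) (iIndepFun_pi fun i => (hf i).aemeasurable)
    fun i => (hf i).comp (measurable_pi_apply i)).trans ?_
  refine Finset.prod_congr rfl fun i _ => ?_
  rw [← (measurePreserving_eval μ i).lintegral_comp (hf i)]

/-- Reweighting each factor of a product of probability measures by a density that is, up to a
constant, that of another probability measure reweights the product accordingly. -/
lemma withDensity_prod_pi (μ ν : ∀ i, Measure (X i)) [∀ i, IsProbabilityMeasure (μ i)]
    [∀ i, IsProbabilityMeasure (ν i)] (f : ∀ i, X i → ℝ≥0∞) (hf : ∀ i, Measurable (f i))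
    (c : ι → ℝ≥0∞) (hc : ∀ i, c i ≠ ∞) (h : ∀ i, (μ i).withDensity (f i) = c i • ν i) :
    (Measure.pi μ).withDensity (fun x => ∏ i, f i (x i)) = (∏ i, c i) • Measure.pi ν := by
  classical
  -- Both sides are identified with the product of the measures `c i • ν i` by evaluating on boxes;
  -- finiteness makes this product determined by its boxes.
  have hfin : ∀ i, IsFiniteMeasure (c i • ν i) := fun i =>
    ⟨by simpa using (hc i).lt_top⟩
  trans Measure.pi fun i => c i • ν i
  · symm
    apply Measure.pi_eq
    intro s hs
    rw [withDensity_apply _ (MeasurableSet.univ_pi hs),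
      ← lintegral_indicator (MeasurableSet.univ_pi hs)]
    have : ∀ x : ∀ i, X i, (Set.univ.pi s).indicator (fun x => ∏ i, f i (x i)) x =
        ∏ i, (s i).indicator (f i) (x i) := by
      intro x
      by_cases hx : x ∈ Set.univ.pi s
      · rw [Set.indicator_of_mem hx]
        exact Finset.prod_congr rfl fun i _ =>
          (Set.indicator_of_mem (hx i (Set.mem_univ i)) _).symm
      · rw [Set.indicator_of_notMem hx]
        simp only [Set.mem_pi, Set.mem_univ, true_implies, not_forall] at hx
        obtain ⟨i, hi⟩ := hx
        exact (Finset.prod_eq_zero (Finset.mem_univ i) (Set.indicator_of_notMem hi _)).symm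
    simp_rw [this]
    rw [lintegral_prod_pi μ _ fun i => (hf i).indicator (hs i)]
    exact Finset.prod_congr rfl fun i _ => by
      rw [lintegral_indicator (hs i), ← withDensity_apply _ (hs i), h]
  · apply Measure.pi_eq
    intro s hs
    simp [Measure.pi_pi, Finset.prod_mul_distrib]

/-- Reweighting a product of probability measures by a function of one coordinate. -/
lemma withDensity_eval_pi [DecidableEq ι] (μ ν : ∀ i, Measure (X i))
    [∀ i, IsProbabilityMeasure (μ i)] [∀ i, IsProbabilityMeasure (ν i)] (i : ι)
    (w : X i → ℝ≥0∞) (hw : Measurable w) (c : ℝ≥0∞) (hc : c ≠ ∞)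
    (h : (μ i).withDensity w = c • ν i) (hne : ∀ j, j ≠ i → μ j = ν j) :
    (Measure.pi μ).withDensity (fun x => w (x i)) = c • Measure.pi ν := by
  have key := withDensity_prod_pi μ ν (Function.update (fun _ _ => 1) i w)
    (fun j => by
      by_cases hj : j = i
      · subst hj; simpa using hw
      · simp only [Function.update_of_ne hj]; exact measurable_const)
    (Function.update (fun _ => 1) i c)
    (fun j => by
      by_cases hj : j = i
      · subst hj; simpa using hc
      · simp [Function.update_of_ne hj])
    (fun j => by
      by_cases hj : j = i
      · subst hj; simpa using h
      · simp only [Function.update_of_ne hj, one_smul, ← hne j hj]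
        exact withDensity_one)
  have h1 : ∀ x : ∀ i, X i,
      ∏ j, Function.update (fun _ _ => (1 : ℝ≥0∞)) i w j (x j) = w (x i) := by
    intro x
    rw [Finset.prod_eq_single i (fun j _ hj => by simp [Function.update_of_ne hj]) (by simp)]
    simp
  have h2 : ∏ j, Function.update (fun _ => (1 : ℝ≥0∞)) i c j = c := by
    rw [Finset.prod_eq_single i (fun j _ hj => by simp [Function.update_of_ne hj]) (by simp)]
    simp
  simpa only [h1, h2] using key

end ProductDensity

/-! ### Gamma distributions -/

/-- Exponential tilting only moves the rate, and the normalizing constant is the moment generating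
function. The first fact gives Dirichlet conjugacy, the second the Chernoff bound. -/
lemma gammaMeasure_withDensity_exp {a r z : ℝ} (ha : 0 < a) (hr : 0 < r) (hz : z < r) :
    (gammaMeasure a r).withDensity (fun x => ENNReal.ofReal (Real.exp (z * x))) =
      ENNReal.ofReal ((r / (r - z)) ^ a) • gammaMeasure a (r - z) := by
  have hrz : 0 < r - z := sub_pos.2 hz
  have hm : ∀ a r, Measurable (gammaPDF a r) := fun a r =>
    (measurable_gammaPDFReal a r).ennreal_ofReal
  unfold gammaMeasure
  rw [← withDensity_mul _ (hm _ _) (by fun_prop), ← withDensity_smul _ (hm _ _)]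
  congr 1
  ext x
  simp only [Pi.mul_apply, Pi.smul_apply, smul_eq_mul, gammaPDF]
  rw [← ENNReal.ofReal_mul (gammaPDFReal_nonneg ha hr x), ← ENNReal.ofReal_mul (by positivity)]
  congr 1
  unfold gammaPDFReal
  split_ifs with hx
  · rw [Real.div_rpow hr.le hrz.le, mul_assoc, ← Real.exp_add]
    have : (r - z) ^ a ≠ 0 := (Real.rpow_pos_of_pos hrz a).ne'
    field_simp
    ring_nf
  · simp

/-- Size biasing raises the shape by one: this is where the unit added to a Dirichlet parameter by
an observation comes from. -/
lemma gammaMeasure_withDensity_id {a r : ℝ} (ha : 0 < a) (hr : 0 < r) :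
    (gammaMeasure a r).withDensity (fun x => ENNReal.ofReal x) =
      ENNReal.ofReal (a / r) • gammaMeasure (a + 1) r := by
  have hm : ∀ a r, Measurable (gammaPDF a r) := fun a r =>
    (measurable_gammaPDFReal a r).ennreal_ofReal
  unfold gammaMeasure
  rw [← withDensity_mul _ (hm _ _) (by fun_prop), ← withDensity_smul _ (hm _ _)]
  congr 1
  ext x
  simp only [Pi.mul_apply, Pi.smul_apply, smul_eq_mul, gammaPDF]
  rw [← ENNReal.ofReal_mul (gammaPDFReal_nonneg ha hr x), ← ENNReal.ofReal_mul (by positivity)]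
  congr 1
  unfold gammaPDFReal
  split_ifs with hx
  · rcases hx.eq_or_lt with rfl | hx
    · simp [Real.zero_rpow ha.ne']
    · rw [Real.Gamma_add_one ha.ne', Real.rpow_add hr, Real.rpow_one, add_sub_cancel_right,
        Real.rpow_sub hx, Real.rpow_one]
      have := (Real.Gamma_pos_of_pos ha).ne'
      field_simp
  · simp

lemma gammaMeasure_map_div {a θ : ℝ} (hθ : 0 < θ) :
    (gammaMeasure a 1).map (fun x => x / θ) = gammaMeasure a θ := by
  have hm : ∀ a r, Measurable (gammaPDF a r) := fun a r =>
    (measurable_gammaPDFReal a r).ennreal_ofReal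
  ext s hs
  have hdiv : Measurable fun x : ℝ => x / θ := by fun_prop
  rw [Measure.map_apply hdiv hs]
  unfold gammaMeasure
  rw [withDensity_apply _ (hdiv hs), withDensity_apply _ hs, ← lintegral_indicator (hdiv hs),
    ← lintegral_indicator hs]
  conv_lhs => rw [← Real.smul_map_volume_mul_left hθ.ne']
  rw [lintegral_smul_measure, lintegral_map ((hm _ _).indicator (hdiv hs)) (by fun_prop),
    smul_eq_mul, ← lintegral_const_mul' _ _ ENNReal.ofReal_ne_top]
  congr 1
  ext x
  have hiff : θ * x ∈ (fun x => x / θ) ⁻¹' s ↔ x ∈ s := by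
    simp [mul_div_cancel_left₀ x hθ.ne']
  by_cases hx : x ∈ s
  · rw [Set.indicator_of_mem hx, Set.indicator_of_mem (hiff.2 hx)]
    unfold gammaPDF gammaPDFReal
    rw [← ENNReal.ofReal_mul (abs_nonneg _), abs_of_pos hθ]
    congr 1
    by_cases h0 : 0 ≤ x
    · rw [if_pos h0, if_pos (by positivity), Real.mul_rpow hθ.le h0, Real.rpow_sub hθ,
        Real.rpow_one]
      field_simp
      simp
    · rw [if_neg h0, if_neg (by simpa [mul_nonneg_iff_of_pos_left hθ] using h0), mul_zero]
  · rw [Set.indicator_of_notMem hx, Set.indicator_of_notMem (mt hiff.1 hx), mul_zero]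

lemma gammaMeasure_ae_pos {a r : ℝ} : ∀ᵐ x ∂gammaMeasure a r, 0 < x := by
  have hm : Measurable (gammaPDF a r) := (measurable_gammaPDFReal a r).ennreal_ofReal
  -- For shape one the density is nonzero at the origin, so this point is discarded as
  -- Lebesgue-null.
  have h0 : ∀ᵐ x : ℝ, x ≠ 0 := by simp [ae_iff]
  unfold gammaMeasure
  rw [ae_withDensity_iff hm]
  filter_upwards [h0] with x hx hpdf
  by_contra hneg
  exact hpdf (gammaPDF_of_neg (lt_of_le_of_ne (not_lt.1 hneg) hx))

/-- Writes the normalization 1/∑g of a Dirichlet coordinate as a mixture of exponential tilts, each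
of which acts on the gamma coordinates separately. -/
lemma lintegral_exp_neg_mul_Ioi {G : ℝ} (hG : 0 < G) :
    ∫⁻ θ in Set.Ioi (0 : ℝ), ENNReal.ofReal (Real.exp (-θ * G)) = ENNReal.ofReal (1 / G) := by
  have hint : IntegrableOn (fun θ : ℝ => Real.exp (-G * θ)) (Set.Ioi 0) :=
    exp_neg_integrableOn_Ioi 0 hG
  have h1 := integral_exp_mul_Ioi (a := -G) (by linarith) 0
  rw [← ofReal_integral_eq_lintegral_ofReal]
  · congr 1
    have : ∀ θ : ℝ, -θ * G = -G * θ := fun θ => by ring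
    simp_rw [this, h1]
    simp
  · refine hint.congr (Filter.Eventually.of_forall fun θ => ?_)
    simp only [mul_comm, mul_neg]
  · exact Filter.Eventually.of_forall fun θ => (Real.exp_pos _).le

/-! ### Dirichlet distributions -/

section Dirichlet

variable {S : Type u} [Fintype S]

/-- Division of a vector by the sum of its entries. -/
def normalize (g : S → ℝ) : S → ℝ := fun s => g s / ∑ s', g s'

lemma measurable_normalize : Measurable (normalize : (S → ℝ) → S → ℝ) := by
  unfold normalize
  exact measurable_pi_lambda _ fun s => by fun_prop

/-- A common rate is a common scale and cancels in g/∑g. Hence tilting all coordinates by the same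
exponential does not change the normalized law. -/
lemma dirichlet_eq_map_gamma {η : S → ℝ} (hη : ∀ s, 0 < η s) {θ : ℝ} (hθ : 0 < θ) :
    dirichlet η = (Measure.pi fun s => gammaMeasure (η s) θ).map normalize := by
  have hp : ∀ s, IsProbabilityMeasure (gammaMeasure (η s) 1) := fun s =>
    isProbabilityMeasure_gammaMeasure (hη s) one_pos
  have hp' : ∀ s, IsProbabilityMeasure (gammaMeasure (η s) θ) := fun s =>
    isProbabilityMeasure_gammaMeasure (hη s) hθ
  have hm : ∀ s, gammaMeasure (η s) θ = (gammaMeasure (η s) 1).map (fun x => x / θ) := fun s =>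
    (gammaMeasure_map_div hθ).symm
  have h1 : (Measure.pi fun s => gammaMeasure (η s) θ) =
      (Measure.pi fun s => gammaMeasure (η s) 1).map (fun g s => g s / θ) := by
    have hs : ∀ s, SigmaFinite ((gammaMeasure (η s) 1).map (fun x => x / θ)) := fun s => by
      rw [← hm]; infer_instance
    rw [Measure.pi_map_pi (f := fun _ x => x / θ) fun s => by fun_prop]
    simp_rw [hm]
  rw [h1, Measure.map_map measurable_normalize (measurable_pi_lambda _ fun s => by fun_prop)]
  unfold dirichlet
  congr 1
  ext g s
  simp only [normalize, Function.comp, ← Finset.sum_div]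
  rw [div_div_div_cancel_right₀ hθ.ne']

lemma isProbabilityMeasure_dirichlet {η : S → ℝ} (hη : ∀ s, 0 < η s) :
    IsProbabilityMeasure (dirichlet η) := by
  have hp : ∀ s, IsProbabilityMeasure (gammaMeasure (η s) 1) := fun s =>
    isProbabilityMeasure_gammaMeasure (hη s) one_pos
  rw [dirichlet_eq_map_gamma hη one_pos]
  exact Measure.isProbabilityMeasure_map measurable_normalize.aemeasurable

lemma ae_pos_pi_gamma {η : S → ℝ} (hη : ∀ s, 0 < η s) {θ : ℝ} (hθ : 0 < θ) :
    ∀ᵐ g ∂(Measure.pi fun s => gammaMeasure (η s) θ), ∀ s, 0 < g s := by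
  have hp : ∀ s, IsProbabilityMeasure (gammaMeasure (η s) θ) := fun s =>
    isProbabilityMeasure_gammaMeasure (hη s) hθ
  rw [ae_all_iff]
  intro s
  exact (measurePreserving_eval _ s).quasiMeasurePreserving.ae gammaMeasure_ae_pos

lemma dirichlet_ae_mem_stdSimplex [Nonempty S] {η : S → ℝ} (hη : ∀ s, 0 < η s) :
    ∀ᵐ p ∂dirichlet η, p ∈ stdSimplex ℝ S := by
  have hms : MeasurableSet {p : S → ℝ | p ∈ stdSimplex ℝ S} :=
    (isClosed_stdSimplex ℝ S).measurableSet
  rw [dirichlet_eq_map_gamma hη one_pos, ae_map_iff measurable_normalize.aemeasurable hms]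
  filter_upwards [ae_pos_pi_gamma hη one_pos] with g hg
  have hG : 0 < ∑ s, g s := Finset.sum_pos (fun s _ => hg s) Finset.univ_nonempty
  exact ⟨fun s => div_nonneg (hg s).le hG.le, by
    simp only [normalize, ← Finset.sum_div, div_self hG.ne']⟩

/-- Conjugacy of the Dirichlet prior: observing the category `s₀` adds one to its parameter. -/
lemma dirichlet_withDensity_eval [DecidableEq S] {η : S → ℝ} (hη : ∀ s, 0 < η s) (s₀ : S) :
    ∃ c : ℝ≥0∞, c ≠ ∞ ∧ (dirichlet η).withDensity (fun p => ENNReal.ofReal (p s₀)) =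
      c • dirichlet (Function.update η s₀ (η s₀ + 1)) := by
  have : Nonempty S := ⟨s₀⟩
  set η' := Function.update η s₀ (η s₀ + 1) with hη'def
  have hη' : ∀ s, 0 < η' s := by
    intro s
    by_cases h : s = s₀
    · subst h; simp only [hη'def, Function.update_self]; linarith [hη s]
    · simp only [hη'def, Function.update_of_ne h]; exact hη s
  have hp : ∀ s, IsProbabilityMeasure (gammaMeasure (η s) 1) := fun s =>
    isProbabilityMeasure_gammaMeasure (hη s) one_pos
  have hp1 : ∀ s, IsProbabilityMeasure (gammaMeasure (η' s) 1) := fun s =>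
    isProbabilityMeasure_gammaMeasure (hη' s) one_pos
  set κ : ℝ → ℝ≥0∞ := fun θ => ∏ s, ENNReal.ofReal ((1 / (1 + θ)) ^ η' s) with hκ
  have hκm : Measurable κ := by
    refine Finset.measurable_fun_prod _ fun s _ => ?_
    fun_prop
  have hexp : ∀ θ : ℝ, Measurable fun x : ℝ => ENNReal.ofReal (Real.exp (-θ * x)) := by
    intro θ; fun_prop
  -- exponential tilting of the gamma variables
  have htilt : ∀ θ ∈ Set.Ioi (0 : ℝ), ∀ f : (S → ℝ) → ℝ≥0∞, Measurable f →
      ∫⁻ g, ENNReal.ofReal (Real.exp (-θ * ∑ s, g s)) * f (normalize g)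
        ∂(Measure.pi fun s => gammaMeasure (η' s) 1) = κ θ * ∫⁻ p, f p ∂dirichlet η' := by
    intro θ hθ f hf
    have hθ' : (0 : ℝ) < 1 + θ := by have := Set.mem_Ioi.1 hθ; linarith
    have hp2 : ∀ s, IsProbabilityMeasure (gammaMeasure (η' s) (1 + θ)) := fun s =>
      isProbabilityMeasure_gammaMeasure (hη' s) hθ'
    have h1 := withDensity_prod_pi (fun s => gammaMeasure (η' s) 1)
      (fun s => gammaMeasure (η' s) (1 + θ)) (fun _ x => ENNReal.ofReal (Real.exp (-θ * x)))
      (fun _ => hexp θ) (fun s => ENNReal.ofReal ((1 / (1 + θ)) ^ η' s))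
      (fun s => ENNReal.ofReal_ne_top) fun s => by
        have := gammaMeasure_withDensity_exp (hη' s) one_pos (z := -θ)
          (by have := Set.mem_Ioi.1 hθ; linarith)
        simpa only [sub_neg_eq_add] using this
    have h2 : ∀ g : S → ℝ, ∏ s, ENNReal.ofReal (Real.exp (-θ * g s)) =
        ENNReal.ofReal (Real.exp (-θ * ∑ s, g s)) := by
      intro g
      rw [← ENNReal.ofReal_prod_of_nonneg fun s _ => (Real.exp_pos _).le, ← Real.exp_sum,
        Finset.mul_sum]
    simp_rw [h2] at h1
    have hfn : Measurable fun g : S → ℝ => f (normalize g) := hf.comp measurable_normalize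
    have h3 := lintegral_withDensity_eq_lintegral_mul
      (Measure.pi fun s => gammaMeasure (η' s) 1)
      (f := fun g : S → ℝ => ENNReal.ofReal (Real.exp (-θ * ∑ s, g s))) (by fun_prop) hfn
    simp only [Pi.mul_apply] at h3
    rw [← h3, h1, lintegral_smul_measure, dirichlet_eq_map_gamma hη' hθ',
      lintegral_map hf measurable_normalize, smul_eq_mul]
  have hbias := withDensity_eval_pi (fun s => gammaMeasure (η s) 1)
    (fun s => gammaMeasure (η' s) 1) s₀ (fun x => ENNReal.ofReal x) (by fun_prop)
    (ENNReal.ofReal (η s₀)) ENNReal.ofReal_ne_top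
    (by simpa [hη'def] using gammaMeasure_withDensity_id (hη s₀) one_pos)
    (fun s hs => by simp [hη'def, Function.update_of_ne hs])
  set c : ℝ≥0∞ := ENNReal.ofReal (η s₀) * ∫⁻ θ in Set.Ioi (0 : ℝ), κ θ with hc
  -- With G = ∑g, p(s₀) = g(s₀)/G = g(s₀)·∫e^{-θG}dθ. The factor g(s₀) size-biases one coordinate,
  -- turning `η` into `η'`; the factor e^{-θG} changes all rates to 1+θ, which the normalized vector
  -- does not see and which contributes only the mass `κ θ`.
  have key : ∀ f : (S → ℝ) → ℝ≥0∞, Measurable f →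
      ∫⁻ p, ENNReal.ofReal (p s₀) * f p ∂dirichlet η = c * ∫⁻ p, f p ∂dirichlet η' := by
    intro f hf
    have hfn : Measurable fun g : S → ℝ => f (normalize g) := hf.comp measurable_normalize
    rw [dirichlet_eq_map_gamma hη one_pos, lintegral_map (by fun_prop) measurable_normalize]
    calc ∫⁻ g, ENNReal.ofReal (normalize g s₀) * f (normalize g)
          ∂(Measure.pi fun s => gammaMeasure (η s) 1)
        = ∫⁻ g, ENNReal.ofReal (g s₀) * (∫⁻ θ in Set.Ioi (0 : ℝ),
            ENNReal.ofReal (Real.exp (-θ * ∑ s, g s)) * f (normalize g))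
          ∂(Measure.pi fun s => gammaMeasure (η s) 1) := by
          refine lintegral_congr_ae ?_
          filter_upwards [ae_pos_pi_gamma hη one_pos] with g hg
          have hG : 0 < ∑ s, g s := Finset.sum_pos (fun s _ => hg s) Finset.univ_nonempty
          rw [lintegral_mul_const _ (by fun_prop), lintegral_exp_neg_mul_Ioi hG, ← mul_assoc,
            ← ENNReal.ofReal_mul (hg s₀).le, normalize, mul_one_div]
      _ = ENNReal.ofReal (η s₀) * ∫⁻ g, (∫⁻ θ in Set.Ioi (0 : ℝ),
            ENNReal.ofReal (Real.exp (-θ * ∑ s, g s)) * f (normalize g))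
          ∂(Measure.pi fun s => gammaMeasure (η' s) 1) := by
          have hmeas : Measurable fun g : S → ℝ => ∫⁻ θ in Set.Ioi (0 : ℝ),
              ENNReal.ofReal (Real.exp (-θ * ∑ s, g s)) * f (normalize g) := by
            refine Measurable.lintegral_prod_right ?_
            exact Measurable.mul (by fun_prop) (hfn.comp measurable_fst)
          have h3 := lintegral_withDensity_eq_lintegral_mul
            (Measure.pi fun s => gammaMeasure (η s) 1)
            (f := fun g : S → ℝ => ENNReal.ofReal (g s₀)) (by fun_prop) hmeas
          simp only [Pi.mul_apply] at h3
          rw [← h3, hbias, lintegral_smul_measure, smul_eq_mul]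
      _ = ENNReal.ofReal (η s₀) * ∫⁻ θ in Set.Ioi (0 : ℝ), κ θ * ∫⁻ p, f p ∂dirichlet η' := by
          congr 1
          rw [lintegral_lintegral_swap]
          · exact setLIntegral_congr_fun measurableSet_Ioi fun θ hθ => htilt θ hθ f hf
          · refine Measurable.aemeasurable ?_
            exact Measurable.mul (by fun_prop) (hfn.comp measurable_fst)
      _ = c * ∫⁻ p, f p ∂dirichlet η' := by
          rw [lintegral_mul_const _ hκm, ← mul_assoc]
  have hP := isProbabilityMeasure_dirichlet hη
  have hP' := isProbabilityMeasure_dirichlet hη'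
  refine ⟨c, ?_, ?_⟩
  -- Testing with the constant one identifies `c` with the mean of p(s₀), which is at most one.
  · have h1 := key (fun _ => 1) measurable_const
    simp only [mul_one, lintegral_const, measure_univ] at h1
    rw [← h1]
    refine ne_top_of_le_ne_top ENNReal.one_ne_top ?_
    calc ∫⁻ p, ENNReal.ofReal (p s₀) ∂dirichlet η ≤ ∫⁻ _, 1 ∂dirichlet η := by
          refine lintegral_mono_ae ?_
          filter_upwards [dirichlet_ae_mem_stdSimplex hη] with p hp
          exact ENNReal.ofReal_le_one.2 ((mem_Icc_of_mem_stdSimplex hp s₀).2)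
      _ = 1 := by simp
  · ext s hs
    rw [withDensity_apply _ hs, ← lintegral_indicator hs, Measure.smul_apply, smul_eq_mul,
      ← lintegral_indicator_one hs, ← key _ (measurable_one.indicator hs)]
    refine lintegral_congr fun p => ?_
    by_cases hps : p ∈ s <;> simp [hps]

end Dirichlet

/-! ### Concentration of linear functionals of a Dirichlet vector -/

/-- A Pinsker inequality with constant one, through the Hellinger affinity h = √(mq) +
√((1−m)(1−q)). From log x ≤ x − 1 the divergence is at least 2(1−h) ≥ 1 − h², and 1 − h² dominates
(q−m)². -/
lemma sq_sub_le_binary_kl {m q : ℝ} (hm : 0 < m) (hm1 : m < 1) (hq : 0 < q) (hq1 : q < 1) :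
    (q - m) ^ 2 ≤ m * Real.log (m / q) + (1 - m) * Real.log ((1 - m) / (1 - q)) := by
  have aux : ∀ x y : ℝ, 0 < x → 0 < y →
      2 * x - 2 * (Real.sqrt x * Real.sqrt y) ≤ x * Real.log (x / y) := by
    intro x y hx hy
    have hsx := Real.sqrt_pos.2 hx
    have hsy := Real.sqrt_pos.2 hy
    have h1 := Real.log_le_sub_one_of_pos (div_pos hsy hsx)
    have h2 : Real.log (x / y) = -(2 * Real.log (Real.sqrt y / Real.sqrt x)) := by
      rw [Real.log_div hsy.ne' hsx.ne', Real.log_sqrt hy.le, Real.log_sqrt hx.le,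
        Real.log_div hx.ne' hy.ne']
      ring
    rw [h2]
    have h3 : x * (Real.sqrt y / Real.sqrt x) = Real.sqrt x * Real.sqrt y := by
      rw [mul_div_assoc', div_eq_iff hsx.ne']
      nth_rw 1 [← Real.mul_self_sqrt hx.le]
      ring
    nlinarith [mul_le_mul_of_nonneg_left h1 hx.le]
  have h1 := aux m q hm hq
  have h2 := aux (1 - m) (1 - q) (by linarith) (by linarith)
  set a := Real.sqrt m
  set b := Real.sqrt q
  set c := Real.sqrt (1 - m)
  set d := Real.sqrt (1 - q)
  have ha : a * a = m := Real.mul_self_sqrt hm.le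
  have hb : b * b = q := Real.mul_self_sqrt hq.le
  have hc : c * c = 1 - m := Real.mul_self_sqrt (by linarith)
  have hd : d * d = 1 - q := Real.mul_self_sqrt (by linarith)
  have ha0 : 0 ≤ a := Real.sqrt_nonneg _
  have hb0 : 0 ≤ b := Real.sqrt_nonneg _
  have hc0 : 0 ≤ c := Real.sqrt_nonneg _
  have hd0 : 0 ≤ d := Real.sqrt_nonneg _
  -- Lagrange's identity for the unit vectors (a,c) and (b,d); `hid2` is the same for (a,c) and
  -- (d,b).
  have hid : (a * b + c * d) ^ 2 + (a * d - b * c) ^ 2 = 1 := by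
    have : (a * b + c * d) ^ 2 + (a * d - b * c) ^ 2 = (a * a + c * c) * (b * b + d * d) := by
      ring
    rw [this, ha, hb, hc, hd]; ring
  have hid2 : (a * d + b * c) ^ 2 + (a * b - c * d) ^ 2 = 1 := by
    have : (a * d + b * c) ^ 2 + (a * b - c * d) ^ 2 = (a * a + c * c) * (b * b + d * d) := by
      ring
    rw [this, ha, hb, hc, hd]; ring
  have hmq : m - q = (a * d - b * c) * (a * d + b * c) := by
    have : (a * d - b * c) * (a * d + b * c) = (a * a) * (d * d) - (b * b) * (c * c) := by ring
    rw [this, ha, hb, hc, hd]; ring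
  have hle : (q - m) ^ 2 ≤ (a * d - b * c) ^ 2 := by
    have : (q - m) ^ 2 = (a * d - b * c) ^ 2 * (a * d + b * c) ^ 2 := by
      rw [← mul_pow, ← hmq]; ring
    rw [this]
    exact mul_le_of_le_one_right (sq_nonneg _) (by nlinarith [sq_nonneg (a * b - c * d)])
  have hw : a * b + c * d ≤ 1 := by nlinarith [sq_nonneg (a * d - b * c)]
  nlinarith

section Tail

variable {S : Type u} [Fintype S]

/-- Mean of `V` with respect to the normalized weights `η`; it is the expectation of
`∑ s, p s * V s` for `p ∼ Dir(η)`. -/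
def weightedMean (η V : S → ℝ) : ℝ := (∑ s, η s * V s) / ∑ s, η s

/-- The Chernoff exponent. The chosen θ is optimal for values in {0,1}: it turns 1 − θ(V−q) into the
mixture, with weights V and 1−V, of m/q and (1−m)/(1−q). Concavity of the logarithm then reduces
general V to the binary divergence. -/
lemma prod_gamma_mgf_le {η V : S → ℝ} (hη : ∀ s, 0 < η s) [Nonempty S]
    (hV0 : ∀ s, 0 ≤ V s) (hV1 : ∀ s, V s ≤ 1) {q : ℝ}
    (hm : 0 < weightedMean η V) (hmq : weightedMean η V < q) (hq1 : q < 1) :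
    ∃ θ : ℝ, 0 < θ ∧ (∀ s, θ * (V s - q) < 1) ∧
      ∏ s, (1 / (1 - θ * (V s - q))) ^ η s ≤
        Real.exp (-((∑ s, η s) * (q - weightedMean η V) ^ 2)) := by
  set m := weightedMean η V with hmdef
  have hq : 0 < q := hm.trans hmq
  have hn : 0 < ∑ s, η s := Finset.sum_pos (fun s _ => hη s) Finset.univ_nonempty
  have hmn : ∑ s, η s * V s = m * ∑ s, η s := by
    rw [hmdef, weightedMean, div_mul_cancel₀ _ hn.ne']
  have hmq' : 0 < m / q := div_pos hm hq
  have hmq1 : 0 < (1 - m) / (1 - q) := div_pos (by linarith) (by linarith)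
  have hid : ∀ s, 1 - (q - m) / (q * (1 - q)) * (V s - q) =
      V s * (m / q) + (1 - V s) * ((1 - m) / (1 - q)) := by
    intro s
    have : (1 - q) ≠ 0 := by linarith
    field_simp
    ring
  have hpos : ∀ s, 0 < V s * (m / q) + (1 - V s) * ((1 - m) / (1 - q)) := by
    intro s
    rcases (hV0 s).eq_or_lt with h | h
    · rw [← h]; simpa using hmq1
    · have := mul_pos h hmq'
      have := mul_nonneg (sub_nonneg.2 (hV1 s)) hmq1.le
      linarith
  refine ⟨(q - m) / (q * (1 - q)), div_pos (by linarith) (mul_pos hq (by linarith)), ?_, ?_⟩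
  · intro s
    have := hid s
    have := hpos s
    linarith
  · simp_rw [hid]
    have h1 : ∀ s, (1 / (V s * (m / q) + (1 - V s) * ((1 - m) / (1 - q)))) ^ η s =
        Real.exp (-(η s * Real.log (V s * (m / q) + (1 - V s) * ((1 - m) / (1 - q))))) := by
      intro s
      rw [Real.rpow_def_of_pos (one_div_pos.2 (hpos s)), one_div, Real.log_inv]
      congr 1; ring
    simp_rw [h1]
    rw [← Real.exp_sum]
    apply Real.exp_le_exp.2
    rw [Finset.sum_neg_distrib]
    apply neg_le_neg
    have h2 : ∀ s, V s * Real.log (m / q) + (1 - V s) * Real.log ((1 - m) / (1 - q)) ≤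
        Real.log (V s * (m / q) + (1 - V s) * ((1 - m) / (1 - q))) := fun s =>
      strictConcaveOn_log_Ioi.concaveOn.2 hmq' hmq1 (hV0 s) (sub_nonneg.2 (hV1 s)) (by ring)
    calc (∑ s, η s) * (q - m) ^ 2
        ≤ (∑ s, η s) * (m * Real.log (m / q) + (1 - m) * Real.log ((1 - m) / (1 - q))) :=
          mul_le_mul_of_nonneg_left (sq_sub_le_binary_kl hm (by linarith) hq hq1) hn.le
      _ = (∑ s, η s * V s) * Real.log (m / q) +
            (∑ s, η s - ∑ s, η s * V s) * Real.log ((1 - m) / (1 - q)) := by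
          rw [hmn]; ring
      _ = ∑ s, η s * (V s * Real.log (m / q) + (1 - V s) * Real.log ((1 - m) / (1 - q))) := by
          rw [← Finset.sum_sub_distrib, Finset.sum_mul, Finset.sum_mul, ← Finset.sum_add_distrib]
          exact Finset.sum_congr rfl fun s _ => by ring
      _ ≤ _ := Finset.sum_le_sum fun s _ => mul_le_mul_of_nonneg_left (h2 s) (hη s).le

lemma measurableSet_lt_linear (V : S → ℝ) (q : ℝ) :
    MeasurableSet {p : S → ℝ | q < ∑ s, p s * V s} :=
  measurableSet_lt measurable_const (by fun_prop)

/-- The event p·V > q is homogeneous: in terms of the gamma variables it reads ∑g(V−q) > 0, so no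
normalization remains and the exponential Markov inequality factorizes over independent coordinates.
The cases q ≥ 1 and mean zero, where the tilt is not available, are null or empty events. -/
lemma dirichlet_tail_unit {η V : S → ℝ} (hη : ∀ s, 0 < η s) [Nonempty S]
    (hV0 : ∀ s, 0 ≤ V s) (hV1 : ∀ s, V s ≤ 1) {q : ℝ} (hmq : weightedMean η V < q) :
    (dirichlet η).real {p | q < ∑ s, p s * V s} ≤
      Real.exp (-((∑ s, η s) * (q - weightedMean η V) ^ 2)) := by
  have hn : 0 < ∑ s, η s := Finset.sum_pos (fun s _ => hη s) Finset.univ_nonempty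
  have hm0 : 0 ≤ weightedMean η V :=
    div_nonneg (Finset.sum_nonneg fun s _ => mul_nonneg (hη s).le (hV0 s)) hn.le
  rcases le_or_gt 1 q with hq1 | hq1
  · have : (dirichlet η).real {p | q < ∑ s, p s * V s} = 0 := by
      rw [measureReal_def, ENNReal.toReal_eq_zero_iff]
      left
      refine measure_mono_null (t := {p | ¬ p ∈ stdSimplex ℝ S}) ?_
        (dirichlet_ae_mem_stdSimplex hη)
      intro p hp hps
      have : ∑ s, p s * V s ≤ ∑ s, p s :=
        Finset.sum_le_sum fun s _ => mul_le_of_le_one_right (hps.1 s) (hV1 s)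
      rw [hps.2] at this
      have hp' : q < ∑ s, p s * V s := hp
      linarith
    rw [this]; positivity
  rcases hm0.eq_or_lt with hm | hm
  · have hVz : ∀ s, V s = 0 := by
      have h0 : ∑ s, η s * V s = 0 := by
        rcases div_eq_zero_iff.1 hm.symm with h | h
        · exact h
        · exact absurd h hn.ne'
      rw [Finset.sum_eq_zero_iff_of_nonneg fun s _ => mul_nonneg (hη s).le (hV0 s)] at h0
      intro s
      exact (mul_eq_zero.1 (h0 s (Finset.mem_univ s))).resolve_left (hη s).ne'
    have : {p : S → ℝ | q < ∑ s, p s * V s} = ∅ := by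
      ext p
      simp only [hVz, mul_zero, Finset.sum_const_zero, Set.mem_ofPred_eq, Set.mem_empty_iff_false,
        iff_false, not_lt]
      linarith
    rw [this, measureReal_empty]; positivity
  obtain ⟨θ, hθ, hlt, hle⟩ := prod_gamma_mgf_le hη hV0 hV1 hm hmq hq1
  refine le_trans ?_ hle
  have hp : ∀ s, IsProbabilityMeasure (gammaMeasure (η s) 1) := fun s =>
    isProbabilityMeasure_gammaMeasure (hη s) one_pos
  have hprod : (0 : ℝ) ≤ ∏ s, (1 / (1 - θ * (V s - q))) ^ η s :=
    Finset.prod_nonneg fun s _ => Real.rpow_nonneg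
      (one_div_nonneg.2 (sub_nonneg.2 (hlt s).le)) _
  rw [measureReal_def]
  refine ENNReal.toReal_le_of_le_ofReal hprod ?_
  rw [dirichlet_eq_map_gamma hη one_pos,
    Measure.map_apply measurable_normalize (measurableSet_lt_linear V q),
    ← lintegral_indicator_one (measurable_normalize (measurableSet_lt_linear V q))]
  calc ∫⁻ g, (normalize ⁻¹' {p : S → ℝ | q < ∑ s, p s * V s}).indicator 1 g
        ∂(Measure.pi fun s => gammaMeasure (η s) 1)
      ≤ ∫⁻ g, ∏ s, ENNReal.ofReal (Real.exp (θ * (V s - q) * g s))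
        ∂(Measure.pi fun s => gammaMeasure (η s) 1) := by
        refine lintegral_mono_ae ?_
        filter_upwards [ae_pos_pi_gamma hη one_pos] with g hg
        by_cases hgm : g ∈ normalize ⁻¹' {p : S → ℝ | q < ∑ s, p s * V s}
        · rw [Set.indicator_of_mem hgm, Pi.one_apply,
            ← ENNReal.ofReal_prod_of_nonneg fun s _ => (Real.exp_pos _).le, ← Real.exp_sum,
            ← ENNReal.ofReal_one]
          apply ENNReal.ofReal_le_ofReal
          apply Real.one_le_exp
          have hG : 0 < ∑ s, g s := Finset.sum_pos (fun s _ => hg s) Finset.univ_nonempty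
          have h1 : q < (∑ s, g s * V s) / ∑ s, g s := by
            have h2 : q < ∑ s, normalize g s * V s := hgm
            simpa only [normalize, div_mul_eq_mul_div, ← Finset.sum_div] using h2
          rw [lt_div_iff₀ hG] at h1
          have h3 : ∑ s, θ * (V s - q) * g s = θ * (∑ s, g s * V s - q * ∑ s, g s) := by
            rw [Finset.mul_sum, ← Finset.sum_sub_distrib, Finset.mul_sum]
            exact Finset.sum_congr rfl fun s _ => by ring
          rw [h3]
          exact mul_nonneg hθ.le (by linarith)
        · rw [Set.indicator_of_notMem hgm]; exact zero_le
    _ = ∏ s, ∫⁻ x, ENNReal.ofReal (Real.exp (θ * (V s - q) * x)) ∂(gammaMeasure (η s) 1) :=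
        lintegral_prod_pi (fun s => gammaMeasure (η s) 1)
          (fun s x => ENNReal.ofReal (Real.exp (θ * (V s - q) * x))) fun s => by fun_prop
    _ = ∏ s, ENNReal.ofReal ((1 / (1 - θ * (V s - q))) ^ η s) := by
        refine Finset.prod_congr rfl fun s _ => ?_
        have hp' := isProbabilityMeasure_gammaMeasure (hη s) (sub_pos.2 (hlt s))
        have := congrArg (fun μ => μ Set.univ)
          (gammaMeasure_withDensity_exp (hη s) one_pos (hlt s))
        simpa using this
    _ = ENNReal.ofReal (∏ s, (1 / (1 - θ * (V s - q))) ^ η s) :=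
        (ENNReal.ofReal_prod_of_nonneg fun s _ => Real.rpow_nonneg
          (one_div_nonneg.2 (sub_nonneg.2 (hlt s).le)) _).symm

/-- Upper tail: a Dirichlet average of values in an interval of length `D`. -/
lemma dirichlet_upper_tail {η V : S → ℝ} (hη : ∀ s, 0 < η s) [Nonempty S] {lo D : ℝ}
    (hD : 0 < D) (hlo : ∀ s, lo ≤ V s) (hhi : ∀ s, V s ≤ lo + D) {x : ℝ} (hx : 0 ≤ x) :
    (dirichlet η).real {p | weightedMean η V + D * x < ∑ s, p s * V s} ≤
      Real.exp (-((∑ s, η s) * x ^ 2)) := by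
  have hn : 0 < ∑ s, η s := Finset.sum_pos (fun s _ => hη s) Finset.univ_nonempty
  have hP := isProbabilityMeasure_dirichlet hη
  rcases hx.eq_or_lt with rfl | hx
  · simp
  set W : S → ℝ := fun s => (V s - lo) / D with hW
  have hmW : weightedMean η W = (weightedMean η V - lo) / D := by
    unfold weightedMean
    rw [hW]
    have : ∑ s, η s * ((V s - lo) / D) = (∑ s, η s * V s - lo * ∑ s, η s) / D := by
      rw [Finset.mul_sum, ← Finset.sum_sub_distrib, Finset.sum_div]
      exact Finset.sum_congr rfl fun s _ => by ring
    rw [this]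
    field_simp
  have key := dirichlet_tail_unit (V := W) hη (fun s => div_nonneg (by linarith [hlo s]) hD.le)
    (fun s => (div_le_one hD).2 (by linarith [hhi s])) (q := weightedMean η W + x) (by linarith)
  rw [add_sub_cancel_left] at key
  refine le_trans (le_of_eq ?_) key
  refine measureReal_congr ?_
  filter_upwards [dirichlet_ae_mem_stdSimplex hη] with p hp
  refine propext ?_
  change weightedMean η V + D * x < ∑ s, p s * V s ↔ weightedMean η W + x < ∑ s, p s * W s
  have h1 : ∑ s, p s * W s = (∑ s, p s * V s - lo) / D := by
    have : ∑ s, p s * W s = (∑ s, p s * V s - lo * ∑ s, p s) / D := by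
      rw [Finset.mul_sum, ← Finset.sum_sub_distrib, Finset.sum_div]
      exact Finset.sum_congr rfl fun s _ => by rw [hW]; ring
    rw [this, hp.2, mul_one]
  rw [h1, hmW, lt_div_iff₀ hD, add_mul, div_mul_cancel₀ _ hD.ne']
  constructor <;> intro h <;> linarith

lemma weightedMean_neg (η V : S → ℝ) : weightedMean η (fun s => -V s) = -weightedMean η V := by
  unfold weightedMean
  simp [neg_div]

/-- Lower tail: a Dirichlet average of values in an interval of length `D`. -/
lemma dirichlet_lower_tail {η V : S → ℝ} (hη : ∀ s, 0 < η s) [Nonempty S] {lo D : ℝ}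
    (hD : 0 < D) (hlo : ∀ s, lo ≤ V s) (hhi : ∀ s, V s ≤ lo + D) {x : ℝ} (hx : 0 ≤ x) :
    (dirichlet η).real {p | ∑ s, p s * V s < weightedMean η V - D * x} ≤
      Real.exp (-((∑ s, η s) * x ^ 2)) := by
  have key := dirichlet_upper_tail (V := fun s => -V s) hη (lo := -(lo + D)) hD
    (fun s => by linarith [hhi s]) (fun s => by linarith [hlo s]) hx
  refine le_trans (le_of_eq ?_) key
  congr 1
  ext p
  simp only [weightedMean_neg, mul_neg, Finset.sum_neg_distrib, Set.mem_ofPred_eq]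
  constructor <;> intro h <;> linarith

end Tail

/-! ### Quantiles of linear functionals -/

section Quantile

variable {S : Type u} [Fintype S]

lemma linear_mem_of_stdSimplex {p V : S → ℝ} (hp : p ∈ stdSimplex ℝ S) {lo hi : ℝ}
    (hlo : ∀ s, lo ≤ V s) (hhi : ∀ s, V s ≤ hi) :
    lo ≤ ∑ s, p s * V s ∧ ∑ s, p s * V s ≤ hi := by
  have h1 : lo = ∑ s, p s * lo := by rw [← Finset.sum_mul, hp.2, one_mul]
  have h2 : hi = ∑ s, p s * hi := by rw [← Finset.sum_mul, hp.2, one_mul]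
  constructor
  · rw [h1]; exact Finset.sum_le_sum fun s _ => mul_le_mul_of_nonneg_left (hlo s) (hp.1 s)
  · rw [h2]; exact Finset.sum_le_sum fun s _ => mul_le_mul_of_nonneg_left (hhi s) (hp.1 s)

/-- The set whose infimum is the quantile. -/
def quantileSet (η : S → ℝ) (α : ℝ) (V : S → ℝ) : Set ℝ :=
  {z | α ≤ (dirichlet η).real {p | ∑ s, p s * V s ≤ z}}

lemma rho_eq_sInf (η : S → ℝ) (α : ℝ) (V : S → ℝ) : rho η α V = sInf (quantileSet η α V) := rfl

variable [Nonempty S] {η : S → ℝ} {α : ℝ}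

/-- A positive level excludes thresholds below all values of `V`. Together with nonemptiness, which
needs a level at most one, this makes the real infimum a genuine one and not the default value 0. -/
lemma le_of_mem_quantileSet (hη : ∀ s, 0 < η s) (hα : 0 < α) {V : S → ℝ} {lo z : ℝ}
    (hlo : ∀ s, lo ≤ V s) (hz : z ∈ quantileSet η α V) : lo ≤ z := by
  by_contra hlt
  push Not at hlt
  have : (dirichlet η).real {p | ∑ s, p s * V s ≤ z} = 0 := by
    rw [measureReal_def, ENNReal.toReal_eq_zero_iff]
    left
    refine measure_mono_null (t := {p | ¬ p ∈ stdSimplex ℝ S}) ?_ (dirichlet_ae_mem_stdSimplex hη)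
    intro p hp hps
    have h1 : ∑ s, p s * V s ≤ z := hp
    obtain ⟨s, hs⟩ := Finite.exists_max V
    exact absurd ((linear_mem_of_stdSimplex hps hlo hs).1) (not_le.2 (h1.trans_lt hlt))
  have h2 : α ≤ (dirichlet η).real {p | ∑ s, p s * V s ≤ z} := hz
  linarith

lemma quantileSet_bddBelow (hη : ∀ s, 0 < η s) (hα : 0 < α) (V : S → ℝ) :
    BddBelow (quantileSet η α V) := by
  obtain ⟨s, hs⟩ := Finite.exists_min V
  exact ⟨V s, fun z hz => le_of_mem_quantileSet hη hα hs hz⟩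

lemma mem_quantileSet_of_le (hη : ∀ s, 0 < η s) (hα1 : α ≤ 1) {V : S → ℝ} {hi : ℝ}
    (hhi : ∀ s, V s ≤ hi) : hi ∈ quantileSet η α V := by
  have hP := isProbabilityMeasure_dirichlet hη
  have : (dirichlet η).real {p | ∑ s, p s * V s ≤ hi} = 1 := by
    have hae : ∀ᵐ p ∂dirichlet η, p ∈ {p : S → ℝ | ∑ s, p s * V s ≤ hi} := by
      filter_upwards [dirichlet_ae_mem_stdSimplex hη] with p hp
      obtain ⟨s, hs⟩ := Finite.exists_min V
      exact (linear_mem_of_stdSimplex hp hs hhi).2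
    have hms : MeasurableSet {p : S → ℝ | ∑ s, p s * V s ≤ hi} :=
      measurableSet_le (by fun_prop) measurable_const
    rw [measureReal_def, (mem_ae_iff_prob_eq_one hms).1 hae, ENNReal.toReal_one]
  exact hα1.trans this.ge

lemma rho_mem (hη : ∀ s, 0 < η s) (hα : 0 < α) (hα1 : α ≤ 1) {V : S → ℝ} {lo hi : ℝ}
    (hlo : ∀ s, lo ≤ V s) (hhi : ∀ s, V s ≤ hi) : lo ≤ rho η α V ∧ rho η α V ≤ hi := by
  have hmem := mem_quantileSet_of_le hη hα1 hhi
  exact ⟨le_csInf ⟨_, hmem⟩ fun z hz => le_of_mem_quantileSet hη hα hlo hz,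
    csInf_le (quantileSet_bddBelow hη hα V) hmem⟩

lemma rho_mono (hη : ∀ s, 0 < η s) (hα : 0 < α) (hα1 : α ≤ 1) {V W : S → ℝ}
    (h : ∀ s, V s ≤ W s) : rho η α V ≤ rho η α W := by
  have hP := isProbabilityMeasure_dirichlet hη
  obtain ⟨s, hs⟩ := Finite.exists_max W
  refine csInf_le_csInf (quantileSet_bddBelow hη hα V) ⟨_, mem_quantileSet_of_le hη hα1 hs⟩ ?_
  intro z hz
  refine le_trans (show α ≤ _ from hz) ?_
  rw [measureReal_def, measureReal_def]
  refine ENNReal.toReal_mono (measure_ne_top _ _) (measure_mono_ae ?_)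
  filter_upwards [dirichlet_ae_mem_stdSimplex hη] with p hp hpz
  exact le_trans (Finset.sum_le_sum fun s _ => mul_le_mul_of_nonneg_left (h s) (hp.1 s)) hpz

lemma rho_mono_level (hη : ∀ s, 0 < η s) (hα : 0 < α) {β : ℝ} (hαβ : α ≤ β) (hβ1 : β ≤ 1)
    (V : S → ℝ) : rho η α V ≤ rho η β V := by
  obtain ⟨s, hs⟩ := Finite.exists_max V
  exact csInf_le_csInf (quantileSet_bddBelow hη hα V) ⟨_, mem_quantileSet_of_le hη hβ1 hs⟩
    fun z hz => hαβ.trans hz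

/-- Translation is only needed in one direction: with monotonicity it already gives the
shift-contraction property of all risk backups. -/
lemma rho_add_const (hη : ∀ s, 0 < η s) (hα : 0 < α) (hα1 : α ≤ 1) (V : S → ℝ) (c : ℝ) :
    rho η α (fun s => V s + c) ≤ rho η α V + c := by
  have hP := isProbabilityMeasure_dirichlet hη
  obtain ⟨s, hs⟩ := Finite.exists_max V
  rw [← sub_le_iff_le_add]
  refine le_csInf ⟨_, mem_quantileSet_of_le hη hα1 hs⟩ fun z hz => ?_
  rw [sub_le_iff_le_add]
  refine csInf_le (quantileSet_bddBelow hη hα _) ?_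
  refine le_trans (show α ≤ _ from hz) ?_
  rw [measureReal_def, measureReal_def]
  refine ENNReal.toReal_mono (measure_ne_top _ _) (measure_mono_ae ?_)
  filter_upwards [dirichlet_ae_mem_stdSimplex hη] with p hp hpz
  have hpz' : ∑ s, p s * V s ≤ z := hpz
  change ∑ s, p s * (V s + c) ≤ z + c
  simp_rw [mul_add]
  rw [Finset.sum_add_distrib, ← Finset.sum_mul, hp.2, one_mul]
  linarith

/-- The quantile is nonexpansive in the sup norm. -/
lemma rho_le_rho_add (hη : ∀ s, 0 < η s) (hα : 0 < α) (hα1 : α ≤ 1) {V W : S → ℝ} {c : ℝ}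
    (h : ∀ s, V s ≤ W s + c) : rho η α V ≤ rho η α W + c :=
  (rho_mono hη hα hα1 h).trans (rho_add_const hη hα hα1 W c)

/-- The `α`-quantile is exceeded with probability at most `1 - α`. -/
lemma dirichlet_rho_lt_le (hη : ∀ s, 0 < η s) (hα1 : α ≤ 1) (V : S → ℝ) :
    (dirichlet η).real {p | rho η α V < ∑ s, p s * V s} ≤ 1 - α := by
  have hP := isProbabilityMeasure_dirichlet hη
  obtain ⟨s, hs⟩ := Finite.exists_max V
  have hne : (quantileSet η α V).Nonempty := ⟨_, mem_quantileSet_of_le hη hα1 hs⟩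
  -- Attainment of the infimum is avoided: each threshold slightly above it exceeds some member of
  -- the quantile set, and the strict event is the increasing union of the events with these
  -- thresholds.
  have hlim : ∀ n : ℕ,
      (dirichlet η).real {p | rho η α V + 1 / ((n : ℝ) + 1) < ∑ s, p s * V s} ≤ 1 - α := by
    intro n
    obtain ⟨z, hz, hzlt⟩ := exists_lt_of_csInf_lt hne
      (show sInf (quantileSet η α V) < rho η α V + 1 / ((n : ℝ) + 1) by
        rw [rho_eq_sInf]; linarith [Nat.one_div_pos_of_nat (α := ℝ) (n := n)])
    have hzα : α ≤ (dirichlet η).real {p | ∑ s, p s * V s ≤ z} := hz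
    have hcompl : {p : S → ℝ | z < ∑ s, p s * V s} = {p | ∑ s, p s * V s ≤ z}ᶜ := by
      ext p; simp
    calc (dirichlet η).real {p | rho η α V + 1 / ((n : ℝ) + 1) < ∑ s, p s * V s}
        ≤ (dirichlet η).real {p | z < ∑ s, p s * V s} :=
          measureReal_mono fun p hp => hzlt.trans hp
      _ = 1 - (dirichlet η).real {p | ∑ s, p s * V s ≤ z} := by
          rw [hcompl, probReal_compl_eq_one_sub (measurableSet_le (by fun_prop) measurable_const)]
      _ ≤ 1 - α := by linarith
  have hU : {p : S → ℝ | rho η α V < ∑ s, p s * V s} =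
      ⋃ n : ℕ, {p | rho η α V + 1 / ((n : ℝ) + 1) < ∑ s, p s * V s} := by
    ext p
    simp only [Set.mem_ofPred_eq, Set.mem_iUnion]
    constructor
    · intro h
      obtain ⟨n, hn⟩ := exists_nat_one_div_lt (sub_pos.2 h)
      exact ⟨n, by linarith⟩
    · rintro ⟨n, hn⟩
      linarith [Nat.one_div_pos_of_nat (α := ℝ) (n := n)]
  have htend := tendsto_measure_iUnion_atTop (μ := dirichlet η)
    (s := fun n : ℕ => {p : S → ℝ | rho η α V + 1 / ((n : ℝ) + 1) < ∑ s, p s * V s})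
    (fun m n hmn p hp => by
      have h1 : (1 : ℝ) / ((n : ℝ) + 1) ≤ 1 / ((m : ℝ) + 1) :=
        one_div_le_one_div_of_le (by positivity) (by simpa using hmn)
      have h2 : rho η α V + 1 / ((m : ℝ) + 1) < ∑ s, p s * V s := hp
      change rho η α V + 1 / ((n : ℝ) + 1) < ∑ s, p s * V s
      linarith)
  rw [← hU] at htend
  exact le_of_tendsto ((ENNReal.tendsto_toReal (measure_ne_top _ _)).comp htend)
    (Filter.Eventually.of_forall hlim)

/-- The radius makes the upper tail equal to 1 − α, so the right-hand side is itself a member of the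
quantile set. -/
lemma rho_le_mean_add (hη : ∀ s, 0 < η s) (hα : 0 < α) (hα1 : α < 1) {V : S → ℝ} {lo D : ℝ}
    (hD : 0 < D) (hlo : ∀ s, lo ≤ V s) (hhi : ∀ s, V s ≤ lo + D) :
    rho η α V ≤ weightedMean η V +
      D * Real.sqrt (Real.log (1 / (1 - α)) / ∑ s, η s) := by
  have hP := isProbabilityMeasure_dirichlet hη
  have hn : 0 < ∑ s, η s := Finset.sum_pos (fun s _ => hη s) Finset.univ_nonempty
  refine csInf_le (quantileSet_bddBelow hη hα V) ?_
  have h1 := dirichlet_upper_tail hη hD hlo hhi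
    (Real.sqrt_nonneg (Real.log (1 / (1 - α)) / ∑ s, η s))
  have hlog : 0 ≤ Real.log (1 / (1 - α)) :=
    Real.log_nonneg ((one_le_div (by linarith)).2 (by linarith))
  set z := weightedMean η V + D * Real.sqrt (Real.log (1 / (1 - α)) / ∑ s, η s)
  have hexp : Real.exp (-Real.log (1 / (1 - α))) = 1 - α := by
    rw [one_div, Real.log_inv, neg_neg, Real.exp_log (by linarith)]
  rw [Real.sq_sqrt (div_nonneg hlog hn.le), mul_div_cancel₀ _ hn.ne', hexp] at h1
  have hcompl : {p : S → ℝ | ∑ s, p s * V s ≤ z} = {p | z < ∑ s, p s * V s}ᶜ := by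
    ext p; simp
  change α ≤ (dirichlet η).real {p | ∑ s, p s * V s ≤ z}
  rw [hcompl, probReal_compl_eq_one_sub (measurableSet_lt_linear V z)]
  linarith

lemma mean_sub_le_rho (hη : ∀ s, 0 < η s) (hα : 0 < α) (hα1 : α < 1) {V : S → ℝ} {lo D : ℝ}
    (hD : 0 < D) (hlo : ∀ s, lo ≤ V s) (hhi : ∀ s, V s ≤ lo + D) :
    weightedMean η V - D * Real.sqrt (Real.log (1 / α) / ∑ s, η s) ≤ rho η α V := by
  have hP := isProbabilityMeasure_dirichlet hη
  have hn : 0 < ∑ s, η s := Finset.sum_pos (fun s _ => hη s) Finset.univ_nonempty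
  refine le_csInf ⟨_, mem_quantileSet_of_le hη hα1.le hhi⟩ fun z hz => ?_
  by_contra hlt
  push Not at hlt
  have hlog : 0 < Real.log (1 / α) := Real.log_pos ((one_lt_div hα).2 hα1)
  have hzα : α ≤ (dirichlet η).real {p | ∑ s, p s * V s ≤ z} := hz
  set y := (weightedMean η V - z) / D with hy
  have hzy : z = weightedMean η V - D * y := by rw [hy]; field_simp; ring
  have hylt : Real.sqrt (Real.log (1 / α) / ∑ s, η s) < y := by
    rw [hy, lt_div_iff₀ hD]; linarith
  -- The midpoint leaves room on both sides: x < y passes from ≤ to the strict event of the tail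
  -- bound, and x above the square root makes the tail strictly smaller than α.
  set x := (Real.sqrt (Real.log (1 / α) / ∑ s, η s) + y) / 2 with hx
  have hs0 := Real.sqrt_nonneg (Real.log (1 / α) / ∑ s, η s)
  have h1 := dirichlet_lower_tail hη hD hlo hhi (x := x) (by linarith)
  have h2 : (dirichlet η).real {p | ∑ s, p s * V s ≤ z} ≤
      (dirichlet η).real {p | ∑ s, p s * V s < weightedMean η V - D * x} := by
    refine measureReal_mono fun p hp => lt_of_le_of_lt (show ∑ s, p s * V s ≤ z from hp) ?_
    have : x < y := by linarith
    rw [hzy]; nlinarith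
  have h3 : Real.exp (-((∑ s, η s) * x ^ 2)) < α := by
    rw [← Real.lt_log_iff_exp_lt hα]
    have h4 : Real.log (1 / α) / ∑ s, η s < x ^ 2 := by
      have hlt : Real.sqrt (Real.log (1 / α) / ∑ s, η s) < x := by linarith
      exact (Real.sqrt_lt' (by linarith)).1 hlt
    rw [div_lt_iff₀ hn, one_div, Real.log_inv] at h4
    linarith
  linarith

end Quantile

/-! ### Monotone shift contractions -/

section ShiftContraction

variable {S : Type u}

/-- Monotone operators that turn a shift by `c` into a shift by at most `γ * c`; all Bellman
operators below are of this kind. -/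
def IsShiftContraction (γ : ℝ) (T : (S → ℝ) → S → ℝ) : Prop :=
  ∀ (V W : S → ℝ) (c : ℝ), (∀ s, V s ≤ W s + c) → ∀ s, T V s ≤ T W s + γ * c

variable [Fintype S] [Nonempty S] {γ : ℝ} {T : (S → ℝ) → S → ℝ}

/-- Comparison principle. At a maximizer of V − W the shift property gives max(V−W) ≤ γ·max(V−W),
which forces the maximum to be nonpositive. Uniqueness, bounds and monotonicity of risk values all
follow from it. -/
lemma IsShiftContraction.le (hT : IsShiftContraction γ T) (hγ : γ < 1) {V W : S → ℝ}
    (hV : ∀ s, V s ≤ T V s) (hW : ∀ s, T W s ≤ W s) (s : S) : V s ≤ W s := by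
  obtain ⟨s₀, hs₀⟩ := Finite.exists_max fun s => V s - W s
  have h := hT V W (V s₀ - W s₀) (fun s => by linarith [hs₀ s]) s₀
  have h1 := hV s₀
  have h2 := hW s₀
  have : V s₀ - W s₀ ≤ 0 := by nlinarith
  linarith [hs₀ s]

omit [Nonempty S] in
lemma IsShiftContraction.exists_fixedPoint (hT : IsShiftContraction γ T) (hγ0 : 0 < γ)
    (hγ : γ < 1) : ∃ V : S → ℝ, ∀ s, V s = T V s := by
  have hlip : LipschitzWith ⟨γ, hγ0.le⟩ T := by
    refine LipschitzWith.of_dist_le_mul fun V W => ?_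
    have hd : ∀ s, |V s - W s| ≤ dist V W := fun s => by
      rw [← Real.dist_eq]; exact dist_le_pi_dist V W s
    refine (dist_pi_le_iff (mul_nonneg hγ0.le dist_nonneg)).2 fun s => ?_
    rw [Real.dist_eq, abs_le]
    have h1 := hT V W (dist V W) (fun s => by linarith [(abs_le.1 (hd s)).2]) s
    have h2 := hT W V (dist V W) (fun s => by linarith [(abs_le.1 (hd s)).1]) s
    change -(γ * dist V W) ≤ _ ∧ _ ≤ γ * dist V W
    constructor <;> linarith
  have hc : ContractingWith ⟨γ, hγ0.le⟩ T := ⟨by exact_mod_cast hγ, hlip⟩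
  exact ⟨ContractingWith.fixedPoint T hc, fun s =>
    congrFun hc.fixedPoint_isFixedPt.symm s⟩

lemma IsShiftContraction.eq (hT : IsShiftContraction γ T) (hγ : γ < 1) {V W : S → ℝ}
    (hV : ∀ s, V s = T V s) (hW : ∀ s, W s = T W s) : V = W :=
  funext fun s => le_antisymm (hT.le hγ (fun s => (hV s).le) (fun s => (hW s).ge) s)
    (hT.le hγ (fun s => (hW s).le) (fun s => (hV s).ge) s)

omit [Fintype S] [Nonempty S] in
lemma isShiftContraction_iSup {A : Type v} [Finite A] [Nonempty A] {Q : (S → ℝ) → S → A → ℝ}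
    (hQ : ∀ π : S → A, IsShiftContraction γ fun V s => Q V s (π s)) :
    IsShiftContraction γ fun V s => ⨆ a, Q V s a := fun V W c h s =>
  ciSup_le fun a => (hQ (fun _ => a) V W c h s).trans
    (add_le_add_left (le_ciSup (Set.finite_range (Q W s)).bddAbove a) _)

end ShiftContraction

/-! ### Solutions of the Bayesian-risk Bellman equations -/

section BR

variable {S : Type u} {A : Type v} [Fintype S] [Nonempty S]
  {γ : ℝ} {r : S → A → ℝ} {φ : S → A → S → ℝ} {α : S → A → ℝ}

lemma isShiftContraction_brQ (hγ0 : 0 < γ) (hφ : ∀ s a s', 0 < φ s a s') (hα : ∀ s a, 0 < α s a)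
    (hα1 : ∀ s a, α s a ≤ 1) (π : S → A) :
    IsShiftContraction γ fun V s => brQ γ r φ α V s (π s) := fun V W c h s => by
  have := mul_le_mul_of_nonneg_left
    (rho_le_rho_add (hφ s (π s)) (hα s (π s)) (hα1 s (π s)) h) hγ0.le
  simp only [brQ]
  linarith

/-- `Classical.epsilon` picks a solution as soon as one exists, which Banach's theorem provides. -/
lemma brValue_eq (hγ0 : 0 < γ) (hγ : γ < 1) (hφ : ∀ s a s', 0 < φ s a s')
    (hα : ∀ s a, 0 < α s a) (hα1 : ∀ s a, α s a ≤ 1) (π : S → A) (s : S) :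
    brValue γ r φ α π s = brQ γ r φ α (brValue γ r φ α π) s (π s) :=
  Classical.epsilon_spec (p := fun V : S → ℝ => ∀ s, V s = brQ γ r φ α V s (π s))
    ((isShiftContraction_brQ hγ0 hφ hα hα1 π).exists_fixedPoint hγ0 hγ) s

lemma brOptValue_eq [Finite A] [Nonempty A] (hγ0 : 0 < γ) (hγ : γ < 1)
    (hφ : ∀ s a s', 0 < φ s a s') (hα : ∀ s a, 0 < α s a) (hα1 : ∀ s a, α s a ≤ 1) (s : S) :
    brOptValue γ r φ α s = ⨆ a, brQ γ r φ α (brOptValue γ r φ α) s a :=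
  Classical.epsilon_spec (p := fun V : S → ℝ => ∀ s, V s = ⨆ a, brQ γ r φ α V s a)
    ((isShiftContraction_iSup (isShiftContraction_brQ hγ0 hφ hα hα1)).exists_fixedPoint hγ0 hγ) s

lemma brValue_mem (hγ0 : 0 < γ) (hγ : γ < 1) (hφ : ∀ s a s', 0 < φ s a s')
    (hα : ∀ s a, 0 < α s a) (hα1 : ∀ s a, α s a ≤ 1) (hr : ∀ s a, 0 ≤ r s a ∧ r s a ≤ 1)
    (π : S → A) (s : S) :
    0 ≤ brValue γ r φ α π s ∧ brValue γ r φ α π s ≤ 1 / (1 - γ) := by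
  have hc := isShiftContraction_brQ (r := r) hγ0 hφ hα hα1 π
  have he := brValue_eq (r := r) hγ0 hγ hφ hα hα1 π
  constructor
  · refine hc.le hγ (V := fun _ => 0) (fun s => ?_) (fun s => (he s).ge) s
    have h1 := (rho_mem (hφ s (π s)) (hα s (π s)) (hα1 s (π s)) (V := fun _ => (0 : ℝ))
      (fun _ => le_rfl) (fun _ => le_rfl)).1
    have := mul_nonneg hγ0.le h1
    have := (hr s (π s)).1
    simp only [brQ]
    linarith
  · refine hc.le hγ (W := fun _ => 1 / (1 - γ)) (fun s => (he s).le) (fun s => ?_) s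
    have h1 := (rho_mem (hφ s (π s)) (hα s (π s)) (hα1 s (π s)) (V := fun _ => 1 / (1 - γ))
      (fun _ => le_rfl) (fun _ => le_rfl)).2
    have := mul_le_mul_of_nonneg_left h1 hγ0.le
    have := (hr s (π s)).2
    have h2 : γ * (1 / (1 - γ)) + 1 = 1 / (1 - γ) := by
      have : 1 - γ ≠ 0 := by linarith
      field_simp; ring
    simp only [brQ]
    linarith

/-- For a greedy policy the optimal value also solves the equation of that policy, and this solution
is unique. -/
lemma IsBROptimal.brOptValue_eq_brValue [Finite A] [Nonempty A] (hγ0 : 0 < γ) (hγ : γ < 1)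
    (hφ : ∀ s a s', 0 < φ s a s') (hα : ∀ s a, 0 < α s a) (hα1 : ∀ s a, α s a ≤ 1)
    {π : S → A} (hπ : IsBROptimal γ r φ α π) :
    brOptValue γ r φ α = brValue γ r φ α π := by
  refine (isShiftContraction_brQ (r := r) hγ0 hφ hα hα1 π).eq hγ (fun s => ?_)
    (brValue_eq hγ0 hγ hφ hα hα1 π)
  rw [brOptValue_eq hγ0 hγ hφ hα hα1 s]
  exact le_antisymm (ciSup_le fun a => hπ s a)
    (le_ciSup (f := fun a => brQ γ r φ α (brOptValue γ r φ α) s a)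
      (Set.finite_range _).bddAbove (π s))

/-- Quantiles increase with the level, so the optimal value at the lower level is a subsolution at
the higher one. -/
lemma brOptValue_mono_level [Finite A] [Nonempty A] (hγ0 : 0 < γ) (hγ : γ < 1)
    (hφ : ∀ s a s', 0 < φ s a s') (hα : ∀ s a, 0 < α s a) {β : S → A → ℝ}
    (hαβ : ∀ s a, α s a ≤ β s a) (hβ1 : ∀ s a, β s a ≤ 1) (s : S) :
    brOptValue γ r φ α s ≤ brOptValue γ r φ β s := by
  have hα1 : ∀ s a, α s a ≤ 1 := fun s a => (hαβ s a).trans (hβ1 s a)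
  have hβ : ∀ s a, 0 < β s a := fun s a => (hα s a).trans_le (hαβ s a)
  refine (isShiftContraction_iSup (isShiftContraction_brQ (r := r) hγ0 hφ hβ hβ1)).le hγ
    (fun s => ?_) (fun s => (brOptValue_eq hγ0 hγ hφ hβ hβ1 s).ge) s
  rw [brOptValue_eq hγ0 hγ hφ hα hα1 s]
  refine ciSup_mono (Set.finite_range _).bddAbove fun a => ?_
  have := mul_le_mul_of_nonneg_left (rho_mono_level (hφ s a) (hα s a) (hαβ s a) (hβ1 s a)
    (brOptValue γ r φ α)) hγ0.le
  simp only [brQ]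
  linarith

lemma brOptValue_mem [Finite A] [Nonempty A] (hγ0 : 0 < γ) (hγ : γ < 1)
    (hφ : ∀ s a s', 0 < φ s a s') (hα : ∀ s a, 0 < α s a) (hα1 : ∀ s a, α s a ≤ 1)
    (hr : ∀ s a, 0 ≤ r s a ∧ r s a ≤ 1) (s : S) :
    0 ≤ brOptValue γ r φ α s ∧ brOptValue γ r φ α s ≤ 1 / (1 - γ) := by
  have : ∀ s, ∃ a, ∀ b, brQ γ r φ α (brOptValue γ r φ α) s b ≤
      brQ γ r φ α (brOptValue γ r φ α) s a := fun s => Finite.exists_max _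
  choose π hπ using this
  rw [IsBROptimal.brOptValue_eq_brValue hγ0 hγ hφ hα hα1 (π := π) fun s a => hπ s a]
  exact brValue_mem hγ0 hγ hφ hα hα1 hr π s

end BR

/-! ### Values in the true MDP -/

section TrueMDP

variable {S : Type u} {A : Type v} [Fintype S]

/-- The rows of a transition kernel are probability vectors. -/
def IsKernel (P : S → A → S → ℝ) : Prop := ∀ s a, P s a ∈ stdSimplex ℝ S

variable [Fintype A] [DecidableEq S] {γ : ℝ} {r : S → A → ℝ} {P : S → A → S → ℝ}
  {π : ℕ → S → A → ℝ}

lemma stateLaw_mem_stdSimplex (hP : IsKernel P) (hπ : ∀ t x, π t x ∈ stdSimplex ℝ A) (s : S)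
    (t : ℕ) : stateLaw P π s t ∈ stdSimplex ℝ S := by
  induction t with
  | zero =>
    refine ⟨fun x => ?_, by simp [stateLaw]⟩
    simp only [stateLaw]; split_ifs <;> norm_num
  | succ t ih =>
    refine ⟨fun y => Finset.sum_nonneg fun x _ => mul_nonneg (ih.1 x) <|
      Finset.sum_nonneg fun a _ => mul_nonneg ((hπ t x).1 a) ((hP x a).1 y), ?_⟩
    simp only [stateLaw]
    rw [Finset.sum_comm]
    have : ∀ x, ∑ y, stateLaw P π s t x * ∑ a, π t x a * P x a y = stateLaw P π s t x := by
      intro x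
      rw [← Finset.mul_sum, Finset.sum_comm]
      simp_rw [← Finset.mul_sum, (hP x _).2, mul_one, (hπ t x).2, mul_one]
    simp_rw [this]
    exact ih.2

lemma abs_expectedReward_le (hP : IsKernel P) (hπ : ∀ t x, π t x ∈ stdSimplex ℝ A)
    (hr : ∀ s a, |r s a| ≤ 1) (s : S) (t : ℕ) :
    |∑ x, stateLaw P π s t x * ∑ a, π t x a * r x a| ≤ 1 := by
  have hL := stateLaw_mem_stdSimplex hP hπ s t
  have h1 : ∀ x, -1 ≤ ∑ a, π t x a * r x a ∧ ∑ a, π t x a * r x a ≤ 1 := fun x =>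
    linear_mem_of_stdSimplex (hπ t x) (fun a => (abs_le.1 (hr x a)).1)
      (fun a => (abs_le.1 (hr x a)).2)
  exact abs_le.2 (linear_mem_of_stdSimplex hL (fun x => (h1 x).1) (fun x => (h1 x).2))

lemma summable_discounted (hγ0 : 0 < γ) (hγ : γ < 1) (hP : IsKernel P)
    (hπ : ∀ t x, π t x ∈ stdSimplex ℝ A) (hr : ∀ s a, |r s a| ≤ 1) (s : S) :
    Summable fun t : ℕ => γ ^ t * ∑ x, stateLaw P π s t x * ∑ a, π t x a * r x a := by
  refine Summable.of_norm_bounded (summable_geometric_of_lt_one hγ0.le hγ) fun t => ?_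
  rw [Real.norm_eq_abs, abs_mul, abs_of_nonneg (pow_nonneg hγ0.le t)]
  exact mul_le_of_le_one_right (pow_nonneg hγ0.le t) (abs_expectedReward_le hP hπ hr s t)

/-- A supersolution of the evaluation equations of a Markov policy dominates its value. -/
lemma markovValue_le (hγ0 : 0 < γ) (hγ : γ < 1) (hP : IsKernel P)
    (hπ : ∀ t x, π t x ∈ stdSimplex ℝ A) (hr : ∀ s a, |r s a| ≤ 1) {W : S → ℝ}
    (hW : ∀ t x, ∑ a, π t x a * (r x a + γ * ∑ y, P x a y * W y) ≤ W x) (s : S) :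
    markovValue γ r P π s ≤ W s := by
  -- Rewards collected before time n plus the discounted `W` of the state at time n do not increase
  -- with n, and equal `W s` at n = 0. The discounted remainder vanishes in the limit.
  have hpart : ∀ n : ℕ, ∑ t ∈ Finset.range n,
      γ ^ t * ∑ x, stateLaw P π s t x * ∑ a, π t x a * r x a +
        γ ^ n * ∑ x, stateLaw P π s n x * W x ≤ W s := by
    intro n
    induction n with
    | zero => simp [stateLaw]
    | succ n ih =>
      refine le_trans ?_ ih
      rw [Finset.sum_range_succ, add_assoc, add_le_add_iff_left, pow_succ, mul_assoc, ← mul_add]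
      refine mul_le_mul_of_nonneg_left ?_ (pow_nonneg hγ0.le n)
      have hnext : ∑ y, stateLaw P π s (n + 1) y * W y =
          ∑ x, stateLaw P π s n x * ∑ a, π n x a * ∑ y, P x a y * W y := by
        simp only [stateLaw, Finset.sum_mul, Finset.mul_sum]
        rw [Finset.sum_comm]
        refine Finset.sum_congr rfl fun x _ => ?_
        rw [Finset.sum_comm]
        exact Finset.sum_congr rfl fun a _ => Finset.sum_congr rfl fun y _ => by ring
      rw [hnext, Finset.mul_sum, ← Finset.sum_add_distrib]
      refine Finset.sum_le_sum fun x _ => ?_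
      have h1 := mul_le_mul_of_nonneg_left (hW n x)
        ((stateLaw_mem_stdSimplex hP hπ s n).1 x)
      refine le_trans (le_of_eq ?_) h1
      have : ∑ a, π n x a * (r x a + γ * ∑ y, P x a y * W y) =
          ∑ a, π n x a * r x a + γ * ∑ a, π n x a * ∑ y, P x a y * W y := by
        rw [Finset.mul_sum, ← Finset.sum_add_distrib]
        exact Finset.sum_congr rfl fun a _ => by ring
      rw [this]; ring
  have : Nonempty S := ⟨s⟩
  obtain ⟨s₀, hs₀⟩ := Finite.exists_min W
  have h1 := (summable_discounted hγ0 hγ hP hπ hr s).hasSum.tendsto_sum_nat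
  have h2 : Filter.Tendsto (fun n : ℕ => W s - γ ^ n * W s₀) Filter.atTop (nhds (W s)) := by
    have := (tendsto_pow_atTop_nhds_zero_of_lt_one hγ0.le hγ).mul_const (W s₀)
    simpa using this.const_sub (W s)
  refine le_of_tendsto_of_tendsto' h1 h2 fun n => ?_
  have h3 := mul_le_mul_of_nonneg_left (linear_mem_of_stdSimplex
    (stateLaw_mem_stdSimplex hP hπ s n) hs₀ (fun x => le_ciSup (Set.finite_range W).bddAbove x)).1
    (pow_nonneg hγ0.le n)
  linarith [hpart n]

/-- The upper bound applied to −r and −W; this is why rewards are only assumed bounded in absolute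
value here. -/
lemma le_markovValue (hγ0 : 0 < γ) (hγ : γ < 1) (hP : IsKernel P)
    (hπ : ∀ t x, π t x ∈ stdSimplex ℝ A) (hr : ∀ s a, |r s a| ≤ 1) {W : S → ℝ}
    (hW : ∀ t x, W x ≤ ∑ a, π t x a * (r x a + γ * ∑ y, P x a y * W y)) (s : S) :
    W s ≤ markovValue γ r P π s := by
  have h := markovValue_le (r := fun x a => -r x a) (W := fun x => -W x) hγ0 hγ hP hπ
    (fun x a => by rw [abs_neg]; exact hr x a) (fun t x => by
      refine le_trans (le_of_eq ?_) (neg_le_neg (hW t x))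
      rw [← Finset.sum_neg_distrib]
      refine Finset.sum_congr rfl fun a _ => ?_
      simp only [mul_neg, Finset.sum_neg_distrib]
      ring) s
  have h2 : markovValue γ (fun x a => -r x a) P π s = -markovValue γ r P π s := by
    unfold markovValue
    rw [← tsum_neg]
    simp
  rw [h2] at h
  linarith

variable [DecidableEq A]

omit [Fintype S] [DecidableEq S] in
lemma pure_mem_stdSimplex (π : S → A) (x : S) :
    (fun a => if a = π x then (1 : ℝ) else 0) ∈ stdSimplex ℝ A :=
  ⟨fun a => by dsimp only; split_ifs <;> norm_num, by simp⟩

omit [Fintype A] [DecidableEq S] [DecidableEq A] in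
lemma isShiftContraction_trueBackup (hγ0 : 0 < γ) (hP : IsKernel P) (π : S → A) :
    IsShiftContraction γ fun V s => r s (π s) + γ * ∑ y, P s (π s) y * V y := fun V W c h s => by
  have h1 : ∑ y, P s (π s) y * V y ≤ ∑ y, P s (π s) y * W y + c := by
    calc ∑ y, P s (π s) y * V y ≤ ∑ y, P s (π s) y * (W y + c) :=
          Finset.sum_le_sum fun y _ => mul_le_mul_of_nonneg_left (h y) ((hP s (π s)).1 y)
      _ = _ := by simp_rw [mul_add]; rw [Finset.sum_add_distrib, ← Finset.sum_mul, (hP s (π s)).2,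
                    one_mul]
  have := mul_le_mul_of_nonneg_left h1 hγ0.le
  dsimp only
  linarith

lemma trueValue_eq_of_fixedPoint (hγ0 : 0 < γ) (hγ : γ < 1) (hP : IsKernel P)
    (hr : ∀ s a, |r s a| ≤ 1) {π : S → A} {V : S → ℝ}
    (hV : ∀ s, V s = r s (π s) + γ * ∑ y, P s (π s) y * V y) (s : S) :
    trueValue γ r P π s = V s := by
  have h1 : ∀ x, ∑ a, (if a = π x then (1 : ℝ) else 0) * (r x a + γ * ∑ y, P x a y * V y) =
      V x := fun x => by
    rw [hV x]; simp
  exact le_antisymm (markovValue_le hγ0 hγ hP (fun _ => pure_mem_stdSimplex π) hr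
    (fun _ x => (h1 x).le) s) (le_markovValue hγ0 hγ hP (fun _ => pure_mem_stdSimplex π) hr
    (fun _ x => (h1 x).ge) s)

lemma trueValue_eq (hγ0 : 0 < γ) (hγ : γ < 1) (hP : IsKernel P)
    (hr : ∀ s a, |r s a| ≤ 1) (π : S → A) (s : S) :
    trueValue γ r P π s = r s (π s) + γ * ∑ y, P s (π s) y * trueValue γ r P π y := by
  have : Nonempty S := ⟨s⟩
  obtain ⟨V, hV⟩ := (isShiftContraction_trueBackup (r := r) hγ0 hP π).exists_fixedPoint hγ0 hγ
  have := trueValue_eq_of_fixedPoint hγ0 hγ hP hr hV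
  simp_rw [this]
  exact hV s

omit [Fintype S] [Fintype A] [DecidableEq S] [DecidableEq A] in
lemma abs_le_one_of_mem (hr : ∀ s a, 0 ≤ r s a ∧ r s a ≤ 1) (s : S) (a : A) : |r s a| ≤ 1 :=
  abs_le.2 ⟨by linarith [(hr s a).1], (hr s a).2⟩

omit [DecidableEq A] in
lemma markovValue_mem (hγ0 : 0 < γ) (hγ : γ < 1) (hP : IsKernel P)
    (hπ : ∀ t x, π t x ∈ stdSimplex ℝ A) (hr : ∀ s a, 0 ≤ r s a ∧ r s a ≤ 1) (s : S) :
    0 ≤ markovValue γ r P π s ∧ markovValue γ r P π s ≤ 1 / (1 - γ) := by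
  constructor
  · refine le_markovValue (W := fun _ => 0) hγ0 hγ hP hπ (abs_le_one_of_mem hr) (fun t x => ?_) s
    exact Finset.sum_nonneg fun a _ => mul_nonneg ((hπ t x).1 a) (by simpa using (hr x a).1)
  · refine markovValue_le (W := fun _ => 1 / (1 - γ)) hγ0 hγ hP hπ (abs_le_one_of_mem hr)
      (fun t x => ?_) s
    have h2 : 1 + γ * (1 / (1 - γ)) = 1 / (1 - γ) := by
      have : 1 - γ ≠ 0 := by linarith
      field_simp; ring
    have : Nonempty A := by
      by_contra hne
      rw [not_nonempty_iff] at hne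
      have := (hπ t x).2
      simp at this
    refine (linear_mem_of_stdSimplex (hπ t x) (lo := 0) (fun a => ?_) (fun a => ?_)).2
    · have := (hr x a).1
      rw [← Finset.sum_mul, (hP x a).2]
      have : 0 < 1 - γ := by linarith
      positivity
    · rw [← Finset.sum_mul, (hP x a).2, one_mul]
      linarith [(hr x a).2]

lemma trueValue_mem (hγ0 : 0 < γ) (hγ : γ < 1) (hP : IsKernel P)
    (hr : ∀ s a, 0 ≤ r s a ∧ r s a ≤ 1) (π : S → A) (s : S) :
    0 ≤ trueValue γ r P π s ∧ trueValue γ r P π s ≤ 1 / (1 - γ) :=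
  markovValue_mem hγ0 hγ hP (fun _ => pure_mem_stdSimplex π) hr s

variable [Nonempty A]

instance nonempty_markovPolicy :
    Nonempty {π : ℕ → S → A → ℝ // ∀ t x, π t x ∈ stdSimplex ℝ A} :=
  ⟨⟨fun _ _ => fun a => if a = Classical.arbitrary A then 1 else 0,
    fun _ x => pure_mem_stdSimplex (fun _ : S => Classical.arbitrary A) x⟩⟩

/-- A supersolution of the optimality equation dominates the optimal value. -/
lemma trueOptValue_le (hγ0 : 0 < γ) (hγ : γ < 1) (hP : IsKernel P)
    (hr : ∀ s a, |r s a| ≤ 1) {W : S → ℝ}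
    (hW : ∀ x a, r x a + γ * ∑ y, P x a y * W y ≤ W x) (s : S) :
    trueOptValue γ r P s ≤ W s := by
  refine ciSup_le fun π => markovValue_le hγ0 hγ hP π.2 hr (fun t x => ?_) s
  calc ∑ a, π.1 t x a * (r x a + γ * ∑ y, P x a y * W y) ≤ ∑ a, π.1 t x a * W x :=
        Finset.sum_le_sum fun a _ => mul_le_mul_of_nonneg_left (hW x a) ((π.2 t x).1 a)
    _ = W x := by rw [← Finset.sum_mul, (π.2 t x).2, one_mul]

omit [Nonempty A] in
lemma trueValue_le_trueOptValue (hγ0 : 0 < γ) (hγ : γ < 1) (hP : IsKernel P)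
    (hr : ∀ s a, 0 ≤ r s a ∧ r s a ≤ 1) (π : S → A) (s : S) :
    trueValue γ r P π s ≤ trueOptValue γ r P s :=
  le_ciSup (f := fun π : {π : ℕ → S → A → ℝ // ∀ t x, π t x ∈ stdSimplex ℝ A} =>
      markovValue γ r P π.1 s)
    ⟨1 / (1 - γ), by rintro _ ⟨π, rfl⟩; exact (markovValue_mem hγ0 hγ hP π.2 hr s).2⟩
    ⟨fun _ x a => if a = π x then 1 else 0, fun _ => pure_mem_stdSimplex π⟩

lemma trueOptValue_mem (hγ0 : 0 < γ) (hγ : γ < 1) (hP : IsKernel P)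
    (hr : ∀ s a, 0 ≤ r s a ∧ r s a ≤ 1) (s : S) :
    0 ≤ trueOptValue γ r P s ∧ trueOptValue γ r P s ≤ 1 / (1 - γ) :=
  ⟨(trueValue_mem hγ0 hγ hP hr (fun _ => Classical.arbitrary A) s).1.trans
    (trueValue_le_trueOptValue hγ0 hγ hP hr _ s),
    ciSup_le fun π => (markovValue_mem hγ0 hγ hP π.2 hr s).2⟩

/-- The optimal value is attained by a stationary deterministic policy. -/
lemma exists_trueValue_eq_trueOptValue (hγ0 : 0 < γ) (hγ : γ < 1) (hP : IsKernel P)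
    (hr : ∀ s a, 0 ≤ r s a ∧ r s a ≤ 1) (s : S) :
    ∃ π : S → A, trueValue γ r P π s = trueOptValue γ r P s := by
  have : Nonempty S := ⟨s⟩
  obtain ⟨U, hU⟩ := (isShiftContraction_iSup (Q := fun (V : S → ℝ) s (a : A) =>
    r s a + γ * ∑ y, P s a y * V y)
    (isShiftContraction_trueBackup (r := r) hγ0 hP)).exists_fixedPoint hγ0 hγ
  have hmax : ∀ s, ∃ a, ∀ b, r s b + γ * ∑ y, P s b y * U y ≤ r s a + γ * ∑ y, P s a y * U y :=
    fun s => Finite.exists_max _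
  choose π hπ using hmax
  have hle : ∀ x a, r x a + γ * ∑ y, P x a y * U y ≤ U x := fun x a => by
    rw [hU x]
    exact le_ciSup (f := fun a => r x a + γ * ∑ y, P x a y * U y) (Set.finite_range _).bddAbove a
  have hfix : ∀ s, U s = r s (π s) + γ * ∑ y, P s (π s) y * U y := fun s =>
    le_antisymm (by rw [hU s]; exact ciSup_le (hπ s)) (hle s (π s))
  refine ⟨π, le_antisymm (trueValue_le_trueOptValue hγ0 hγ hP hr π s) ?_⟩
  rw [trueValue_eq_of_fixedPoint hγ0 hγ hP (abs_le_one_of_mem hr) hfix s]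
  exact trueOptValue_le hγ0 hγ hP (abs_le_one_of_mem hr) hle s

/-- Reduces an uncountable supremum over Markov policies to a finite one, which makes the optimal
value measurable in the kernel. -/
lemma trueOptValue_eq_iSup (hγ0 : 0 < γ) (hγ : γ < 1) (hP : IsKernel P)
    (hr : ∀ s a, 0 ≤ r s a ∧ r s a ≤ 1) (s : S) :
    trueOptValue γ r P s = ⨆ π : S → A, trueValue γ r P π s := by
  obtain ⟨π, hπ⟩ := exists_trueValue_eq_trueOptValue hγ0 hγ hP hr s
  refine le_antisymm ?_ (ciSup_le fun π => trueValue_le_trueOptValue hγ0 hγ hP hr π s)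
  rw [← hπ]
  exact le_ciSup (f := fun π : S → A => trueValue γ r P π s) (Set.finite_range _).bddAbove π

end TrueMDP

/-! ### Visit counts -/

section Visits

variable {S : Type u} {A : Type v} [Fintype S] [DecidableEq S] [DecidableEq A]

@[simp] lemma visits_nil (x : S) (b : A) : visits ([] : List (S × A × S)) x b = 0 := by
  simp [visits]

lemma visits_append (H L : List (S × A × S)) (x : S) (b : A) :
    visits (H ++ L) x b = visits H x b + visits L x b := by
  simp [visits, List.count_append, Finset.sum_add_distrib]

lemma visits_singleton (s : S) (a : A) (s' : S) (x : S) (b : A) :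
    visits [(s, a, s')] x b = if x = s ∧ b = a then 1 else 0 := by
  simp only [visits, List.count_singleton, beq_iff_eq, Prod.mk.injEq]
  split_ifs with h
  · obtain ⟨rfl, rfl⟩ := h
    simp
  · refine Finset.sum_eq_zero fun y _ => if_neg fun hy => h ⟨hy.1.symm, hy.2.1.symm⟩

lemma visits_le_length (H : List (S × A × S)) (x : S) (b : A) : visits H x b ≤ H.length := by
  induction H using List.reverseRecOn with
  | nil => simp
  | append_singleton L z ih =>
    obtain ⟨s, a, s'⟩ := z
    rw [visits_append, visits_singleton, List.length_append, List.length_singleton]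
    split_ifs <;> omega

lemma sum_visits [Fintype A] (H : List (S × A × S)) : ∑ x, ∑ b, visits H x b = H.length := by
  induction H using List.reverseRecOn with
  | nil => simp
  | append_singleton L z ih =>
    obtain ⟨s, a, s'⟩ := z
    simp_rw [visits_append, visits_singleton, Finset.sum_add_distrib, ih, List.length_append,
      List.length_singleton, ite_and]
    simp

end Visits

/-! ### The transition operator of the algorithm -/

section Run

variable {S : Type u} {A : Type v} [Fintype S] (γ : ℝ) (P : S → A → S → ℝ)
  (pol : ℕ → List (S × A × S) → S → A)

/-- Conditional expectation of a function of the situation after one interaction. -/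
def transition : Module.End ℝ (AlgState S A → ℝ) where
  toFun f c := ∑ o, c.outcomeProb γ P pol o * f (c.next pol o)
  map_add' f g := by ext c; simp [mul_add, Finset.sum_add_distrib]
  map_smul' k f := by
    ext c
    simp only [Pi.smul_apply, smul_eq_mul, RingHom.id_apply, Finset.mul_sum]
    exact Finset.sum_congr rfl fun o _ => by ring

/-- The part of the conditional expectation in which the pseudo-episode continues. -/
def contPart (f : AlgState S A → ℝ) (c : AlgState S A) : ℝ :=
  γ * ∑ s', P c.state (c.action pol) s' * f (c.next pol (s', true))

/-- The part of the conditional expectation in which a new pseudo-episode starts. -/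
def newPart (f : AlgState S A → ℝ) (c : AlgState S A) : ℝ :=
  (1 - γ) * ∑ s', P c.state (c.action pol) s' * f (c.next pol (s', false))

variable {γ P pol}

lemma transition_apply (f : AlgState S A → ℝ) (c : AlgState S A) :
    transition γ P pol f c = ∑ o, c.outcomeProb γ P pol o * f (c.next pol o) := rfl

lemma transition_eq_add (f : AlgState S A → ℝ) (c : AlgState S A) :
    transition γ P pol f c = contPart γ P pol f c + newPart γ P pol f c := by
  rw [transition_apply, Fintype.sum_prod_type, contPart, newPart, Finset.mul_sum, Finset.mul_sum,
    ← Finset.sum_add_distrib]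
  refine Finset.sum_congr rfl fun s' _ => ?_
  simp only [Fintype.sum_bool, AlgState.outcomeProb, if_true, Bool.false_eq_true, if_false]
  ring

lemma outcomeProb_nonneg (hγ0 : 0 < γ) (hγ : γ < 1) (hP : IsKernel P) (c : AlgState S A)
    (o : S × Bool) : 0 ≤ c.outcomeProb γ P pol o := by
  refine mul_nonneg ((hP _ _).1 _) ?_
  split_ifs <;> linarith

lemma sum_outcomeProb (hP : IsKernel P) (c : AlgState S A) :
    ∑ o, c.outcomeProb γ P pol o = 1 := by
  have := transition_eq_add (γ := γ) (P := P) (pol := pol) (fun _ => 1) c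
  simp only [transition_apply, contPart, newPart, mul_one, (hP _ _).2] at this
  rw [this]; ring

lemma transition_const (hP : IsKernel P) (k : ℝ) :
    transition γ P pol (fun _ => k) = fun _ => k := by
  ext c
  rw [transition_apply, ← Finset.sum_mul, sum_outcomeProb hP, one_mul]

lemma transition_pow_const (hP : IsKernel P) (k : ℝ) (n : ℕ) :
    (transition γ P pol ^ n) (fun _ => k) = fun _ => k := by
  induction n with
  | zero => rfl
  | succ n ih => rw [pow_succ, Module.End.mul_apply, transition_const hP, ih]

lemma contPart_mono (hγ0 : 0 < γ) (hP : IsKernel P) {f g : AlgState S A → ℝ} {c : AlgState S A}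
    (h : ∀ o, f (c.next pol o) ≤ g (c.next pol o)) :
    contPart γ P pol f c ≤ contPart γ P pol g c :=
  mul_le_mul_of_nonneg_left (Finset.sum_le_sum fun s' _ =>
    mul_le_mul_of_nonneg_left (h _) ((hP _ _).1 s')) hγ0.le

lemma newPart_nonneg (hγ : γ < 1) (hP : IsKernel P) {f : AlgState S A → ℝ} {c : AlgState S A}
    (h : ∀ s', 0 ≤ f (c.next pol (s', false))) : 0 ≤ newPart γ P pol f c :=
  mul_nonneg (by linarith) (Finset.sum_nonneg fun s' _ => mul_nonneg ((hP _ _).1 s') (h s'))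

lemma contPart_nonneg (hγ0 : 0 < γ) (hP : IsKernel P) {f : AlgState S A → ℝ} {c : AlgState S A}
    (h : ∀ s', 0 ≤ f (c.next pol (s', true))) : 0 ≤ contPart γ P pol f c :=
  mul_nonneg hγ0.le (Finset.sum_nonneg fun s' _ => mul_nonneg ((hP _ _).1 s') (h s'))

lemma contPart_add (f g : AlgState S A → ℝ) (c : AlgState S A) :
    contPart γ P pol (fun c => f c + g c) c = contPart γ P pol f c + contPart γ P pol g c := by
  simp only [contPart, mul_add, Finset.sum_add_distrib]

lemma contPart_const_mul (k : ℝ) (f : AlgState S A → ℝ) (c : AlgState S A) :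
    contPart γ P pol (fun c => k * f c) c = k * contPart γ P pol f c := by
  simp only [contPart, Finset.mul_sum]
  exact Finset.sum_congr rfl fun s' _ => by ring

lemma contPart_sum (n : ℕ) (f : ℕ → AlgState S A → ℝ) (c : AlgState S A) :
    contPart γ P pol (fun c => ∑ j ∈ Finset.range n, f j c) c =
      ∑ j ∈ Finset.range n, contPart γ P pol (f j) c := by
  simp only [contPart, Finset.mul_sum]
  rw [Finset.sum_comm]

lemma contPart_const (hP : IsKernel P) (k : ℝ) (c : AlgState S A) :
    contPart γ P pol (fun _ => k) c = γ * k := by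
  rw [contPart, ← Finset.sum_mul, (hP _ _).2, one_mul]

/-- A family of properties that the successive situations of a run have. -/
def IsInvariant (pol : ℕ → List (S × A × S) → S → A) (I : ℕ → AlgState S A → Prop) : Prop :=
  ∀ n c o, I n c → I (n + 1) (c.next pol o)

/-- The comparison is required only in situations that the invariant allows at the final time;
bookkeeping facts such as `Reachable` fail for arbitrary values of the structure. -/
lemma transition_pow_mono (hγ0 : 0 < γ) (hγ : γ < 1) (hP : IsKernel P)
    {I : ℕ → AlgState S A → Prop} (hI : IsInvariant pol I) {f g : AlgState S A → ℝ} :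
    ∀ {n k : ℕ}, (∀ c, I (k + n) c → f c ≤ g c) → ∀ c, I k c →
      (transition γ P pol ^ n) f c ≤ (transition γ P pol ^ n) g c := by
  intro n
  induction n with
  | zero => intro k h c hc; exact h c hc
  | succ n ih =>
    intro k h c hc
    rw [pow_succ', Module.End.mul_apply, Module.End.mul_apply, transition_apply, transition_apply]
    refine Finset.sum_le_sum fun o _ => mul_le_mul_of_nonneg_left ?_
      (outcomeProb_nonneg hγ0 hγ hP c o)
    exact ih (k := k + 1) (fun c hc => h c (by rwa [show k + (n + 1) = k + 1 + n by ring]))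
      _ (hI k c o hc)

lemma transition_pow_nonneg (hγ0 : 0 < γ) (hγ : γ < 1) (hP : IsKernel P) {f : AlgState S A → ℝ}
    (hf : ∀ c, 0 ≤ f c) (n : ℕ) (c : AlgState S A) : 0 ≤ (transition γ P pol ^ n) f c := by
  have h := transition_pow_mono (I := fun _ _ => True) hγ0 hγ hP (pol := pol) (n := n) (k := 0)
    (fun _ _ _ _ => trivial) (f := fun _ => 0) (g := f) (fun c _ => hf c) c trivial
  rwa [transition_pow_const hP] at h

/-- A quantity dominated by the increments of a bounded potential has a bounded expected sum. -/
lemma sum_transition_pow_le (hγ0 : 0 < γ) (hγ : γ < 1) (hP : IsKernel P)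
    {I : ℕ → AlgState S A → Prop} (hI : IsInvariant pol I) {f Φ : AlgState S A → ℝ} {n : ℕ}
    {B : ℝ} {c₀ : AlgState S A} (hc₀ : I 0 c₀) (hΦ₀ : 0 ≤ Φ c₀)
    (hstep : ∀ k < n, ∀ c, I k c → ∀ o, f c ≤ Φ (c.next pol o) - Φ c)
    (hB : ∀ c, I n c → Φ c ≤ B) :
    ∑ k ∈ Finset.range n, (transition γ P pol ^ k) f c₀ ≤ B := by
  have h1 : ∀ k ∈ Finset.range n, (transition γ P pol ^ k) f c₀ ≤
      (transition γ P pol ^ (k + 1)) Φ c₀ - (transition γ P pol ^ k) Φ c₀ := by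
    intro k hk
    rw [pow_succ, Module.End.mul_apply, ← Pi.sub_apply, ← map_sub]
    refine transition_pow_mono hγ0 hγ hP hI (k := 0) (fun c hc => ?_) c₀ hc₀
    rw [zero_add] at hc
    rw [Pi.sub_apply, transition_apply]
    have h2 : f c + Φ c = ∑ o, c.outcomeProb γ P pol o * (f c + Φ c) := by
      rw [← Finset.sum_mul, sum_outcomeProb hP, one_mul]
    have h3 : ∑ o, c.outcomeProb γ P pol o * (f c + Φ c) ≤
        ∑ o, c.outcomeProb γ P pol o * Φ (c.next pol o) :=
      Finset.sum_le_sum fun o _ => mul_le_mul_of_nonneg_left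
        (by linarith [hstep k (Finset.mem_range.1 hk) c hc o]) (outcomeProb_nonneg hγ0 hγ hP c o)
    linarith
  refine (Finset.sum_le_sum h1).trans ?_
  rw [Finset.sum_range_sub fun k => (transition γ P pol ^ k) Φ c₀, pow_zero, Module.End.one_apply]
  have h4 := transition_pow_mono hγ0 hγ hP hI (k := 0) (n := n) (f := Φ) (g := fun _ => B)
    (fun c hc => hB c (by rwa [zero_add] at hc)) c₀ hc₀
  rw [transition_pow_const hP] at h4
  linarith

/-! ### Expected sums along paths -/

/-- Situation after the first `t` of the outcomes `ω`, starting from `c`. -/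
def stateFrom (pol : ℕ → List (S × A × S) → S → A) (c : AlgState S A) {T : ℕ}
    (ω : Fin T → S × Bool) (t : ℕ) : AlgState S A :=
  ((List.ofFn ω).take t).foldl (AlgState.next pol) c

/-- Induction on the horizon by splitting off the first outcome. Outcomes after time `t` sum to one,
which is the case t = 0 of the induction applied to a constant function. -/
lemma sum_path_eq_transition_pow (hP : IsKernel P) (f : AlgState S A → ℝ) :
    ∀ {T t : ℕ} (_ : t ≤ T) (c : AlgState S A),
      ∑ ω : Fin T → S × Bool,
        (∏ i : Fin T, (stateFrom pol c ω i).outcomeProb γ P pol (ω i)) * f (stateFrom pol c ω t) =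
      (transition γ P pol ^ t) f c := by
  intro T
  induction T generalizing f with
  | zero =>
    intro t ht c
    obtain rfl : t = 0 := by omega
    simp [stateFrom]
  | succ T ih =>
    intro t ht c
    have hcons : ∀ (o : S × Bool) (ω : Fin T → S × Bool) (i : ℕ),
        stateFrom pol c (Fin.cons o ω : Fin (T + 1) → S × Bool) (i + 1) =
          stateFrom pol (c.next pol o) ω i := fun o ω i => by
      simp [stateFrom]
    have hzero : ∀ (ω : Fin (T + 1) → S × Bool), stateFrom pol c ω 0 = c := fun ω => by
      simp [stateFrom]
    have hsum : ∀ F : (Fin (T + 1) → S × Bool) → ℝ,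
        ∑ ω, F ω = ∑ o : S × Bool, ∑ ω : Fin T → S × Bool, F (Fin.cons o ω) := fun F => by
      rw [← (Fin.consEquiv fun _ : Fin (T + 1) => S × Bool).sum_comp, Fintype.sum_prod_type]
      rfl
    rw [hsum]
    simp only [Fin.prod_univ_succ, Fin.cons_zero, Fin.cons_succ, Fin.val_zero,
      Fin.val_succ, hcons, hzero, mul_assoc]
    simp_rw [← Finset.mul_sum]
    cases t with
    | zero =>
      simp only [hzero]
      have h1 : ∀ o, ∑ ω : Fin T → S × Bool, (∏ i : Fin T,
          (stateFrom pol (c.next pol o) ω i).outcomeProb γ P pol (ω i)) * f c = f c := fun o =>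
        ih (fun _ => f c) (Nat.zero_le T) (c.next pol o)
      simp_rw [h1]
      rw [← Finset.sum_mul, sum_outcomeProb hP, one_mul]
      rfl
    | succ t =>
      simp only [hcons]
      simp_rw [ih f (Nat.le_of_succ_le_succ ht)]
      rw [pow_succ', Module.End.mul_apply, transition_apply]

lemma sum_pathProb_eq (hP : IsKernel P) (f : AlgState S A → ℝ) (s₁ : S) (T : ℕ) :
    ∑ ω : Fin T → S × Bool, pathProb γ P pol s₁ ω * ∑ t : Fin T, f (stateAt pol s₁ ω t) =
      ∑ t ∈ Finset.range T, (transition γ P pol ^ t) f (AlgState.start s₁) := by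
  simp_rw [Finset.mul_sum]
  rw [Finset.sum_comm, ← Fin.sum_univ_eq_sum_range
    (fun t => (transition γ P pol ^ t) f (AlgState.start s₁))]
  exact Finset.sum_congr rfl fun t _ => sum_path_eq_transition_pow hP f t.2.le _

/-! ### Invariants of a run -/

/-- Bookkeeping properties of the situation after `n` interactions. -/
structure Reachable (n : ℕ) (c : AlgState S A) : Prop where
  length_hist : c.hist.length = n
  one_le_ep : 1 ≤ c.ep
  ep_le : c.ep ≤ c.epHist.length + 1
  prefix_hist : c.epHist <+: c.hist

omit [Fintype S] in
lemma reachable_start (s₁ : S) : Reachable 0 (AlgState.start s₁ : AlgState S A) :=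
  ⟨rfl, le_rfl, le_rfl, List.prefix_rfl⟩

omit [Fintype S] in
lemma isInvariant_reachable : IsInvariant pol Reachable := by
  rintro n c ⟨s', b⟩ ⟨h1, h2, h3, h4⟩
  have h5 := h4.length_le
  cases b
  · refine ⟨?_, ?_, ?_, List.prefix_rfl⟩ <;> simp [AlgState.next] <;> omega
  · exact ⟨by simp [AlgState.next, h1], h2, h3, h4.trans (List.prefix_append _ _)⟩

/-- A quantity that only depends on the data of the current pseudo-episode. -/
def IsEpisodic (f : AlgState S A → ℝ) : Prop :=
  ∀ c c' : AlgState S A, c.ep = c'.ep → c.epHist = c'.epHist → f c = f c'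

open Classical in
/-- The restriction of a quantity to the starts of pseudo-episodes. -/
def atStart (f : AlgState S A → ℝ) (c : AlgState S A) : ℝ :=
  if c.epHist = c.hist then f c else 0

omit [Fintype S] in
lemma atStart_nonneg {f : AlgState S A → ℝ} (hf : ∀ c, 0 ≤ f c) (c : AlgState S A) :
    0 ≤ atStart f c := by
  unfold atStart; split_ifs <;> [exact hf c; exact le_rfl]

lemma contPart_of_isEpisodic (hP : IsKernel P) {f : AlgState S A → ℝ} (hf : IsEpisodic f)
    (c : AlgState S A) : contPart γ P pol f c = γ * f c := by
  have : ∀ s', f (c.next pol (s', true)) = f c := fun s' => hf _ _ rfl rfl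
  simp only [contPart, this]
  rw [← Finset.sum_mul, (hP _ _).2, one_mul]

/-- Right after a reset the two histories coincide, so `atStart` sees all of the reset part; the
remaining part is nonnegative. -/
lemma newPart_le_transition_atStart (hγ0 : 0 < γ) (hP : IsKernel P) {f : AlgState S A → ℝ}
    (hf0 : ∀ c, 0 ≤ f c) (c : AlgState S A) :
    newPart γ P pol f c ≤ transition γ P pol (atStart f) c := by
  rw [transition_eq_add]
  have h1 : newPart γ P pol (atStart f) c = newPart γ P pol f c := by
    have : ∀ s', atStart f (c.next pol (s', false)) = f (c.next pol (s', false)) := fun s' =>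
      if_pos rfl
    simp only [newPart, this]
  have h2 : 0 ≤ contPart γ P pol (atStart f) c :=
    contPart_nonneg hγ0 hP fun _ => atStart_nonneg hf0 _
  linarith

/-- An episodic quantity is controlled by its values at the starts of pseudo-episodes. -/
lemma transition_pow_episodic_le (hγ0 : 0 < γ) (hγ : γ < 1) (hP : IsKernel P)
    {f : AlgState S A → ℝ} (hf : IsEpisodic f) (hf0 : ∀ c, 0 ≤ f c) (s₁ : S) (t : ℕ) :
    (transition γ P pol ^ t) f (AlgState.start s₁) ≤
      ∑ k ∈ Finset.range (t + 1), (transition γ P pol ^ k) (atStart f) (AlgState.start s₁) := by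
  induction t with
  | zero => simp [atStart, AlgState.start]
  | succ t ih =>
    rw [Finset.sum_range_succ]
    have h1 : (transition γ P pol ^ (t + 1)) f (AlgState.start s₁) ≤
        (transition γ P pol ^ t) (f + transition γ P pol (atStart f)) (AlgState.start s₁) := by
      rw [pow_succ, Module.End.mul_apply]
      refine transition_pow_mono (I := fun _ _ => True) hγ0 hγ hP (fun _ _ _ _ => trivial) (k := 0)
        (fun c _ => ?_) _ trivial
      rw [transition_eq_add, contPart_of_isEpisodic hP hf, Pi.add_apply]
      have := newPart_le_transition_atStart (pol := pol) hγ0 hP hf0 c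
      nlinarith [hf0 c]
    rw [map_add, Pi.add_apply, ← Module.End.mul_apply, ← pow_succ] at h1
    linarith

/-- As pseudo-episodes last `1 / (1 - γ)` steps on average, so does an episodic quantity. -/
lemma sum_transition_pow_episodic_le (hγ0 : 0 < γ) (hγ : γ < 1) (hP : IsKernel P)
    {f : AlgState S A → ℝ} (hf : IsEpisodic f) (hf0 : ∀ c, 0 ≤ f c) (s₁ : S) (T : ℕ) :
    ∑ t ∈ Finset.range T, (transition γ P pol ^ t) f (AlgState.start s₁) ≤
      1 / (1 - γ) *
        ∑ t ∈ Finset.range T, (transition γ P pol ^ t) (atStart f) (AlgState.start s₁) := by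
  set a : ℕ → ℝ := fun t => (transition γ P pol ^ t) f (AlgState.start s₁) with ha
  set b : ℕ → ℝ := fun t => (transition γ P pol ^ t) (atStart f) (AlgState.start s₁) with hb
  have hstep : ∀ t, a (t + 1) ≤ γ * a t + b (t + 1) := by
    intro t
    have h1 : a (t + 1) ≤ (transition γ P pol ^ t) (γ • f + transition γ P pol (atStart f))
        (AlgState.start s₁) := by
      simp only [ha]
      rw [pow_succ, Module.End.mul_apply]
      refine transition_pow_mono (I := fun _ _ => True) hγ0 hγ hP (fun _ _ _ _ => trivial) (k := 0)
        (fun c _ => ?_) _ trivial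
      rw [transition_eq_add, contPart_of_isEpisodic hP hf, Pi.add_apply, Pi.smul_apply,
        smul_eq_mul]
      have := newPart_le_transition_atStart (pol := pol) hγ0 hP hf0 c
      linarith
    rw [map_add, map_smul, Pi.add_apply, Pi.smul_apply, smul_eq_mul, ← Module.End.mul_apply,
      ← pow_succ] at h1
    exact h1
  have h0 : a 0 ≤ b 0 := by simp [ha, hb, atStart, AlgState.start]
  have ha0 : ∀ t, 0 ≤ a t := fun t => transition_pow_nonneg hγ0 hγ hP hf0 t _
  -- The additional multiple of the last term carries the induction: it absorbs the share γ·a(n)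
  -- that the next step inherits.
  have hsum : ∀ n, ∑ t ∈ Finset.range (n + 1), a t + γ / (1 - γ) * a n ≤
      1 / (1 - γ) * ∑ t ∈ Finset.range (n + 1), b t := by
    have h1γ : 0 < 1 - γ := by linarith
    intro n
    induction n with
    | zero =>
      have : a 0 + γ / (1 - γ) * a 0 = 1 / (1 - γ) * a 0 := by field_simp; ring
      simp only [zero_add, Finset.sum_range_one, this]
      exact mul_le_mul_of_nonneg_left h0 (by positivity)
    | succ n ih =>
      rw [Finset.sum_range_succ, Finset.sum_range_succ _ (n + 1), mul_add]
      have h2 := mul_le_mul_of_nonneg_left (hstep n) (show 0 ≤ 1 / (1 - γ) by positivity)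
      have h3 : a (n + 1) + γ / (1 - γ) * a (n + 1) = 1 / (1 - γ) * a (n + 1) := by
        field_simp; ring
      have h4 : 1 / (1 - γ) * (γ * a n + b (n + 1)) =
          γ / (1 - γ) * a n + 1 / (1 - γ) * b (n + 1) := by field_simp
      linarith
  cases T with
  | zero => simp
  | succ n =>
    have := hsum n
    have h5 : 0 ≤ γ / (1 - γ) * a n := mul_nonneg (div_nonneg hγ0.le (by linarith)) (ha0 n)
    linarith

/-- Steps at position at least `m` of their pseudo-episode are rare. -/
def late (m : ℕ) (c : AlgState S A) : ℝ := if c.epHist.length + m ≤ c.hist.length then 1 else 0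

omit [Fintype S] in
lemma late_nonneg (m : ℕ) (c : AlgState S A) : 0 ≤ late m c := by
  unfold late; split_ifs <;> norm_num

/-- A step is at position m+1 or later only if the preceding step continued, with probability γ,
from position m or later; after a reset it is not. So the expectation loses a factor γ with each
decrease of m. -/
lemma transition_pow_late_le (hγ0 : 0 < γ) (hγ : γ < 1) (hP : IsKernel P) (s₁ : S) (n m : ℕ) :
    (transition γ P pol ^ n) (late m) (AlgState.start s₁) ≤ γ ^ m := by
  have hstep : ∀ m, transition γ P pol (late (m + 1)) = γ • late m := by
    intro m
    ext c
    have h1 : ∀ s', late (m + 1) (c.next pol (s', true)) = late m c := fun s' => by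
      simp only [late, AlgState.next, if_true, List.length_append, List.length_singleton]
      congr 1
      exact propext ⟨fun h => by omega, fun h => by omega⟩
    have h2 : ∀ s', late (m + 1) (c.next pol (s', false)) = 0 := fun s' => by
      simp [late, AlgState.next]
    rw [transition_eq_add, contPart, newPart]
    simp only [h1, h2, mul_zero, Finset.sum_const_zero, add_zero]
    rw [← Finset.sum_mul, (hP _ _).2, one_mul, Pi.smul_apply, smul_eq_mul]
  induction n generalizing m with
  | zero =>
    cases m with
    | zero => simp [late, AlgState.start]
    | succ m =>
      have : (0 : ℝ) ≤ γ ^ (m + 1) := by positivity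
      simpa [late, AlgState.start] using this
  | succ n ih =>
    cases m with
    | zero =>
      have h := transition_pow_mono (I := fun _ _ => True) hγ0 hγ hP (pol := pol) (n := n + 1)
        (k := 0) (fun _ _ _ _ => trivial) (f := late 0) (g := fun _ => 1) (fun c _ => by
          unfold late; split_ifs <;> norm_num) (AlgState.start s₁) trivial
      rw [transition_pow_const hP] at h
      simpa using h
    | succ m =>
      rw [pow_succ, Module.End.mul_apply, hstep, map_smul, Pi.smul_apply, smul_eq_mul, pow_succ']
      exact mul_le_mul_of_nonneg_left (ih m) hγ0.le

/-- Unrolling a recursive inequality along the current pseudo-episode for `m` steps. -/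
lemma le_sum_transition_pow_of_contPart (hγ0 : 0 < γ) (hγ : γ < 1) (hP : IsKernel P)
    {I : ℕ → AlgState S A → Prop} (hI : IsInvariant pol I) {D g F : AlgState S A → ℝ} {b e : ℝ}
    (hg0 : ∀ c, 0 ≤ g c) (hF : IsEpisodic F) (hF0 : ∀ c, 0 ≤ F c) (he : 0 ≤ e)
    (hDb : ∀ n c, I n c → D c ≤ b)
    (hD : ∀ n c, I n c → D c ≤ γ * g c + e * F c + contPart γ P pol D c) (m : ℕ) :
    ∀ n c, I n c → D c ≤
      γ * ∑ j ∈ Finset.range m, (transition γ P pol ^ j) g c + e * m * F c + γ ^ m * b := by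
  induction m with
  | zero => intro n c hc; simpa using hDb n c hc
  | succ m ih =>
    intro n c hc
    have h1 : contPart γ P pol D c ≤ contPart γ P pol (fun c =>
        (γ * ∑ j ∈ Finset.range m, (transition γ P pol ^ j) g c + e * m * F c) + γ ^ m * b) c :=
      contPart_mono hγ0 hP fun o => ih (n + 1) _ (hI n c o hc)
    rw [contPart_add, contPart_add, contPart_const_mul, contPart_const_mul, contPart_sum,
      contPart_const hP, contPart_of_isEpisodic hP hF] at h1
    -- The errors are nonnegative, so adding the branch in which a new pseudo-episode starts gives
    -- an upper bound in terms of the run itself.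
    have h2 : ∀ j, contPart γ P pol ((transition γ P pol ^ j) g) c ≤
        (transition γ P pol ^ (j + 1)) g c := by
      intro j
      rw [pow_succ', Module.End.mul_apply, transition_eq_add]
      have := newPart_nonneg (c := c) (pol := pol) hγ hP
        (f := (transition γ P pol ^ j) g) fun s' => transition_pow_nonneg hγ0 hγ hP hg0 j _
      linarith
    have h3 := mul_le_mul_of_nonneg_left (Finset.sum_le_sum fun j (_ : j ∈ Finset.range m) => h2 j)
      hγ0.le
    -- `F` is constant while the pseudo-episode continues; its discount factors are estimated by
    -- one, whence the factor m.
    have h4 : e * m * (γ * F c) ≤ e * m * F c :=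
      mul_le_mul_of_nonneg_left (by nlinarith [hF0 c]) (by positivity)
    have h5 := hD n c hc
    rw [Finset.sum_range_succ', pow_zero, Module.End.one_apply, pow_succ']
    push_cast
    linarith

lemma sum_range_shift_le {a : ℕ → ℝ} (ha : ∀ n, 0 ≤ a n) (T m : ℕ) :
    ∑ t ∈ Finset.range T, ∑ j ∈ Finset.range m, a (t + j) ≤
      m * ∑ h ∈ Finset.range (T + m), a h := by
  rw [Finset.sum_comm]
  have : ∀ j ∈ Finset.range m, ∑ t ∈ Finset.range T, a (t + j) ≤
      ∑ h ∈ Finset.range (T + m), a h := by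
    intro j hj
    have hj' := Finset.mem_range.1 hj
    have h1 : ∑ t ∈ Finset.range T, a (t + j) = ∑ h ∈ Finset.Ico j (T + j), a h := by
      rw [Finset.sum_Ico_eq_sum_range, Nat.add_sub_cancel]
      exact Finset.sum_congr rfl fun t _ => by rw [add_comm]
    rw [h1]
    refine Finset.sum_le_sum_of_subset_of_nonneg (fun h hh => ?_) fun h _ _ => ha h
    rw [Finset.mem_Ico] at hh
    exact Finset.mem_range.2 (by omega)
  refine (Finset.sum_le_sum this).trans ?_
  simp

/-- After summation over t, an error at time h is charged only by the m times preceding it (itself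
included), hence the factor m and the extended range T + m. -/
lemma sum_transition_pow_le_of_contPart (hγ0 : 0 < γ) (hγ : γ < 1) (hP : IsKernel P)
    {I : ℕ → AlgState S A → Prop} (hI : IsInvariant pol I) {D g F : AlgState S A → ℝ} {b e : ℝ}
    (hg0 : ∀ c, 0 ≤ g c) (hF : IsEpisodic F) (hF0 : ∀ c, 0 ≤ F c) (he : 0 ≤ e)
    (hDb : ∀ n c, I n c → D c ≤ b)
    (hD : ∀ n c, I n c → D c ≤ γ * g c + e * F c + contPart γ P pol D c) (m T : ℕ)
    {c₀ : AlgState S A} (hc₀ : I 0 c₀) :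
    ∑ t ∈ Finset.range T, (transition γ P pol ^ t) D c₀ ≤
      γ * m * ∑ h ∈ Finset.range (T + m), (transition γ P pol ^ h) g c₀ +
        e * m * ∑ t ∈ Finset.range T, (transition γ P pol ^ t) F c₀ + T * (γ ^ m * b) := by
  have h1 := le_sum_transition_pow_of_contPart hγ0 hγ hP hI hg0 hF hF0 he hDb hD m
  have h2 : ∀ t ∈ Finset.range T, (transition γ P pol ^ t) D c₀ ≤
      γ * ∑ j ∈ Finset.range m, (transition γ P pol ^ (t + j)) g c₀ +
        e * m * (transition γ P pol ^ t) F c₀ + γ ^ m * b := by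
    intro t _
    have h3 := transition_pow_mono hγ0 hγ hP hI (k := 0) (n := t) (f := D)
      (g := γ • ∑ j ∈ Finset.range m, (transition γ P pol ^ j) g + (e * m) • F +
        fun _ => γ ^ m * b) (fun c hc => by
          simpa [Finset.sum_apply] using h1 _ c hc) c₀ hc₀
    rw [map_add, map_add, map_smul, map_smul, map_sum, Pi.add_apply, Pi.add_apply, Pi.smul_apply,
      Pi.smul_apply, transition_pow_const hP, Finset.sum_apply, smul_eq_mul, smul_eq_mul] at h3
    simp_rw [← Module.End.mul_apply, ← pow_add] at h3
    exact h3
  refine (Finset.sum_le_sum h2).trans ?_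
  rw [Finset.sum_add_distrib, Finset.sum_add_distrib, ← Finset.mul_sum, ← Finset.mul_sum,
    Finset.sum_const, Finset.card_range, nsmul_eq_mul]
  have h4 := sum_range_shift_le (a := fun h => (transition γ P pol ^ h) g c₀)
    (fun h => transition_pow_nonneg hγ0 hγ hP hg0 h c₀) T m
  have h5 := mul_le_mul_of_nonneg_left h4 hγ0.le
  linarith

end Run

/-! ### The posterior law of the kernel -/

section Posterior

variable {S : Type u} {A : Type v} [Fintype S] [DecidableEq S] [Fintype A] [DecidableEq A]

/-- Conditional law of the kernel given the interaction history `H`. -/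
def kernelPosterior (H : List (S × A × S)) : Measure (S → A → S → ℝ) :=
  Measure.pi fun s => Measure.pi fun a => dirichlet (posterior H s a)

omit [Fintype S] [Fintype A] in
lemma posterior_pos (H : List (S × A × S)) (s : S) (a : A) (s' : S) : 0 < posterior H s a s' := by
  unfold posterior; positivity

lemma kernelPosterior_nil : kernelPosterior ([] : List (S × A × S)) = kernelPrior S A := by
  have h : posterior ([] : List (S × A × S)) = fun _ _ _ => 1 := by
    ext s a s'
    simp [posterior]
  rw [kernelPosterior, kernelPrior, h]

instance isProbabilityMeasure_posteriorRow (H : List (S × A × S)) (s : S) (a : A) :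
    IsProbabilityMeasure (dirichlet (posterior H s a)) :=
  isProbabilityMeasure_dirichlet (posterior_pos H s a)

instance isProbabilityMeasure_kernelPosterior (H : List (S × A × S)) :
    IsProbabilityMeasure (kernelPosterior H) := by
  unfold kernelPosterior; infer_instance

lemma measurePreserving_row (H : List (S × A × S)) (s : S) (a : A) :
    MeasurePreserving (fun P : S → A → S → ℝ => P s a) (kernelPosterior H)
      (dirichlet (posterior H s a)) :=
  (measurePreserving_eval (fun a => dirichlet (posterior H s a)) a).comp
    (measurePreserving_eval (fun s => Measure.pi fun a => dirichlet (posterior H s a)) s)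

lemma ae_isKernel (H : List (S × A × S)) : ∀ᵐ P ∂kernelPosterior H, IsKernel P := by
  unfold IsKernel
  rw [ae_all_iff]
  intro s
  rw [ae_all_iff]
  intro a
  have : Nonempty S := ⟨s⟩
  exact (measurePreserving_row H s a).quasiMeasurePreserving.ae
    (dirichlet_ae_mem_stdSimplex (posterior_pos H s a))

omit [Fintype S] [Fintype A] in
lemma posterior_append_self (H : List (S × A × S)) (s : S) (a : A) (s' : S) :
    posterior (H ++ [(s, a, s')]) s a =
      Function.update (posterior H s a) s' (posterior H s a s' + 1) := by
  ext y
  by_cases hy : y = s'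
  · subst hy
    simp [posterior, List.count_append]; ring
  · have : s' ≠ y := fun h => hy h.symm
    simp [posterior, List.count_append, Function.update_of_ne hy, this]

omit [Fintype S] [Fintype A] in
lemma posterior_append_of_ne (H : List (S × A × S)) {s x : S} {a b : A} (s' : S)
    (h : ¬ (x = s ∧ b = a)) : posterior (H ++ [(s, a, s')]) x b = posterior H x b := by
  ext y
  have : ¬ ((s, a, s') = (x, b, y)) := fun he => by
    simp only [Prod.mk.injEq] at he
    exact h ⟨he.1.symm, he.2.1.symm⟩
  simp [posterior, List.count_append, this]

/-- Bayes' rule for one observed transition. -/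
lemma kernelPosterior_withDensity (H : List (S × A × S)) (s : S) (a : A) (s' : S) :
    ∃ c : ℝ≥0∞, c ≠ ∞ ∧ (kernelPosterior H).withDensity (fun P => ENNReal.ofReal (P s a s')) =
      c • kernelPosterior (H ++ [(s, a, s')]) := by
  obtain ⟨c, hc, h⟩ := dirichlet_withDensity_eval (posterior_pos H s a) s'
  rw [← posterior_append_self] at h
  refine ⟨c, hc, ?_⟩
  refine withDensity_eval_pi (fun s => Measure.pi fun a => dirichlet (posterior H s a))
    (fun x => Measure.pi fun b => dirichlet (posterior (H ++ [(s, a, s')]) x b)) s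
    (fun R => ENNReal.ofReal (R a s')) (by fun_prop) c hc ?_ ?_
  · exact withDensity_eval_pi (fun a => dirichlet (posterior H s a))
      (fun b => dirichlet (posterior (H ++ [(s, a, s')]) s b)) a
      (fun p => ENNReal.ofReal (p s')) (by fun_prop) c hc h
      fun b hb => by rw [posterior_append_of_ne H s' fun h => hb h.2]
  · intro x hx
    simp_rw [posterior_append_of_ne H s' fun h : x = s ∧ _ => hx h.1]

/-- The factor z, the predictive probability of the transition, does not depend on f. Inequalities
between posterior expectations therefore propagate from each possible next history to the current
one. -/
lemma integral_mul_kernelPosterior (H : List (S × A × S)) (s : S) (a : A) (s' : S) :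
    ∃ z : ℝ, 0 ≤ z ∧ ∀ f : (S → A → S → ℝ) → ℝ,
      ∫ P, P s a s' * f P ∂kernelPosterior H =
        z * ∫ P, f P ∂kernelPosterior (H ++ [(s, a, s')]) := by
  obtain ⟨c, hc, h⟩ := kernelPosterior_withDensity H s a s'
  refine ⟨c.toReal, ENNReal.toReal_nonneg, fun f => ?_⟩
  rw [← smul_eq_mul, ← integral_smul_measure, ← h,
    integral_withDensity_eq_integral_toReal_smul (by fun_prop)
      (Filter.Eventually.of_forall fun _ => ENNReal.ofReal_lt_top)]
  refine integral_congr_ae ?_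
  filter_upwards [ae_isKernel H] with P hP
  rw [ENNReal.toReal_ofReal ((hP s a).1 s'), smul_eq_mul]

/-! ### Kernel-dependent functions of the situation -/

/-- Functions of the kernel and the situation that are measurable in the kernel, and bounded over
all kernels with stochastic rows. -/
structure IsNice (f : (S → A → S → ℝ) → AlgState S A → ℝ) : Prop where
  measurable : ∀ c, Measurable fun P => f P c
  bounded : ∀ c, ∃ B, ∀ P, IsKernel P → |f P c| ≤ B

omit [DecidableEq S] [DecidableEq A] [Fintype A] in
lemma IsNice.const (g : AlgState S A → ℝ) :
    IsNice fun _ : S → A → S → ℝ => g :=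
  ⟨fun _ => measurable_const, fun c => ⟨|g c|, fun _ _ => le_rfl⟩⟩

lemma IsNice.integrable {f : (S → A → S → ℝ) → AlgState S A → ℝ} (hf : IsNice f)
    (H : List (S × A × S)) (c : AlgState S A) :
    Integrable (fun P => f P c) (kernelPosterior H) := by
  obtain ⟨B, hB⟩ := hf.bounded c
  refine Integrable.of_bound (hf.measurable c).aestronglyMeasurable B ?_
  filter_upwards [ae_isKernel H] with P hP
  exact hB P hP

variable {γ : ℝ} {pol : ℕ → List (S × A × S) → S → A}

omit [Fintype S] [DecidableEq S] [Fintype A] [DecidableEq A] in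
lemma measurable_outcomeProb (c : AlgState S A) (o : S × Bool) :
    Measurable fun P : S → A → S → ℝ => c.outcomeProb γ P pol o := by
  unfold AlgState.outcomeProb
  fun_prop

omit [DecidableEq S] [Fintype A] [DecidableEq A] in
lemma IsNice.transition {f : (S → A → S → ℝ) → AlgState S A → ℝ} (hf : IsNice f)
    (hγ0 : 0 < γ) (hγ : γ < 1) :
    IsNice fun P => AQBRMDP.transition γ P pol (f P) := by
  refine ⟨fun c => ?_, fun c => ?_⟩
  · simp only [transition_apply]
    exact Finset.measurable_fun_sum _ fun o _ => (measurable_outcomeProb c o).mul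
      (hf.measurable _)
  · choose B hB using hf.bounded
    refine ⟨∑ o, B (c.next pol o), fun P hP => ?_⟩
    rw [transition_apply]
    refine (Finset.abs_sum_le_sum_abs _ _).trans (Finset.sum_le_sum fun o _ => ?_)
    have h0 := outcomeProb_nonneg (pol := pol) hγ0 hγ hP c o
    have h1 : c.outcomeProb γ P pol o ≤ 1 := by
      rw [← sum_outcomeProb (γ := γ) (pol := pol) hP c]
      exact Finset.single_le_sum (f := fun o => c.outcomeProb γ P pol o)
        (fun o _ => outcomeProb_nonneg hγ0 hγ hP c o) (Finset.mem_univ o)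
    rw [abs_mul, abs_of_nonneg h0]
    have h2 := hB (c.next pol o) P hP
    nlinarith [abs_nonneg (f P (c.next pol o))]

omit [DecidableEq S] [Fintype A] [DecidableEq A] in
lemma IsNice.transition_pow {f : (S → A → S → ℝ) → AlgState S A → ℝ} (hf : IsNice f)
    (hγ0 : 0 < γ) (hγ : γ < 1) (n : ℕ) :
    IsNice fun P => (AQBRMDP.transition γ P pol ^ n) (f P) := by
  induction n with
  | zero => exact hf
  | succ n ih =>
    simp_rw [pow_succ', Module.End.mul_apply]
    exact ih.transition hγ0 hγ

/-- Comparing posterior expectations in every situation compares their expectations at any later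
time: the posterior is a martingale along the run. -/
lemma integral_transition_pow_mono (hγ0 : 0 < γ) (hγ : γ < 1)
    {f g : (S → A → S → ℝ) → AlgState S A → ℝ} (hf : IsNice f) (hg : IsNice g)
    {I : ℕ → AlgState S A → Prop} (hI : IsInvariant pol I) :
    ∀ {n k : ℕ}, (∀ c, I (k + n) c →
        ∫ P, f P c ∂kernelPosterior c.hist ≤ ∫ P, g P c ∂kernelPosterior c.hist) →
      ∀ c, I k c → ∫ P, (AQBRMDP.transition γ P pol ^ n) (f P) c ∂kernelPosterior c.hist ≤
        ∫ P, (AQBRMDP.transition γ P pol ^ n) (g P) c ∂kernelPosterior c.hist := by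
  intro n
  induction n with
  | zero => intro k h c hc; exact h c hc
  | succ n ih =>
    intro k h c hc
    have hone : ∀ {f : (S → A → S → ℝ) → AlgState S A → ℝ}, IsNice f →
        ∫ P, (AQBRMDP.transition γ P pol) (f P) c ∂kernelPosterior c.hist =
          ∑ o : S × Bool, ∫ P, c.outcomeProb γ P pol o * f P (c.next pol o)
            ∂kernelPosterior c.hist := by
      intro f hf
      simp_rw [transition_apply]
      refine integral_finsetSum _ fun o _ => ?_
      obtain ⟨B, hB⟩ := hf.bounded (c.next pol o)
      refine Integrable.of_bound ((measurable_outcomeProb c o).mul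
        (hf.measurable _)).aestronglyMeasurable B ?_
      filter_upwards [ae_isKernel c.hist] with P hP
      have h0 := outcomeProb_nonneg (pol := pol) hγ0 hγ hP c o
      have h1 : c.outcomeProb γ P pol o ≤ 1 := by
        rw [← sum_outcomeProb (γ := γ) (pol := pol) hP c]
        exact Finset.single_le_sum (f := fun o => c.outcomeProb γ P pol o)
          (fun o _ => outcomeProb_nonneg hγ0 hγ hP c o) (Finset.mem_univ o)
      rw [Real.norm_eq_abs, abs_mul, abs_of_nonneg h0]
      have h2 := hB P hP
      nlinarith [abs_nonneg (f P (c.next pol o))]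
    simp_rw [pow_succ', Module.End.mul_apply]
    rw [hone (hf.transition_pow hγ0 hγ n), hone (hg.transition_pow hγ0 hγ n)]
    refine Finset.sum_le_sum fun o _ => ?_
    obtain ⟨z, hz, hzf⟩ := integral_mul_kernelPosterior c.hist c.state (c.action pol) o.1
    have hw : (0 : ℝ) ≤ if o.2 then γ else 1 - γ := by split_ifs <;> linarith
    have hhist : (c.next pol o).hist = c.hist ++ [(c.state, c.action pol, o.1)] := by
      unfold AlgState.next
      dsimp only
      split_ifs <;> rfl
    -- The outcome probability is the likelihood P(s,a,s') times a weight free of the kernel, so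
    -- Bayes' rule turns this branch into an expectation under the updated posterior.
    have hfac : ∀ F : (S → A → S → ℝ) → ℝ,
        ∫ P, c.outcomeProb γ P pol o * F P ∂kernelPosterior c.hist =
          (if o.2 then γ else 1 - γ) * (z * ∫ P, F P ∂kernelPosterior (c.next pol o).hist) := by
      intro F
      rw [hhist, ← hzf, ← integral_const_mul]
      refine integral_congr_ae (Filter.Eventually.of_forall fun P => ?_)
      simp only [AlgState.outcomeProb]
      ring
    rw [hfac, hfac]
    refine mul_le_mul_of_nonneg_left (mul_le_mul_of_nonneg_left ?_ hz) hw
    exact ih (k := k + 1) (fun c hc => h c (by rwa [show k + (n + 1) = k + 1 + n by ring]))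
      _ (hI k c o hc)

end Posterior

/-! ### Elementary inequalities for the sums of confidence widths -/

section Elementary

lemma sum_sqrt_le {ι : Type*} (s : Finset ι) {y : ι → ℝ} (hy : ∀ i, 0 ≤ y i) :
    ∑ i ∈ s, Real.sqrt (y i) ≤ Real.sqrt (s.card * ∑ i ∈ s, y i) := by
  refine Real.le_sqrt_of_sq_le ?_
  have h := sq_sum_le_card_mul_sum_sq (s := s) (f := fun i => Real.sqrt (y i))
  simp_rw [Real.sq_sqrt (hy _)] at h
  exact h

lemma four_mul_sqrt (x : ℝ) : 4 * Real.sqrt x = Real.sqrt (16 * x) := by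
  rw [Real.sqrt_mul (by norm_num), show (16 : ℝ) = 4 ^ 2 by norm_num, Real.sqrt_sq (by norm_num)]

lemma one_div_sqrt_succ_le (N : ℕ) :
    1 / Real.sqrt ((N : ℝ) + 1) ≤ 2 * (Real.sqrt ((N : ℝ) + 1) - Real.sqrt N) := by
  have h1 : 0 < Real.sqrt ((N : ℝ) + 1) := Real.sqrt_pos.2 (by positivity)
  have h2 : Real.sqrt ((N : ℝ) + 1) * Real.sqrt ((N : ℝ) + 1) = N + 1 :=
    Real.mul_self_sqrt (by positivity)
  have h3 : Real.sqrt (N : ℝ) * Real.sqrt (N : ℝ) = N := Real.mul_self_sqrt (by positivity)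
  rw [div_le_iff₀ h1]
  nlinarith [sq_nonneg (Real.sqrt ((N : ℝ) + 1) - Real.sqrt N)]

/-- The concave function `x ↦ x (log (1 + M / x) + 2)`. -/
def logPotential (M x : ℝ) : ℝ := x * (Real.log (1 + M / x) + 2)

lemma logPotential_nonneg {M x : ℝ} (hM : 0 ≤ M) (hx : 0 ≤ x) : 0 ≤ logPotential M x := by
  have : 0 ≤ Real.log (1 + M / x) :=
    Real.log_nonneg (by linarith [div_nonneg hM hx])
  unfold logPotential
  positivity

/-- Concavity in tangent form, from log u ≤ u − 1 applied to the ratio of the two arguments of the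
logarithm. -/
lemma logPotential_le_tangent {M x y : ℝ} (hM : 0 < M) (hx : 0 < x) (hy : 0 ≤ y) :
    logPotential M y ≤ logPotential M x +
      (Real.log (1 + M / x) + 2 - M / (x + M)) * (y - x) := by
  unfold logPotential
  have key : y * Real.log (1 + M / y) ≤
      y * Real.log (1 + M / x) + M * (x - y) / (x + M) := by
    -- At y = 0 the prefactor kills the logarithm whatever M/0 means. The case is needed because the
    -- potential is later evaluated at x − 1 with x = 1.
    rcases hy.eq_or_lt with rfl | hy
    · simp only [zero_mul, sub_zero, zero_add]; positivity
    · have h1 : 0 < 1 + M / x := by positivity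
      have h2 : 0 < 1 + M / y := by positivity
      have h3 := Real.log_le_sub_one_of_pos (div_pos h2 h1)
      rw [Real.log_div h2.ne' h1.ne'] at h3
      have h4 := mul_le_mul_of_nonneg_left h3 hy.le
      have h5 : y * ((1 + M / y) / (1 + M / x) - 1) = M * (x - y) / (x + M) := by
        field_simp
        ring
      linarith
  have h6 : (Real.log (1 + M / x) + 2 - M / (x + M)) * (y - x) =
      Real.log (1 + M / x) * (y - x) + 2 * (y - x) + M * (x - y) / (x + M) := by ring
  linarith

/-- With F the potential and L = log(1+M/x), the summand 2 in F makes its slope at x at least L+1,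
so F(x−1) ≤ F(x) − (L+1). Also F(x)·L/x = (L+2)L ≤ (L+1)², so the width q satisfies √F(x)·q ≤ L+1.
Squaring √F(x) − q/2 then bounds √F(x−1). -/
lemma sqrt_log_div_le {M x : ℝ} (hM : 0 < M) (hx : 1 ≤ x) :
    Real.sqrt (Real.log (1 + M / x) / x) ≤
      2 * (Real.sqrt (logPotential M x) - Real.sqrt (logPotential M (x - 1))) := by
  have hx0 : 0 < x := by linarith
  set L := Real.log (1 + M / x) with hL
  have hL0 : 0 ≤ L := Real.log_nonneg (by linarith [div_nonneg hM.le hx0.le])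
  have hF : logPotential M x = x * (L + 2) := rfl
  have htan := logPotential_le_tangent hM hx0 (show 0 ≤ x - 1 by linarith)
  have hfrac : M / (x + M) ≤ 1 := (div_le_one (by linarith)).2 (by linarith)
  have h1 : logPotential M (x - 1) ≤ x * (L + 2) - (L + 1) := by
    rw [hF] at htan
    linarith
  set f := Real.sqrt (x * (L + 2)) with hf
  have hf2 : f * f = x * (L + 2) := Real.mul_self_sqrt (by positivity)
  have hf0 : 0 < f := Real.sqrt_pos.2 (by positivity)
  set q := Real.sqrt (L / x) with hq
  have hq0 : 0 ≤ q := Real.sqrt_nonneg _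
  have hq2 : q * q = L / x := Real.mul_self_sqrt (by positivity)
  have hfq : f * q ≤ L + 1 := by
    have h2 : (f * q) ^ 2 ≤ (L + 1) ^ 2 := by
      have : (f * q) ^ 2 = (L + 2) * L := by
        calc (f * q) ^ 2 = (f * f) * (q * q) := by ring
          _ = (L + 2) * L := by rw [hf2, hq2]; field_simp
      rw [this]; nlinarith
    exact (abs_le_of_sq_le_sq' h2 (by linarith)).2
  have hqf : q ≤ 2 * f := by
    have hh : q ≤ (L + 1) / f := by rw [le_div_iff₀ hf0]; linarith
    have : (L + 1) / f ≤ 2 * f := by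
      rw [div_le_iff₀ hf0]
      nlinarith
    linarith
  have h3 : Real.sqrt (logPotential M (x - 1)) ≤ f - q / 2 := by
    refine Real.sqrt_le_iff.2 ⟨by linarith, h1.trans ?_⟩
    nlinarith
  rw [hF]
  linarith

/-- Jensen by a common tangent at X. Its slope is nonnegative, so an upper bound on the average of
the y suffices. -/
lemma sum_logPotential_le {ι : Type*} (s : Finset ι) {y : ι → ℝ} (hy : ∀ i, 0 ≤ y i) {M X : ℝ}
    (hM : 0 < M) (hX : 0 < X) (hsum : ∑ i ∈ s, y i ≤ s.card * X) :
    ∑ i ∈ s, logPotential M (y i) ≤ s.card * logPotential M X := by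
  have hfrac : M / (X + M) ≤ 1 := (div_le_one (by linarith)).2 (by linarith)
  have hL0 : 0 ≤ Real.log (1 + M / X) := Real.log_nonneg (by linarith [div_nonneg hM.le hX.le])
  calc ∑ i ∈ s, logPotential M (y i)
      ≤ ∑ i ∈ s, (logPotential M X +
          (Real.log (1 + M / X) + 2 - M / (X + M)) * (y i - X)) :=
        Finset.sum_le_sum fun i _ => logPotential_le_tangent hM hX (hy i)
    _ = s.card * logPotential M X +
          (Real.log (1 + M / X) + 2 - M / (X + M)) * (∑ i ∈ s, y i - s.card * X) := by
        rw [Finset.sum_add_distrib, ← Finset.mul_sum, Finset.sum_sub_distrib, Finset.sum_const,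
          Finset.sum_const, nsmul_eq_mul, nsmul_eq_mul]
    _ ≤ s.card * logPotential M X := by
        have : (Real.log (1 + M / X) + 2 - M / (X + M)) * (∑ i ∈ s, y i - s.card * X) ≤ 0 :=
          mul_nonpos_of_nonneg_of_nonpos (by linarith) (by linarith)
        linarith

/-- Potential for the number of visits to a pair after its count has doubled during a
pseudo-episode: `n₀` visits before the pseudo-episode, `N` visits in total. -/
def doublingPotential (m n₀ N : ℕ) : ℕ :=
  m * min (Nat.log 2 (max n₀ 1)) (Nat.clog 2 m) +
    if max n₀ 1 < m then min m (N - 1 - 2 * max n₀ 1) else 0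

lemma log_add_one_le_clog {k m : ℕ} (hk : 1 ≤ k) (hkm : k < m) :
    Nat.log 2 k + 1 ≤ Nat.clog 2 m := by
  have h1 : 2 ^ Nat.log 2 k ≤ k := Nat.pow_log_le_self 2 (by omega)
  have h2 : m ≤ 2 ^ Nat.clog 2 m := Nat.le_pow_clog (by norm_num) m
  exact (Nat.pow_lt_pow_iff_right (by norm_num : 1 < 2)).1 (by omega)

/-- While the second summand is active, the initial count is below m, so the logarithm is still one
short of its cap; that spare unit pays for the at most m visits recorded. -/
lemma doublingPotential_le (m n₀ N : ℕ) : doublingPotential m n₀ N ≤ m * Nat.clog 2 m := by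
  unfold doublingPotential
  split_ifs with h
  · have h1 := log_add_one_le_clog (le_max_right n₀ 1) h
    rw [min_eq_left (by omega)]
    calc m * Nat.log 2 (max n₀ 1) + min m (N - 1 - 2 * max n₀ 1)
        ≤ m * Nat.log 2 (max n₀ 1) + m := by gcongr; exact min_le_left _ _
      _ = m * (Nat.log 2 (max n₀ 1) + 1) := by ring
      _ ≤ _ := Nat.mul_le_mul_left m h1
  · simp only [add_zero]
    exact Nat.mul_le_mul_left m (min_le_right _ _)

/-- A charged visit has 2·max(n₀,1) < N < n₀ + m, so max(n₀,1) < m: the second summand is active and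
below its cap. The offset −1 makes the potential rise precisely from the first charged visit on. -/
lemma doublingPotential_succ (m n₀ N : ℕ) :
    doublingPotential m n₀ N + (if N < n₀ + m ∧ 2 * max n₀ 1 < N then 1 else 0) ≤
      doublingPotential m n₀ (N + 1) := by
  unfold doublingPotential
  split_ifs with h1 h2 h2
  · have : min m (N - 1 - 2 * max n₀ 1) + 1 ≤ min m (N + 1 - 1 - 2 * max n₀ 1) := by
      obtain ⟨h3, h4⟩ := h2
      omega
    omega
  · have : min m (N - 1 - 2 * max n₀ 1) ≤ min m (N + 1 - 1 - 2 * max n₀ 1) := by omega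
    omega
  · obtain ⟨h3, h4⟩ := h2
    omega
  · omega

/-- A new pseudo-episode resets the second summand. If that was positive, the count has at least
doubled, and the increase of the logarithm by one, worth m, compensates the loss. -/
lemma doublingPotential_le_self (m : ℕ) {n₀ N : ℕ} (h : n₀ ≤ N) :
    doublingPotential m n₀ N ≤ doublingPotential m N N := by
  have hmono : Nat.log 2 (max n₀ 1) ≤ Nat.log 2 (max N 1) := Nat.log_mono_right (by omega)
  have hbase : m * min (Nat.log 2 (max n₀ 1)) (Nat.clog 2 m) ≤
      m * min (Nat.log 2 (max N 1)) (Nat.clog 2 m) := Nat.mul_le_mul_left m (by omega)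
  by_cases hb : max n₀ 1 < m ∧ 2 * max n₀ 1 ≤ N
  · have h1 := log_add_one_le_clog (le_max_right n₀ 1) hb.1
    have h2 : Nat.log 2 (max n₀ 1) + 1 ≤ Nat.log 2 (max N 1) := by
      rw [← Nat.log_mul_base (by norm_num) (by omega)]
      exact Nat.log_mono_right (by omega)
    calc doublingPotential m n₀ N
        ≤ m * Nat.log 2 (max n₀ 1) + m := by
          unfold doublingPotential
          rw [if_pos hb.1, min_eq_left (by omega)]
          gcongr
          exact min_le_left _ _
      _ = m * (Nat.log 2 (max n₀ 1) + 1) := by ring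
      _ ≤ m * min (Nat.log 2 (max N 1)) (Nat.clog 2 m) := Nat.mul_le_mul_left m (by omega)
      _ ≤ doublingPotential m N N := Nat.le_add_right _ _
  · have h3 : (if max n₀ 1 < m then min m (N - 1 - 2 * max n₀ 1) else 0) = 0 := by
      split_ifs with h4
      · have : ¬ 2 * max n₀ 1 ≤ N := fun h5 => hb ⟨h4, h5⟩
        omega
      · rfl
    unfold doublingPotential
    rw [h3]
    omega

end Elementary

/-! ### Expected sums over the visited pairs -/

section Potentials

variable {S : Type u} {A : Type v} [Fintype S] [DecidableEq S] [Fintype A] [DecidableEq A]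
  {γ : ℝ} {P : S → A → S → ℝ} {pol : ℕ → List (S × A × S) → S → A}

/-- Visits to the current pair before the current pseudo-episode. -/
def epVisits (pol : ℕ → List (S × A × S) → S → A) (c : AlgState S A) : ℕ :=
  visits c.epHist c.state (c.action pol)

/-- Visits to the current pair so far. -/
def curVisits (pol : ℕ → List (S × A × S) → S → A) (c : AlgState S A) : ℕ :=
  visits c.hist c.state (c.action pol)

omit [Fintype A] in
lemma Reachable.visits_le {n : ℕ} {c : AlgState S A} (hc : Reachable n c) (x : S) (b : A) :
    visits c.epHist x b ≤ visits c.hist x b ∧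
      visits c.hist x b + c.epHist.length ≤ visits c.epHist x b + c.hist.length := by
  obtain ⟨L, hL⟩ := hc.prefix_hist
  rw [← hL, visits_append, List.length_append]
  have := visits_le_length L x b
  omega

/-- Summation along a run of a function of the visit counts of the current pair. -/
lemma sum_transition_pow_visits_le (hγ0 : 0 < γ) (hγ : γ < 1) (hP : IsKernel P) (s₁ : S)
    {f : AlgState S A → ℝ} {w ψ : ℕ → ℕ → ℝ} {n : ℕ} {B : ℝ} (hψ₀ : 0 ≤ ψ 0 0)
    (hfw : ∀ k < n, ∀ c, Reachable k c → f c ≤ w (epVisits pol c) (curVisits pol c))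
    (hsucc : ∀ n₀ N, n₀ ≤ N → w n₀ N ≤ ψ n₀ (N + 1) - ψ n₀ N)
    (hself : ∀ n₀ N, n₀ ≤ N → ψ n₀ N ≤ ψ N N)
    (hB : ∀ c : AlgState S A, Reachable n c →
      ∑ x, ∑ b, ψ (visits c.epHist x b) (visits c.hist x b) ≤ B) :
    ∑ k ∈ Finset.range n, (transition γ P pol ^ k) f (AlgState.start s₁) ≤ B := by
  refine sum_transition_pow_le hγ0 hγ hP isInvariant_reachable
    (Φ := fun c => ∑ x, ∑ b, ψ (visits c.epHist x b) (visits c.hist x b))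
    (reachable_start s₁) ?_ ?_ hB
  · exact Finset.sum_nonneg fun x _ => Finset.sum_nonneg fun b _ => by
      simpa [AlgState.start] using hψ₀
  · intro k hk c hc o
    refine (hfw k hk c hc).trans ?_
    set c' := c.next pol o with hc'
    have hhist : c'.hist = c.hist ++ [(c.state, c.action pol, o.1)] := by
      rw [hc']; unfold AlgState.next
      dsimp only
      split_ifs <;> rfl
    have hep : c'.epHist = c.epHist ∨ c'.epHist = c'.hist := by
      rw [hc']; unfold AlgState.next
      dsimp only
      split_ifs
      · exact Or.inl rfl
      · exact Or.inr rfl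
    -- A possible reset replaces the initial count by the current one; the hypothesis `hself` says
    -- that the potential does not drop then.
    have hpair : ∀ x b, ψ (visits c.epHist x b) (visits c'.hist x b) ≤
        ψ (visits c'.epHist x b) (visits c'.hist x b) := by
      intro x b
      rcases hep with h | h
      · rw [h]
      · rw [h]
        refine hself _ _ ((hc.visits_le x b).1.trans ?_)
        rw [hhist, visits_append]
        omega
    have hinc : ∀ x b, ψ (visits c.epHist x b) (visits c.hist x b) +
        (if x = c.state ∧ b = c.action pol then w (epVisits pol c) (curVisits pol c) else 0) ≤
        ψ (visits c.epHist x b) (visits c'.hist x b) := by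
      intro x b
      rw [hhist, visits_append, visits_singleton]
      split_ifs with h
      · obtain ⟨rfl, rfl⟩ := h
        have := hsucc _ _ (hc.visits_le c.state (c.action pol)).1
        simp only [epVisits, curVisits]
        linarith
      · simp
    have hsum : w (epVisits pol c) (curVisits pol c) = ∑ x, ∑ b,
        if x = c.state ∧ b = c.action pol then w (epVisits pol c) (curVisits pol c) else 0 := by
      simp_rw [ite_and]
      simp
    have htot : ∑ x, ∑ b, (ψ (visits c.epHist x b) (visits c.hist x b) +
        (if x = c.state ∧ b = c.action pol then w (epVisits pol c) (curVisits pol c) else 0)) ≤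
        ∑ x, ∑ b, ψ (visits c'.epHist x b) (visits c'.hist x b) :=
      Finset.sum_le_sum fun x _ => Finset.sum_le_sum fun b _ => (hinc x b).trans (hpair x b)
    simp_rw [Finset.sum_add_distrib] at htot
    rw [← hsum] at htot
    linarith

/-- Indicator of a step, among the first `m` of its pseudo-episode, at a pair whose count has more
than doubled since the start of the pseudo-episode. -/
def doubled (m : ℕ) (pol : ℕ → List (S × A × S) → S → A) (c : AlgState S A) : ℝ :=
  if c.hist.length < c.epHist.length + m ∧ 2 * max (epVisits pol c) 1 < curVisits pol c
  then 1 else 0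

/-- A confidence width at a pair whose count has at most doubled. -/
def undoubledWidth (l : AlgState S A → ℝ) (pol : ℕ → List (S × A × S) → S → A)
    (c : AlgState S A) : ℝ :=
  if curVisits pol c ≤ 2 * max (epVisits pol c) 1
  then Real.sqrt (l c / (epVisits pol c + Fintype.card S)) else 0

lemma sum_doubled_le (hγ0 : 0 < γ) (hγ : γ < 1) (hP : IsKernel P) (s₁ : S) (m n : ℕ) :
    ∑ k ∈ Finset.range n, (transition γ P pol ^ k) (doubled m pol) (AlgState.start s₁) ≤
      Fintype.card S * Fintype.card A * (m * Nat.clog 2 m) := by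
  refine sum_transition_pow_visits_le hγ0 hγ hP s₁
    (w := fun n₀ N => if N < n₀ + m ∧ 2 * max n₀ 1 < N then 1 else 0)
    (ψ := fun n₀ N => (doublingPotential m n₀ N : ℝ)) (by positivity) ?_ ?_ ?_ ?_
  · intro k _ c hc
    unfold doubled
    have := (hc.visits_le c.state (c.action pol)).2
    split_ifs with h1 h2 h2
    · exact le_rfl
    · exact absurd ⟨by simp only [epVisits, curVisits]; omega, h1.2⟩ h2
    · exact zero_le_one
    · exact le_rfl
  · intro n₀ N _
    have := doublingPotential_succ m n₀ N
    have h2 : ((doublingPotential m n₀ N : ℕ) : ℝ) +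
        ((if N < n₀ + m ∧ 2 * max n₀ 1 < N then 1 else 0 : ℕ) : ℝ) ≤
        (doublingPotential m n₀ (N + 1) : ℝ) := by exact_mod_cast this
    push_cast at h2
    linarith
  · intro n₀ N h
    exact_mod_cast doublingPotential_le_self m h
  · intro c _
    have h1 : ∀ x b, (doublingPotential m (visits c.epHist x b) (visits c.hist x b) : ℝ) ≤
        (m : ℝ) * Nat.clog 2 m := fun x b => by
      exact_mod_cast doublingPotential_le m _ _
    refine (Finset.sum_le_sum fun x _ => Finset.sum_le_sum fun b _ => h1 x b).trans ?_
    simp [mul_assoc]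

omit [Fintype A] in
-- At most doubling gives N + S ≤ 2(n₀+1) + S ≤ 4(n₀+S), as S ≥ 1, and the factor 4 leaves the
-- square root as 2.
lemma undoubledWidth_le [Nonempty S] {l : AlgState S A → ℝ} {c : AlgState S A} {l' : ℝ}
    (hl' : 0 ≤ l') (h : curVisits pol c ≤ 2 * max (epVisits pol c) 1 → l c ≤ l') :
    undoubledWidth l pol c ≤
      2 * Real.sqrt (l' / (curVisits pol c + Fintype.card S)) := by
  have hS : (1 : ℝ) ≤ Fintype.card S := by exact_mod_cast Fintype.card_pos
  unfold undoubledWidth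
  split_ifs with hle
  · have h1 : (curVisits pol c : ℝ) + Fintype.card S ≤
        4 * ((epVisits pol c : ℝ) + Fintype.card S) := by
      have h2 : (curVisits pol c : ℝ) ≤ 2 * max (epVisits pol c : ℝ) 1 := by exact_mod_cast hle
      have h3 : max (epVisits pol c : ℝ) 1 ≤ epVisits pol c + 1 :=
        max_le (by linarith) (by linarith [(Nat.cast_nonneg (epVisits pol c) : (0 : ℝ) ≤ _)])
      have h4 : (0 : ℝ) ≤ epVisits pol c := Nat.cast_nonneg _
      linarith
    have h5 : l c / (epVisits pol c + Fintype.card S) ≤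
        2 ^ 2 * (l' / (curVisits pol c + Fintype.card S)) := by
      rw [mul_div_assoc', div_le_div_iff₀ (by positivity) (by positivity)]
      have := h hle
      have h6 : (0 : ℝ) ≤ (curVisits pol c : ℝ) + Fintype.card S := by positivity
      nlinarith
    refine (Real.sqrt_le_sqrt h5).trans (le_of_eq ?_)
    rw [Real.sqrt_mul (by norm_num), Real.sqrt_sq (by norm_num)]
  · positivity

omit [DecidableEq S] [DecidableEq A] in
lemma sum_sum_eq_prod (f : S → A → ℝ) : ∑ x, ∑ b, f x b = ∑ i : S × A, f i.1 i.2 :=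
  (Fintype.sum_prod_type' f).symm

/-- N + S is lowered to N + 1, so the widths telescope to 4√(lN) for each pair; Cauchy–Schwarz over
the SA pairs then uses that the counts add up to n. -/
lemma sum_const_width_le (hγ0 : 0 < γ) (hγ : γ < 1) (hP : IsKernel P) (s₁ : S) (n : ℕ) {l : ℝ}
    (hl : 0 ≤ l) :
    ∑ k ∈ Finset.range n, (transition γ P pol ^ k) (undoubledWidth (fun _ => l) pol)
      (AlgState.start s₁) ≤ Real.sqrt (16 * Fintype.card S * Fintype.card A * n * l) := by
  have : Nonempty S := ⟨s₁⟩
  have hS : (1 : ℝ) ≤ Fintype.card S := by exact_mod_cast Fintype.card_pos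
  refine sum_transition_pow_visits_le hγ0 hγ hP s₁
    (w := fun _ N => 2 * (Real.sqrt l * (1 / Real.sqrt ((N : ℝ) + 1))))
    (ψ := fun _ N => 4 * Real.sqrt l * Real.sqrt N) (by simp) ?_ ?_ (fun _ _ _ => le_rfl) ?_
  · intro k _ c _
    refine (undoubledWidth_le hl fun _ => le_rfl).trans ?_
    refine mul_le_mul_of_nonneg_left ?_ (by norm_num)
    rw [mul_one_div, ← Real.sqrt_div' _ (by positivity)]
    refine Real.sqrt_le_sqrt ?_
    gcongr
  · intro _ N _
    have h1 := one_div_sqrt_succ_le N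
    have h2 := mul_le_mul_of_nonneg_left h1 (show 0 ≤ 2 * Real.sqrt l by positivity)
    push_cast
    linarith
  · intro c hc
    rw [sum_sum_eq_prod]
    simp_rw [← Finset.mul_sum]
    have h1 := sum_sqrt_le (Finset.univ : Finset (S × A))
      (y := fun i => (visits c.hist i.1 i.2 : ℝ)) fun i => by positivity
    have h2 : ∑ i : S × A, (visits c.hist i.1 i.2 : ℝ) = n := by
      rw [← sum_sum_eq_prod fun x b => (visits c.hist x b : ℝ)]
      rw [← hc.length_hist, ← sum_visits c.hist]
      push_cast
      rfl
    rw [h2, Finset.card_univ, Fintype.card_prod] at h1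
    refine (mul_le_mul_of_nonneg_left h1 (by positivity)).trans (le_of_eq ?_)
    rw [mul_assoc, ← Real.sqrt_mul hl, four_mul_sqrt]
    push_cast
    ring_nf

/-- The potential is taken at N + S − 1, one below the argument of the width, so that its increment
from N to N + 1 is the one bounded by `sqrt_log_div_le`. Cauchy–Schwarz and Jensen then sum over
pairs. -/
lemma sum_log_width_le [Nonempty A] (hγ0 : 0 < γ) (hγ : γ < 1) (hP : IsKernel P) (s₁ : S) (n : ℕ)
    {l : AlgState S A → ℝ} {M : ℝ} (hM : 0 < M)
    (hl : ∀ k < n, ∀ c, Reachable k c → curVisits pol c ≤ 2 * max (epVisits pol c) 1 →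
      l c ≤ Real.log (1 + M / (curVisits pol c + Fintype.card S))) :
    ∑ k ∈ Finset.range n, (transition γ P pol ^ k) (undoubledWidth l pol)
      (AlgState.start s₁) ≤ Real.sqrt (16 * Fintype.card S * Fintype.card A *
        (n + Fintype.card S ^ 2 * Fintype.card A) *
        (Real.log (1 + Fintype.card S * Fintype.card A * M /
          (n + Fintype.card S ^ 2 * Fintype.card A)) + 2)) := by
  have : Nonempty S := ⟨s₁⟩
  have hS : (1 : ℝ) ≤ Fintype.card S := by exact_mod_cast Fintype.card_pos
  have hA : (1 : ℝ) ≤ Fintype.card A := by exact_mod_cast Fintype.card_pos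
  refine sum_transition_pow_visits_le hγ0 hγ hP s₁
    (w := fun _ N => 2 * Real.sqrt (Real.log (1 + M / ((N : ℝ) + Fintype.card S)) /
      ((N : ℝ) + Fintype.card S)))
    (ψ := fun _ N => 4 * Real.sqrt (logPotential M ((N : ℝ) + Fintype.card S - 1)))
    (by positivity) ?_ ?_ (fun _ _ _ => le_rfl) ?_
  · intro k hk c hc
    refine undoubledWidth_le (Real.log_nonneg ?_) (hl k hk c hc)
    have : 0 ≤ M / ((curVisits pol c : ℝ) + Fintype.card S) := by positivity
    linarith
  · intro _ N _
    have h1 := sqrt_log_div_le hM (x := (N : ℝ) + Fintype.card S)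
      (by linarith [(Nat.cast_nonneg N : (0 : ℝ) ≤ N)])
    have h2 : ((N + 1 : ℕ) : ℝ) + Fintype.card S - 1 = N + Fintype.card S := by push_cast; ring
    rw [h2]
    linarith
  · intro c hc
    have hy : ∀ i : S × A, (0 : ℝ) ≤ (visits c.hist i.1 i.2 : ℝ) + Fintype.card S - 1 := fun i => by
      linarith [(Nat.cast_nonneg (visits c.hist i.1 i.2) : (0 : ℝ) ≤ _)]
    have h2 : ∑ i : S × A, (visits c.hist i.1 i.2 : ℝ) = n := by
      rw [← sum_sum_eq_prod fun x b => (visits c.hist x b : ℝ)]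
      rw [← hc.length_hist, ← sum_visits c.hist]
      push_cast
      rfl
    set K : ℝ := (Fintype.card S : ℝ) * Fintype.card A with hK
    have hKpos : 0 < K := by positivity
    have hcard : ((Finset.univ : Finset (S × A)).card : ℝ) = K := by
      rw [Finset.card_univ, Fintype.card_prod]; push_cast; rfl
    set Y : ℝ := n + Fintype.card S ^ 2 * Fintype.card A with hYdef
    have hY : 0 < Y := by positivity
    -- The arguments add up to n + SA(S−1), enlarged to n + S²A; Y/K is thus an upper bound for
    -- their average.
    have hsum : ∑ i : S × A, ((visits c.hist i.1 i.2 : ℝ) + Fintype.card S - 1) ≤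
        ((Finset.univ : Finset (S × A)).card : ℝ) * (Y / K) := by
      rw [Finset.sum_sub_distrib, Finset.sum_add_distrib, h2, Finset.sum_const, Finset.sum_const,
        nsmul_eq_mul, nsmul_eq_mul, hcard, mul_div_cancel₀ _ hKpos.ne', hYdef, hK]
      nlinarith
    have h3 := sum_logPotential_le (Finset.univ : Finset (S × A)) hy hM (div_pos hY hKpos) hsum
    rw [sum_sum_eq_prod]
    simp_rw [← Finset.mul_sum]
    have h1 := sum_sqrt_le (Finset.univ : Finset (S × A))
      (y := fun i => logPotential M ((visits c.hist i.1 i.2 : ℝ) + Fintype.card S - 1))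
      fun i => logPotential_nonneg hM.le (hy i)
    refine (mul_le_mul_of_nonneg_left h1 (by norm_num)).trans ?_
    rw [hcard] at h3 ⊢
    have h4 : 16 * Fintype.card S * Fintype.card A * Y *
        (Real.log (1 + K * M / Y) + 2) = 16 * (K * (K * logPotential M (Y / K))) := by
      unfold logPotential
      have : M / (Y / K) = K * M / Y := by field_simp
      rw [this, mul_assoc (16 : ℝ), ← hK]
      field_simp
    rw [h4, four_mul_sqrt]
    gcongr

end Potentials

/-! ### The adaptive quantile schedule -/

section Schedule

variable {S : Type u} {A : Type v} [Fintype S] [DecidableEq S] [Fintype A] [DecidableEq A]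

omit [Fintype A] in
lemma visitsPlus_pos (H : List (S × A × S)) (s : S) (a : A) : 0 < visitsPlus H s a :=
  lt_max_of_lt_right one_pos

lemma sum_visitsPlus_le (H : List (S × A × S)) :
    ∑ x, ∑ b, visitsPlus H x b ≤ H.length + (Fintype.card S : ℝ) * Fintype.card A := by
  have h1 : ∀ x b, visitsPlus H x b ≤ (visits H x b : ℝ) + 1 := fun x b =>
    max_le (by linarith) (by linarith [(Nat.cast_nonneg (visits H x b) : (0 : ℝ) ≤ _)])
  refine (Finset.sum_le_sum fun x _ => Finset.sum_le_sum fun b _ => h1 x b).trans (le_of_eq ?_)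
  rw [← sum_visits H]
  simp [Finset.sum_add_distrib]

lemma sum_visitsPlus_pos (H : List (S × A × S)) (s : S) (a : A) :
    0 < ∑ x, ∑ b, visitsPlus H x b :=
  Finset.sum_pos (fun x _ => Finset.sum_pos (fun b _ => visitsPlus_pos H x b) ⟨a, by simp⟩)
    ⟨s, by simp⟩

lemma relVisits_eq (H : List (S × A × S)) (s : S) (a : A) :
    relVisits H s a = (Fintype.card S : ℝ) * Fintype.card A * visitsPlus H s a /
      ∑ x, ∑ b, visitsPlus H x b := by
  have : Nonempty S := ⟨s⟩
  have : Nonempty A := ⟨a⟩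
  have h1 := sum_visitsPlus_pos H s a
  have h2 : (0 : ℝ) < Fintype.card S := by exact_mod_cast Fintype.card_pos
  have h3 : (0 : ℝ) < Fintype.card A := by exact_mod_cast Fintype.card_pos
  unfold relVisits
  field_simp

lemma relVisits_pos (H : List (S × A × S)) (s : S) (a : A) : 0 < relVisits H s a := by
  have : Nonempty S := ⟨s⟩
  have : Nonempty A := ⟨a⟩
  have h2 : (0 : ℝ) < Fintype.card S := by exact_mod_cast Fintype.card_pos
  have h3 : (0 : ℝ) < Fintype.card A := by exact_mod_cast Fintype.card_pos
  rw [relVisits_eq]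
  exact div_pos (mul_pos (by positivity) (visitsPlus_pos H s a)) (sum_visitsPlus_pos H s a)

lemma sum_relVisits [Nonempty S] [Nonempty A] (H : List (S × A × S)) :
    ∑ x, ∑ b, relVisits H x b = (Fintype.card S : ℝ) * Fintype.card A := by
  have h1 := sum_visitsPlus_pos H (Classical.arbitrary S) (Classical.arbitrary A)
  simp_rw [relVisits_eq, ← Finset.sum_div, ← Finset.mul_sum]
  rw [mul_div_assoc, div_self h1.ne', mul_one]

/-- The risk allowance `δ r_k(s, a) ln(2k) / √k`. -/
def allowance (δ : ℝ) (k : ℕ) (H : List (S × A × S)) (s : S) (a : A) : ℝ :=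
  δ * relVisits H s a * (Real.log (2 * k) / Real.sqrt k)

lemma schedule_eq (δ αlo : ℝ) (k : ℕ) (H : List (S × A × S)) (s : S) (a : A) :
    schedule δ αlo k H s a = max (1 - allowance δ k H s a) αlo := rfl

lemma log_two_mul_pos {k : ℕ} (hk : 1 ≤ k) : 0 < Real.log (2 * k) := by
  have : (1 : ℝ) ≤ k := by exact_mod_cast hk
  exact Real.log_pos (by linarith)

lemma allowance_pos {δ : ℝ} (hδ : 0 < δ) {k : ℕ} (hk : 1 ≤ k) (H : List (S × A × S)) (s : S)
    (a : A) : 0 < allowance δ k H s a := by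
  have h1 : (0 : ℝ) < k := by exact_mod_cast hk
  exact mul_pos (mul_pos hδ (relVisits_pos H s a))
    (div_pos (log_two_mul_pos hk) (Real.sqrt_pos.2 h1))

lemma sum_allowance [Nonempty S] [Nonempty A] (δ : ℝ) (k : ℕ) (H : List (S × A × S)) :
    ∑ x, ∑ b, allowance δ k H x b =
      δ * ((Fintype.card S : ℝ) * Fintype.card A) * (Real.log (2 * k) / Real.sqrt k) := by
  unfold allowance
  simp_rw [← Finset.sum_mul, ← Finset.mul_sum, sum_relVisits]

lemma one_sub_schedule_le (δ αlo : ℝ) (k : ℕ) (H : List (S × A × S)) (s : S) (a : A) :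
    1 - schedule δ αlo k H s a ≤ allowance δ k H s a := by
  rw [schedule_eq]
  linarith [le_max_left (1 - allowance δ k H s a) αlo]

lemma le_schedule (δ αlo : ℝ) (k : ℕ) (H : List (S × A × S)) (s : S) (a : A) :
    αlo ≤ schedule δ αlo k H s a := le_max_right _ _

lemma schedule_lt_one {δ αlo : ℝ} (hδ : 0 < δ) (hα : αlo < 1) {k : ℕ} (hk : 1 ≤ k)
    (H : List (S × A × S)) (s : S) (a : A) : schedule δ αlo k H s a < 1 :=
  max_lt (by have := allowance_pos hδ hk H s a; change 1 - allowance δ k H s a < 1; linarith) hα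

/-- The maximum selects one of the two levels, and each of the two nonnegative logarithms on the
right covers one choice. -/
lemma log_schedule_le {δ αlo : ℝ} (hδ : 0 < δ) (hα0 : 0 < αlo) (hα : αlo < 1) {k : ℕ}
    (hk : 1 ≤ k) (H : List (S × A × S)) (s : S) (a : A) :
    Real.log (1 / (1 - schedule δ αlo k H s a)) ≤
      Real.log (1 / (1 - αlo)) + Real.log (1 + 1 / allowance δ k H s a) := by
  have hy := allowance_pos hδ hk H s a
  have h1 : 0 ≤ Real.log (1 / (1 - αlo)) :=
    Real.log_nonneg ((one_le_div (by linarith)).2 (by linarith))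
  have h2 : 0 ≤ Real.log (1 + 1 / allowance δ k H s a) :=
    Real.log_nonneg (by linarith [one_div_pos.2 hy])
  rw [schedule_eq]
  rcases max_choice (1 - allowance δ k H s a) αlo with h | h
  · rw [h, sub_sub_cancel]
    have := Real.log_le_log (one_div_pos.2 hy)
      (show 1 / allowance δ k H s a ≤ 1 + 1 / allowance δ k H s a by linarith)
    linarith
  · rw [h]; linarith

/-- The additional logarithm in the widths due to the adaptive schedule. -/
def scheduleLog (δ : ℝ) (pol : ℕ → List (S × A × S) → S → A) (c : AlgState S A) : ℝ :=
  Real.log (1 + 1 / allowance δ c.ep c.epHist c.state (c.action pol))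

lemma scheduleLog_nonneg {δ : ℝ} (hδ : 0 < δ) {pol : ℕ → List (S × A × S) → S → A}
    {c : AlgState S A} (hk : 1 ≤ c.ep) : 0 ≤ scheduleLog δ pol c :=
  Real.log_nonneg (by linarith [one_div_pos.2 (allowance_pos hδ hk c.epHist c.state (c.action pol))])

/-- The reciprocal allowance is W√k/(SA·δ·ln(2k)·V), V the adjusted count of the pair and W the sum
of all adjusted counts. Here W ≤ n + SA, k ≤ n and ln(2k) ≥ ln 2, while the undoubled condition
gives N + S ≤ 2(S+1)V. This turns 1/V into the decreasing form M/(N+S). -/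
lemma scheduleLog_le {δ : ℝ} (hδ : 0 < δ) {pol : ℕ → List (S × A × S) → S → A} {n k : ℕ}
    (hkn : k < n) {c : AlgState S A} (hc : Reachable k c)
    (hund : curVisits pol c ≤ 2 * max (epVisits pol c) 1) :
    scheduleLog δ pol c ≤ Real.log (1 + 2 * (Fintype.card S + 1) *
      (n + (Fintype.card S : ℝ) * Fintype.card A) * Real.sqrt n /
        ((Fintype.card S : ℝ) * Fintype.card A * δ * Real.log 2) /
          (curVisits pol c + Fintype.card S)) := by
  have : Nonempty S := ⟨c.state⟩
  have : Nonempty A := ⟨c.action pol⟩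
  have hy := allowance_pos hδ hc.one_le_ep c.epHist c.state (c.action pol)
  have hS : (1 : ℝ) ≤ Fintype.card S := by exact_mod_cast Fintype.card_pos
  have hA : (1 : ℝ) ≤ Fintype.card A := by exact_mod_cast Fintype.card_pos
  have hlen : c.epHist.length ≤ k := hc.length_hist ▸ hc.prefix_hist.length_le
  have hep : (c.ep : ℝ) ≤ n := by
    have h1 : c.ep ≤ n := by have := hc.ep_le; omega
    exact_mod_cast h1
  have hep1 : (1 : ℝ) ≤ c.ep := by exact_mod_cast hc.one_le_ep
  have hlenn : (c.epHist.length : ℝ) ≤ n := by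
    have h1 : c.epHist.length ≤ n := by omega
    exact_mod_cast h1
  unfold scheduleLog
  refine Real.log_le_log (by positivity) ?_
  rw [add_le_add_iff_left]
  set V := visitsPlus c.epHist c.state (c.action pol) with hV
  have hVpos : 0 < V := visitsPlus_pos _ _ _
  have hV1 : 1 ≤ V := le_max_right _ _
  set W := ∑ x, ∑ b, visitsPlus c.epHist x b with hW
  have hWpos : 0 < W := sum_visitsPlus_pos c.epHist c.state (c.action pol)
  have hWle : W ≤ n + (Fintype.card S : ℝ) * Fintype.card A :=
    (sum_visitsPlus_le c.epHist).trans (by linarith)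
  set K : ℝ := (Fintype.card S : ℝ) * Fintype.card A with hK
  have hKpos : 0 < K := by positivity
  have hl2 : 0 < Real.log 2 := Real.log_pos (by norm_num)
  have hlog : Real.log 2 ≤ Real.log (2 * c.ep) := Real.log_le_log (by norm_num) (by linarith)
  have hsq : Real.sqrt c.ep ≤ Real.sqrt n := Real.sqrt_le_sqrt hep
  have hsq0 : 0 < Real.sqrt c.ep := Real.sqrt_pos.2 (by linarith)
  have hn0 : 0 < Real.sqrt n := hsq0.trans_le hsq
  have hNS : (curVisits pol c : ℝ) + Fintype.card S ≤ 2 * (Fintype.card S + 1) * V := by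
    have h2 : (curVisits pol c : ℝ) ≤ 2 * V := by
      have : ((curVisits pol c : ℕ) : ℝ) ≤ ((2 * max (epVisits pol c) 1 : ℕ) : ℝ) := by
        exact_mod_cast hund
      push_cast at this
      exact this
    nlinarith
  have heq : 1 / allowance δ c.ep c.epHist c.state (c.action pol) =
      W * Real.sqrt c.ep / (K * δ * Real.log (2 * c.ep) * V) := by
    unfold allowance
    rw [relVisits_eq, ← hK, ← hV, ← hW]
    have : Real.log (2 * c.ep) ≠ 0 := (log_two_mul_pos hc.one_le_ep).ne'
    field_simp
  have hlogk : 0 < Real.log (2 * c.ep) := log_two_mul_pos hc.one_le_ep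
  rw [heq, div_div]
  have hden : 0 < (curVisits pol c : ℝ) + Fintype.card S := by positivity
  rw [div_le_div_iff₀ (by positivity) (by positivity)]
  calc W * Real.sqrt c.ep * (K * δ * Real.log 2 * (curVisits pol c + Fintype.card S))
      ≤ (n + K) * Real.sqrt n *
          (K * δ * Real.log (2 * c.ep) * (2 * (Fintype.card S + 1) * V)) := by
        gcongr
    _ = 2 * (Fintype.card S + 1) * (n + K) * Real.sqrt n *
          (K * δ * Real.log (2 * c.ep) * V) := by ring

end Schedule

/-! ### Sums over the pseudo-episodes that have started -/

section Starts

variable {S : Type u} {A : Type v} [Fintype S] {γ : ℝ} {P : S → A → S → ℝ}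
  {pol : ℕ → List (S × A × S) → S → A}

/-- The potential adds up the weights of all pseudo-episodes whose first step has been made; the
current one enters only when the histories differ. At most T of them can have made their first step
after T interactions. -/
lemma sum_transition_pow_atStart_le (hγ0 : 0 < γ) (hγ : γ < 1) (hP : IsKernel P) (s₁ : S) (T : ℕ)
    {w : ℕ → ℝ} (hw : ∀ k, 0 ≤ w k) :
    ∑ t ∈ Finset.range T, (transition γ P pol ^ t) (atStart fun c => w c.ep) (AlgState.start s₁) ≤
      ∑ k ∈ Finset.range T, w (k + 1) := by
  classical
  refine sum_transition_pow_le hγ0 hγ hP isInvariant_reachable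
    (Φ := fun c => ∑ k ∈ Finset.range (c.ep - 1 + if c.epHist = c.hist then 0 else 1), w (k + 1))
    (reachable_start s₁) (Finset.sum_nonneg fun k _ => hw _) ?_ ?_
  · rintro n _ c hc ⟨s', b⟩
    have hep := hc.one_le_ep
    have hkey : ∑ k ∈ Finset.range ((c.next pol (s', b)).ep - 1 +
        if (c.next pol (s', b)).epHist = (c.next pol (s', b)).hist then 0 else 1), w (k + 1) =
        ∑ k ∈ Finset.range c.ep, w (k + 1) := by
      congr 2
      cases b
      · simp [AlgState.next]
      · have hne : ¬ (c.epHist = c.hist ++ [(c.state, c.action pol, s')]) := fun h => by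
          have h1 := hc.prefix_hist.length_le
          have h2 := congrArg List.length h
          simp only [List.length_append, List.length_singleton] at h2
          omega
        simp only [AlgState.next, if_true, if_neg hne]
        omega
    rw [hkey]
    unfold atStart
    split_ifs with h
    · change w c.ep ≤ _
      rw [add_zero]
      obtain ⟨j, hj⟩ : ∃ j, c.ep = j + 1 := ⟨c.ep - 1, by omega⟩
      rw [hj, Nat.add_sub_cancel, Finset.sum_range_succ]
      linarith
    · rw [Nat.sub_add_cancel hep]; linarith
  · intro c hc
    refine Finset.sum_le_sum_of_subset_of_nonneg (fun k hk => ?_) fun k _ _ => hw _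
    rw [Finset.mem_range] at hk ⊢
    have h1 := hc.ep_le
    have h2 := hc.one_le_ep
    have h3 := hc.prefix_hist.length_le
    have h4 := hc.length_hist
    split_ifs at hk with h
    · omega
    · have h5 : c.epHist.length ≠ c.hist.length := fun he => h (hc.prefix_hist.eq_of_length he)
      omega

/-- The logarithm is replaced by its largest value and the sum of 1/√k telescopes. -/
lemma sum_log_div_sqrt_le (T : ℕ) :
    ∑ k ∈ Finset.range T, Real.log (2 * ((k + 1 : ℕ) : ℝ)) / Real.sqrt ((k + 1 : ℕ) : ℝ) ≤
      2 * Real.sqrt T * Real.log (2 * T) := by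
  have h1 : ∀ k ∈ Finset.range T,
      Real.log (2 * ((k + 1 : ℕ) : ℝ)) / Real.sqrt ((k + 1 : ℕ) : ℝ) ≤
        Real.log (2 * T) * (2 * (Real.sqrt ((k + 1 : ℕ) : ℝ) - Real.sqrt (k : ℝ))) := by
    intro k hk
    have hkT : ((k + 1 : ℕ) : ℝ) ≤ T := by exact_mod_cast Finset.mem_range.1 hk
    have hk1 : (1 : ℝ) ≤ ((k + 1 : ℕ) : ℝ) := by exact_mod_cast Nat.succ_le_succ (Nat.zero_le k)
    have h2 := one_div_sqrt_succ_le k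
    have h3 : Real.log (2 * ((k + 1 : ℕ) : ℝ)) ≤ Real.log (2 * T) :=
      Real.log_le_log (by linarith) (by linarith)
    have h4 : 0 ≤ Real.log (2 * ((k + 1 : ℕ) : ℝ)) := Real.log_nonneg (by linarith)
    rw [div_eq_mul_one_div]
    push_cast at *
    exact mul_le_mul h3 h2 (by positivity) (h4.trans h3)
  refine (Finset.sum_le_sum h1).trans (le_of_eq ?_)
  rw [← Finset.mul_sum, ← Finset.mul_sum, Finset.sum_range_sub fun k : ℕ => Real.sqrt (k : ℝ)]
  simp
  ring

end Starts

/-! ### Exceptional sets of kernels -/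

section Exceptional

variable {S : Type u} {A : Type v}

open Classical in
/-- Indicator that some row of the kernel lies in the set assigned to it. -/
def rowIndicator (B : AlgState S A → S → A → Set (S → ℝ)) (P : S → A → S → ℝ)
    (c : AlgState S A) : ℝ := if ∃ s a, P s a ∈ B c s a then 1 else 0

variable {B : AlgState S A → S → A → Set (S → ℝ)}

lemma rowIndicator_nonneg (P : S → A → S → ℝ) (c : AlgState S A) : 0 ≤ rowIndicator B P c := by
  unfold rowIndicator; split_ifs <;> norm_num

lemma rowIndicator_le_one (P : S → A → S → ℝ) (c : AlgState S A) : rowIndicator B P c ≤ 1 := by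
  unfold rowIndicator; split_ifs <;> norm_num

variable [Fintype S] [DecidableEq S] [Fintype A] [DecidableEq A]

omit [DecidableEq S] [DecidableEq A] in
lemma isNice_rowIndicator (hB : ∀ c s a, MeasurableSet (B c s a)) : IsNice (rowIndicator B) := by
  classical
  refine ⟨fun c => ?_, fun c => ⟨1, fun P _ => ?_⟩⟩
  · refine Measurable.ite ?_ measurable_const measurable_const
    have : {P : S → A → S → ℝ | ∃ s a, P s a ∈ B c s a} =
        ⋃ s, ⋃ a, (fun P : S → A → S → ℝ => P s a) ⁻¹' B c s a := by
      ext P; simp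
    rw [this]
    exact MeasurableSet.iUnion fun s => MeasurableSet.iUnion fun a =>
      (show Measurable fun P : S → A → S → ℝ => P s a by fun_prop) (hB c s a)
  · rw [abs_of_nonneg (rowIndicator_nonneg P c)]
    exact rowIndicator_le_one P c

omit [DecidableEq S] [Fintype A] [DecidableEq A] in
lemma IsNice.atStart {f : (S → A → S → ℝ) → AlgState S A → ℝ} (hf : IsNice f) :
    IsNice fun P => AQBRMDP.atStart (f P) := by
  refine ⟨fun c => ?_, fun c => ?_⟩
  · unfold AQBRMDP.atStart
    split_ifs
    · exact hf.measurable c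
    · exact measurable_const
  · obtain ⟨b, hb⟩ := hf.bounded c
    refine ⟨max b 0, fun P hP => ?_⟩
    unfold AQBRMDP.atStart
    split_ifs
    · exact (hb P hP).trans (le_max_left _ _)
    · simp

/-- A union bound over the rows, each having its Dirichlet posterior as marginal law; independence
plays no role. -/
lemma integral_rowIndicator_le (hB : ∀ c s a, MeasurableSet (B c s a)) (H : List (S × A × S))
    (c : AlgState S A) :
    ∫ P, rowIndicator B P c ∂kernelPosterior H ≤
      ∑ s, ∑ a, (dirichlet (posterior H s a)).real (B c s a) := by
  classical
  have hrow : ∀ s a, MeasurableSet ((fun P : S → A → S → ℝ => P s a) ⁻¹' B c s a) := fun s a =>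
    (show Measurable fun P : S → A → S → ℝ => P s a by fun_prop) (hB c s a)
  have hint : ∀ s a, Integrable (fun P : S → A → S → ℝ =>
      ((fun P : S → A → S → ℝ => P s a) ⁻¹' B c s a).indicator (fun _ => (1 : ℝ)) P)
      (kernelPosterior H) := fun s a => (integrable_const 1).indicator (hrow s a)
  have hle : ∀ P, rowIndicator B P c ≤ ∑ s, ∑ a,
      ((fun P : S → A → S → ℝ => P s a) ⁻¹' B c s a).indicator (fun _ => (1 : ℝ)) P := by
    intro P
    have h0 : ∀ s a, 0 ≤
        ((fun P : S → A → S → ℝ => P s a) ⁻¹' B c s a).indicator (fun _ => (1 : ℝ)) P :=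
      fun s a => Set.indicator_nonneg (fun _ _ => zero_le_one (α := ℝ)) P
    unfold rowIndicator
    split_ifs with h
    · obtain ⟨s, a, hsa⟩ := h
      calc (1 : ℝ) = ((fun P : S → A → S → ℝ => P s a) ⁻¹' B c s a).indicator (fun _ => 1) P :=
            (Set.indicator_of_mem (show P ∈ (fun P : S → A → S → ℝ => P s a) ⁻¹' B c s a from hsa)
              (fun _ => (1 : ℝ))).symm
        _ ≤ ∑ a, ((fun P : S → A → S → ℝ => P s a) ⁻¹' B c s a).indicator (fun _ => 1) P :=
            Finset.single_le_sum (f := fun a =>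
              ((fun P : S → A → S → ℝ => P s a) ⁻¹' B c s a).indicator (fun _ => (1 : ℝ)) P)
              (fun a _ => h0 s a) (Finset.mem_univ a)
        _ ≤ _ := Finset.single_le_sum (f := fun s => ∑ a,
              ((fun P : S → A → S → ℝ => P s a) ⁻¹' B c s a).indicator (fun _ => (1 : ℝ)) P)
              (fun s _ => Finset.sum_nonneg fun a _ => h0 s a) (Finset.mem_univ s)
    · exact Finset.sum_nonneg fun s _ => Finset.sum_nonneg fun a _ => h0 s a
  calc ∫ P, rowIndicator B P c ∂kernelPosterior H
      ≤ ∫ P, ∑ s, ∑ a, ((fun P : S → A → S → ℝ => P s a) ⁻¹' B c s a).indicator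
          (fun _ => (1 : ℝ)) P ∂kernelPosterior H :=
        integral_mono ((isNice_rowIndicator hB).integrable H c)
          (integrable_finsetSum _ fun s _ => integrable_finsetSum _ fun a _ => hint s a) hle
    _ = ∑ s, ∑ a, (dirichlet (posterior H s a)).real (B c s a) := by
        rw [integral_finsetSum _ fun s _ => integrable_finsetSum _ fun a _ => hint s a]
        refine Finset.sum_congr rfl fun s _ => ?_
        rw [integral_finsetSum _ fun a _ => hint s a]
        refine Finset.sum_congr rfl fun a _ => ?_
        rw [integral_indicator (hrow s a), setIntegral_const, smul_eq_mul, mul_one,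
          measureReal_def, measureReal_def,
          (measurePreserving_row H s a).measure_preimage (hB c s a).nullMeasurableSet]

end Exceptional

/-! ### Simulation along a run -/

section Simulation

variable {S : Type u} {A : Type v} [Fintype S] [DecidableEq S] [Fintype A] [DecidableEq A]
  {γ : ℝ} {P : S → A → S → ℝ} {pol : ℕ → List (S × A × S) → S → A}

omit [Fintype A] in
lemma sum_posterior (H : List (S × A × S)) (s : S) (a : A) :
    ∑ s', posterior H s a s' = visits H s a + Fintype.card S := by
  unfold posterior visits
  rw [Finset.sum_add_distrib]
  simp [add_comm]

lemma sqrt_add_le_sqrt_add_sqrt {x y : ℝ} (hx : 0 ≤ x) (hy : 0 ≤ y) :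
    Real.sqrt (x + y) ≤ Real.sqrt x + Real.sqrt y := by
  refine Real.sqrt_le_iff.2 ⟨by positivity, ?_⟩
  nlinarith [Real.sq_sqrt hx, Real.sq_sqrt hy,
    mul_nonneg (Real.sqrt_nonneg x) (Real.sqrt_nonneg y)]

omit [Fintype A] in
lemma undoubledWidth_nonneg (l : AlgState S A → ℝ) (c : AlgState S A) :
    0 ≤ undoubledWidth l pol c := by
  unfold undoubledWidth; split_ifs <;> [exact Real.sqrt_nonneg _; exact le_rfl]

omit [Fintype A] in
lemma doubled_nonneg (m : ℕ) (c : AlgState S A) : 0 ≤ doubled m pol c := by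
  unfold doubled; split_ifs <;> norm_num

omit [Fintype A] in
/-- A bound by the confidence widths holds unless the step is late, the count of the pair has more
than doubled, or the confidence intervals fail. -/
lemma le_widths_of_le_one {m : ℕ} {c : AlgState S A} {ε F : ℝ} (hε : ε ≤ 1) (hF : 0 ≤ F)
    {w W : AlgState S A → ℝ} (hW : ∀ c, 0 ≤ W c)
    (hwW : curVisits pol c ≤ 2 * max (epVisits pol c) 1 → w c ≤ W c)
    (h : F < 1 → ε ≤ w c) :
    ε ≤ late m c + doubled m pol c + W c + F := by
  have h1 := late_nonneg m c
  have h2 := doubled_nonneg (pol := pol) m c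
  have h3 := hW c
  by_cases hF1 : F < 1
  · by_cases hl : c.epHist.length + m ≤ c.hist.length
    · have : late m c = 1 := if_pos hl
      linarith
    · by_cases hd : curVisits pol c ≤ 2 * max (epVisits pol c) 1
      · linarith [hwW hd, h hF1]
      · have : doubled m pol c = 1 := if_pos ⟨by omega, by omega⟩
        linarith
  · linarith

/-- Accumulated difference between two value functions with the same rewards. -/
lemma sum_transition_pow_valueGap_le (hγ0 : 0 < γ) (hγ : γ < 1) (hP : IsKernel P) (s₁ : S)
    {X : AlgState S A → S → ℝ}
    (hX : ∀ c c' : AlgState S A, c.ep = c'.ep → c.epHist = c'.epHist → X c = X c')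
    {ε F W : AlgState S A → ℝ} (hF : IsEpisodic F) (hF0 : ∀ c, 0 ≤ F c) (hW : ∀ c, 0 ≤ W c)
    {m T : ℕ}
    (hXb : ∀ n c, Reachable n c → X c c.state ≤ γ * (1 / (1 - γ)))
    (hXε : ∀ n c, Reachable n c → X c c.state ≤
      γ * (1 / (1 - γ) * ε c) + γ * ∑ s', P c.state (c.action pol) s' * X c s')
    (hε : ∀ n c, Reachable n c → ε c ≤ late m c + doubled m pol c + W c + F c) :
    ∑ t ∈ Finset.range T, (transition γ P pol ^ t) (fun c => X c c.state) (AlgState.start s₁) ≤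
      γ * m / (1 - γ) * (((T + m : ℕ) : ℝ) * γ ^ m +
        Fintype.card S * Fintype.card A * (m * Nat.clog 2 m) +
        ∑ h ∈ Finset.range (T + m), (transition γ P pol ^ h) W (AlgState.start s₁)) +
      γ * m / (1 - γ) *
        ∑ t ∈ Finset.range T, (transition γ P pol ^ t) F (AlgState.start s₁) +
      T * (γ ^ m * (γ / (1 - γ))) := by
  have hD : 0 < 1 / (1 - γ) := one_div_pos.2 (by linarith)
  -- `X` is fixed during a pseudo-episode, so a continuing step of the run is the operator γP acting
  -- on a single function.
  have hcont : ∀ c : AlgState S A, contPart γ P pol (fun c => X c c.state) c =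
      γ * ∑ s', P c.state (c.action pol) s' * X c s' := fun c => by
    unfold contPart
    refine congrArg _ (Finset.sum_congr rfl fun s' _ => ?_)
    change _ * X (c.next pol (s', true)) s' = _
    rw [hX (c.next pol (s', true)) c rfl rfl]
  set g : AlgState S A → ℝ := (1 / (1 - γ)) • (late m + doubled m pol + W) with hg
  have hgc : ∀ c, g c = 1 / (1 - γ) * (late m c + doubled m pol c + W c) := fun c => rfl
  have main := sum_transition_pow_le_of_contPart (pol := pol) hγ0 hγ hP isInvariant_reachable
    (D := fun c => X c c.state) (g := g) (F := F) (b := γ * (1 / (1 - γ)))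
    (e := γ * (1 / (1 - γ)))
    (fun c => by
      rw [hgc]
      have := late_nonneg m c
      have := doubled_nonneg (pol := pol) m c
      have := hW c
      positivity) hF hF0 (by positivity) hXb
    (fun n c hc => by
      rw [hcont, hgc]
      refine (hXε n c hc).trans ?_
      have := mul_le_mul_of_nonneg_left (hε n c hc) (by positivity : 0 ≤ γ * (1 / (1 - γ)))
      nlinarith) m T (reachable_start s₁)
  have hsum : ∑ h ∈ Finset.range (T + m), (transition γ P pol ^ h) g (AlgState.start s₁) ≤
      1 / (1 - γ) * (((T + m : ℕ) : ℝ) * γ ^ m +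
        Fintype.card S * Fintype.card A * (m * Nat.clog 2 m) +
        ∑ h ∈ Finset.range (T + m), (transition γ P pol ^ h) W (AlgState.start s₁)) := by
    simp only [hg, map_smul, map_add, Pi.smul_apply, Pi.add_apply, smul_eq_mul, ← Finset.mul_sum,
      Finset.sum_add_distrib]
    refine mul_le_mul_of_nonneg_left (add_le_add (add_le_add ?_ ?_) le_rfl) hD.le
    · refine (Finset.sum_le_sum fun h _ => transition_pow_late_le hγ0 hγ hP s₁ h m).trans ?_
      simp
    · exact sum_doubled_le hγ0 hγ hP s₁ m _
  have := mul_le_mul_of_nonneg_left hsum (by positivity : 0 ≤ γ * m)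
  calc _ ≤ _ := main
    _ ≤ γ * m * (1 / (1 - γ) * (((T + m : ℕ) : ℝ) * γ ^ m +
        Fintype.card S * Fintype.card A * (m * Nat.clog 2 m) +
        ∑ h ∈ Finset.range (T + m), (transition γ P pol ^ h) W (AlgState.start s₁))) +
        γ * (1 / (1 - γ)) * m *
          ∑ t ∈ Finset.range T, (transition γ P pol ^ t) F (AlgState.start s₁) +
        T * (γ ^ m * (γ * (1 / (1 - γ)))) := by linarith
    _ = _ := by ring

end Simulation

/-! ### The values in a run -/

section RunValues

variable {S : Type u} {A : Type v} [Fintype S] [DecidableEq S] [Fintype A] [DecidableEq A]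
  {γ δ αlo L : ℝ} {r : S → A → ℝ} {P : S → A → S → ℝ}
  {pol : ℕ → List (S × A × S) → S → A}

/-- Value of the current policy at the adaptive quantile levels. -/
def adaptiveValue (γ : ℝ) (r : S → A → ℝ) (δ αlo : ℝ) (pol : ℕ → List (S × A × S) → S → A)
    (c : AlgState S A) : S → ℝ :=
  brValue γ r (posterior c.epHist) (schedule δ αlo c.ep c.epHist) (c.policy pol)

/-- Value of the current policy at the constant quantile level `αlo`. -/
def robustValue (γ : ℝ) (r : S → A → ℝ) (αlo : ℝ) (pol : ℕ → List (S × A × S) → S → A)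
    (c : AlgState S A) : S → ℝ :=
  brValue γ r (posterior c.epHist) (fun _ _ => αlo) (c.policy pol)

/-- Confidence radius at level `exp (-L)` under the posterior at the start of the episode. -/
def radius (L : ℝ) (c : AlgState S A) (s : S) (a : A) : ℝ :=
  Real.sqrt (L / ∑ s', posterior c.epHist s a s')

/-- Rows under which the value `V` is exceptionally low. -/
def lowRows (γ L : ℝ) (V : AlgState S A → S → ℝ) (c : AlgState S A) (s : S) (a : A) :
    Set (S → ℝ) :=
  {p | ∑ s', p s' * V c s' <
    weightedMean (posterior c.epHist s a) (V c) - 1 / (1 - γ) * radius L c s a}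

/-- Rows under which the value `V` is exceptionally high. -/
def highRows (γ L : ℝ) (V : AlgState S A → S → ℝ) (c : AlgState S A) (s : S) (a : A) :
    Set (S → ℝ) :=
  {p | weightedMean (posterior c.epHist s a) (V c) + 1 / (1 - γ) * radius L c s a <
    ∑ s', p s' * V c s'}

/-- Rows under which the value `V` exceeds its quantile. -/
def aboveQuantileRows (δ αlo : ℝ) (V : AlgState S A → S → ℝ) (c : AlgState S A) (s : S) (a : A) :
    Set (S → ℝ) :=
  {p | rho (posterior c.epHist s a) (schedule δ αlo c.ep c.epHist s a) (V c) <
    ∑ s', p s' * V c s'}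

omit [DecidableEq S] in
lemma measurableSet_linear_lt (V : S → ℝ) (q : ℝ) :
    MeasurableSet {p : S → ℝ | ∑ s, p s * V s < q} :=
  measurableSet_lt (by fun_prop) measurable_const

omit [Fintype A] in
lemma sum_posterior_mul_radius_sq (hL : 0 ≤ L) (c : AlgState S A) (s : S) (a : A) :
    (∑ s', posterior c.epHist s a s') * radius L c s a ^ 2 = L := by
  have : Nonempty S := ⟨s⟩
  have h : 0 < ∑ s', posterior c.epHist s a s' :=
    Finset.sum_pos (fun s' _ => posterior_pos _ _ _ _) Finset.univ_nonempty
  unfold radius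
  rw [Real.sq_sqrt (by positivity)]
  field_simp

omit [Fintype A] in
lemma dirichlet_lowRows_le (hγ : γ < 1) (hL : 0 ≤ L) {V : AlgState S A → S → ℝ}
    {c : AlgState S A} (hV : ∀ s, 0 ≤ V c s ∧ V c s ≤ 1 / (1 - γ)) (s : S) (a : A) :
    (dirichlet (posterior c.epHist s a)).real (lowRows γ L V c s a) ≤ Real.exp (-L) := by
  have : Nonempty S := ⟨s⟩
  have := dirichlet_lower_tail (posterior_pos c.epHist s a)
    (one_div_pos.2 (by linarith : 0 < 1 - γ)) (V := V c) (lo := 0) (fun s => (hV s).1)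
    (fun s => by simpa using (hV s).2) (Real.sqrt_nonneg _ : 0 ≤ radius L c s a)
  exact this.trans_eq (by rw [← radius, sum_posterior_mul_radius_sq hL])

omit [Fintype A] in
lemma dirichlet_highRows_le (hγ : γ < 1) (hL : 0 ≤ L) {V : AlgState S A → S → ℝ}
    {c : AlgState S A} (hV : ∀ s, 0 ≤ V c s ∧ V c s ≤ 1 / (1 - γ)) (s : S) (a : A) :
    (dirichlet (posterior c.epHist s a)).real (highRows γ L V c s a) ≤ Real.exp (-L) := by
  have : Nonempty S := ⟨s⟩
  have := dirichlet_upper_tail (posterior_pos c.epHist s a)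
    (one_div_pos.2 (by linarith : 0 < 1 - γ)) (V := V c) (lo := 0) (fun s => (hV s).1)
    (fun s => by simpa using (hV s).2) (Real.sqrt_nonneg _ : 0 ≤ radius L c s a)
  exact this.trans_eq (by rw [← radius, sum_posterior_mul_radius_sq hL])

omit [Fintype S] [DecidableEq S] [Fintype A] [DecidableEq A] in
lemma not_mem_of_rowIndicator_lt_one {B : AlgState S A → S → A → Set (S → ℝ)} {c : AlgState S A}
    (h : rowIndicator B P c < 1) (s : S) (a : A) : P s a ∉ B c s a := fun hm => by
  unfold rowIndicator at h
  rw [if_pos ⟨s, a, hm⟩] at h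
  exact lt_irrefl _ h

omit [Fintype S] [DecidableEq S] [Fintype A] [DecidableEq A] in
lemma isEpisodic_rowIndicator {B : AlgState S A → S → A → Set (S → ℝ)}
    (hB : ∀ c c' : AlgState S A, c.ep = c'.ep → c.epHist = c'.epHist → B c = B c') :
    IsEpisodic (rowIndicator B P) := fun c c' h1 h2 => by
  unfold rowIndicator
  rw [hB c c' h1 h2]

lemma adaptiveValue_congr (c c' : AlgState S A) (h1 : c.ep = c'.ep) (h2 : c.epHist = c'.epHist) :
    adaptiveValue γ r δ αlo pol c = adaptiveValue γ r δ αlo pol c' := by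
  unfold adaptiveValue AlgState.policy
  rw [h1, h2]

omit [Fintype A] in
lemma robustValue_congr (c c' : AlgState S A) (h1 : c.ep = c'.ep) (h2 : c.epHist = c'.epHist) :
    robustValue γ r αlo pol c = robustValue γ r αlo pol c' := by
  unfold robustValue AlgState.policy
  rw [h1, h2]

omit [Fintype A] in
lemma lowRows_congr {V : AlgState S A → S → ℝ}
    (hV : ∀ c c' : AlgState S A, c.ep = c'.ep → c.epHist = c'.epHist → V c = V c') (c c' : AlgState S A)
    (h1 : c.ep = c'.ep) (h2 : c.epHist = c'.epHist) :
    lowRows γ L V c = lowRows γ L V c' := by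
  ext s a p
  simp only [lowRows, radius, hV c c' h1 h2, h2]

omit [Fintype A] in
lemma highRows_congr {V : AlgState S A → S → ℝ}
    (hV : ∀ c c' : AlgState S A, c.ep = c'.ep → c.epHist = c'.epHist → V c = V c') (c c' : AlgState S A)
    (h1 : c.ep = c'.ep) (h2 : c.epHist = c'.epHist) :
    highRows γ L V c = highRows γ L V c' := by
  ext s a p
  simp only [highRows, radius, hV c c' h1 h2, h2]

lemma aboveQuantileRows_congr {V : AlgState S A → S → ℝ}
    (hV : ∀ c c' : AlgState S A, c.ep = c'.ep → c.epHist = c'.epHist → V c = V c') (c c' : AlgState S A) (h1 : c.ep = c'.ep)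
    (h2 : c.epHist = c'.epHist) :
    aboveQuantileRows δ αlo V c = aboveQuantileRows δ αlo V c' := by
  ext s a p
  simp only [aboveQuantileRows, hV c c' h1 h2, h1, h2]

lemma adaptiveValue_mem (hγ0 : 0 < γ) (hγ : γ < 1) (hδ : 0 < δ) (hα0 : 0 < αlo) (hα : αlo < 1)
    (hr : ∀ s a, 0 ≤ r s a ∧ r s a ≤ 1) {c : AlgState S A} (hc : 1 ≤ c.ep) (s : S) :
    0 ≤ adaptiveValue γ r δ αlo pol c s ∧ adaptiveValue γ r δ αlo pol c s ≤ 1 / (1 - γ) :=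
  have : Nonempty S := ⟨s⟩
  brValue_mem hγ0 hγ (posterior_pos _) (fun s a => hα0.trans_le (le_schedule _ _ _ _ s a))
    (fun s a => (schedule_lt_one hδ hα hc _ s a).le) hr _ s

omit [Fintype A] in
lemma robustValue_mem (hγ0 : 0 < γ) (hγ : γ < 1) (hα0 : 0 < αlo) (hα : αlo < 1)
    (hr : ∀ s a, 0 ≤ r s a ∧ r s a ≤ 1) (c : AlgState S A) (s : S) :
    0 ≤ robustValue γ r αlo pol c s ∧ robustValue γ r αlo pol c s ≤ 1 / (1 - γ) :=
  have : Nonempty S := ⟨s⟩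
  brValue_mem hγ0 hγ (posterior_pos _) (fun _ _ => hα0) (fun _ _ => hα.le) hr _ s

/-- Expected accumulated optimism of the adaptive value of the current policy. -/
lemma sum_adaptiveValue_sub_trueValue_le (hγ0 : 0 < γ) (hγ : γ < 1) (hP : IsKernel P)
    (hδ : 0 < δ) (hα0 : 0 < αlo) (hα : αlo < 1) (hr : ∀ s a, 0 ≤ r s a ∧ r s a ≤ 1) (hL : 0 ≤ L)
    (s₁ : S) (m T : ℕ) (hT : 1 ≤ T) :
    ∑ t ∈ Finset.range T, (transition γ P pol ^ t)
        (fun c => adaptiveValue γ r δ αlo pol c c.state - trueValue γ r P (c.policy pol) c.state)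
        (AlgState.start s₁) ≤
      γ * m / (1 - γ) * (((T + m : ℕ) : ℝ) * γ ^ m +
        Fintype.card S * Fintype.card A * (m * Nat.clog 2 m) +
        (Real.sqrt (16 * Fintype.card S * Fintype.card A * ((T + m : ℕ) : ℝ) *
            Real.log (1 / (1 - αlo))) +
          Real.sqrt (16 * Fintype.card S * Fintype.card A *
            (((T + m : ℕ) : ℝ) + Fintype.card S ^ 2 * Fintype.card A) *
            (Real.log (1 + Fintype.card S * Fintype.card A *
              (2 * (Fintype.card S + 1) * (((T + m : ℕ) : ℝ) + Fintype.card S * Fintype.card A) *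
                Real.sqrt ((T + m : ℕ) : ℝ) /
                  (Fintype.card S * Fintype.card A * δ * Real.log 2)) /
              (((T + m : ℕ) : ℝ) + Fintype.card S ^ 2 * Fintype.card A)) + 2)) +
          Real.sqrt (16 * Fintype.card S * Fintype.card A * ((T + m : ℕ) : ℝ) * L))) +
      γ * m / (1 - γ) *
        ∑ t ∈ Finset.range T, (transition γ P pol ^ t)
          (rowIndicator (lowRows γ L (adaptiveValue γ r δ αlo pol)) P) (AlgState.start s₁) +
      T * (γ ^ m * (γ / (1 - γ))) := by
  have : Nonempty S := ⟨s₁⟩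
  have : Nonempty A := ⟨pol 0 [] s₁⟩
  have hS : (0 : ℝ) < Fintype.card S := by exact_mod_cast Fintype.card_pos
  have hA : (0 : ℝ) < Fintype.card A := by exact_mod_cast Fintype.card_pos
  have hD : 0 < 1 / (1 - γ) := one_div_pos.2 (by linarith)
  have hl1 : 0 ≤ Real.log (1 / (1 - αlo)) :=
    Real.log_nonneg ((one_le_div (by linarith)).2 (by linarith))
  set V := adaptiveValue γ r δ αlo pol with hVdef
  set B := lowRows γ L V with hB
  set X : AlgState S A → S → ℝ := fun c s => V c s - trueValue γ r P (c.policy pol) s with hX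
  set W : AlgState S A → ℝ := undoubledWidth (fun _ => Real.log (1 / (1 - αlo))) pol +
    undoubledWidth (scheduleLog δ pol) pol + undoubledWidth (fun _ => L) pol with hW
  -- The factor 1 − γ normalizes the error by the range 1/(1−γ) of the values, so that ε ≤ 1 always
  -- and an exceptional step is charged at most one.
  set ε : AlgState S A → ℝ := fun c => (1 - γ) *
    (rho (posterior c.epHist c.state (c.action pol))
      (schedule δ αlo c.ep c.epHist c.state (c.action pol)) (V c) -
      ∑ s', P c.state (c.action pol) s' * V c s') with hε
  have hcancel : ∀ x : ℝ, 1 / (1 - γ) * ((1 - γ) * x) = x := fun x => by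
    have : 1 - γ ≠ 0 := by linarith
    field_simp
  have hstep : ∀ n (c : AlgState S A), Reachable n c → X c c.state =
      γ * (1 / (1 - γ) * ε c) + γ * ∑ s', P c.state (c.action pol) s' * X c s' := by
    intro n c hc
    have h1 : V c c.state = r c.state (c.action pol) + γ *
        rho (posterior c.epHist c.state (c.action pol))
          (schedule δ αlo c.ep c.epHist c.state (c.action pol)) (V c) :=
      brValue_eq hγ0 hγ (posterior_pos _) (fun s a => hα0.trans_le (le_schedule _ _ _ _ s a))
        (fun s a => (schedule_lt_one hδ hα hc.one_le_ep _ s a).le) _ _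
    have h2 : trueValue γ r P (c.policy pol) c.state = r c.state (c.action pol) +
        γ * ∑ y, P c.state (c.action pol) y * trueValue γ r P (c.policy pol) y :=
      trueValue_eq hγ0 hγ hP (abs_le_one_of_mem hr) _ _
    simp only [hX, hε]
    rw [hcancel]
    simp only [mul_sub, Finset.sum_sub_distrib]
    linarith
  have hVmem : ∀ n (c : AlgState S A), Reachable n c → ∀ s, 0 ≤ V c s ∧ V c s ≤ 1 / (1 - γ) :=
    fun n c hc s => adaptiveValue_mem hγ0 hγ hδ hα0 hα hr hc.one_le_ep s
  have hrho : ∀ n (c : AlgState S A), Reachable n c →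
      rho (posterior c.epHist c.state (c.action pol))
        (schedule δ αlo c.ep c.epHist c.state (c.action pol)) (V c) ≤ 1 / (1 - γ) :=
    fun n c hc => (rho_mem (posterior_pos _ _ _) (hα0.trans_le (le_schedule _ _ _ _ _ _))
      (schedule_lt_one hδ hα hc.one_le_ep _ _ _).le (fun s => (hVmem n c hc s).1)
      (fun s => (hVmem n c hc s).2)).2
  have key := sum_transition_pow_valueGap_le (pol := pol) hγ0 hγ hP s₁ (X := X) (ε := ε)
    (F := rowIndicator B P) (W := W) (m := m) (T := T) ?_ ?_ (fun c => rowIndicator_nonneg P c)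
    ?_ ?_ (fun n c hc => (hstep n c hc).le) ?_
  · refine key.trans ?_
    have hcoef : 0 ≤ γ * m / (1 - γ) := div_nonneg (by positivity) (by linarith)
    refine add_le_add (add_le_add (mul_le_mul_of_nonneg_left (add_le_add le_rfl ?_) hcoef) le_rfl)
      le_rfl
    simp only [hW, map_add, Pi.add_apply, Finset.sum_add_distrib]
    refine add_le_add (add_le_add (sum_const_width_le hγ0 hγ hP s₁ (T + m) hl1)
      (sum_log_width_le hγ0 hγ hP s₁ (T + m) ?_ fun k hk c hc hund => ?_))
      (sum_const_width_le hγ0 hγ hP s₁ (T + m) hL)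
    · have h1 : (0 : ℝ) < ((T + m : ℕ) : ℝ) := by exact_mod_cast (by omega)
      have h2 := Real.sqrt_pos.2 h1
      have h3 : 0 < Real.log 2 := Real.log_pos (by norm_num)
      positivity
    · exact scheduleLog_le hδ hk hc hund
  · intro c c' h1 h2
    ext s
    simp only [hX, hVdef, adaptiveValue_congr c c' h1 h2, AlgState.policy, h1, h2]
  · exact isEpisodic_rowIndicator (lowRows_congr adaptiveValue_congr)
  · exact fun c => add_nonneg (add_nonneg (undoubledWidth_nonneg _ c) (undoubledWidth_nonneg _ c))
      (undoubledWidth_nonneg _ c)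
  -- Rewards cancel between the two Bellman equations, so the gap is γ times a difference of numbers
  -- in [0, 1/(1−γ)].
  · intro n c hc
    have h1 : V c c.state = r c.state (c.action pol) + γ *
        rho (posterior c.epHist c.state (c.action pol))
          (schedule δ αlo c.ep c.epHist c.state (c.action pol)) (V c) :=
      brValue_eq hγ0 hγ (posterior_pos _) (fun s a => hα0.trans_le (le_schedule _ _ _ _ s a))
        (fun s a => (schedule_lt_one hδ hα hc.one_le_ep _ s a).le) _ _
    have h2 : trueValue γ r P (c.policy pol) c.state = r c.state (c.action pol) +
        γ * ∑ y, P c.state (c.action pol) y * trueValue γ r P (c.policy pol) y :=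
      trueValue_eq hγ0 hγ hP (abs_le_one_of_mem hr) _ _
    have h3 := (linear_mem_of_stdSimplex (hP c.state (c.action pol))
      (fun s => (trueValue_mem hγ0 hγ hP hr (c.policy pol) s).1)
      (fun s => (trueValue_mem hγ0 hγ hP hr (c.policy pol) s).2)).1
    have h4 := hrho n c hc
    simp only [hX]
    nlinarith
  · intro n c hc
    have h0 := (linear_mem_of_stdSimplex (hP c.state (c.action pol))
      (fun s => (hVmem n c hc s).1) (fun s => (hVmem n c hc s).2)).1
    have h1 := hrho n c hc
    have hγ' : 0 < 1 - γ := by linarith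
    refine le_widths_of_le_one (pol := pol)
      (w := fun c => Real.sqrt (Real.log (1 / (1 - αlo)) / (epVisits pol c + Fintype.card S)) +
        Real.sqrt (scheduleLog δ pol c / (epVisits pol c + Fintype.card S)) +
        Real.sqrt (L / (epVisits pol c + Fintype.card S))) (W := W) ?_
      (rowIndicator_nonneg P c)
      (fun c => add_nonneg (add_nonneg (undoubledWidth_nonneg _ c) (undoubledWidth_nonneg _ c))
        (undoubledWidth_nonneg _ c)) ?_ ?_
    · simp only [hε]
      calc _ ≤ (1 - γ) * (1 / (1 - γ)) := by
            refine mul_le_mul_of_nonneg_left ?_ hγ'.le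
            linarith
        _ = 1 := by field_simp
    · intro hund
      simp only [hW, Pi.add_apply, undoubledWidth, if_pos hund]
      exact le_rfl
    · intro hF
      have hrow := not_mem_of_rowIndicator_lt_one hF c.state (c.action pol)
      have h5 : weightedMean (posterior c.epHist c.state (c.action pol)) (V c) -
          1 / (1 - γ) * radius L c c.state (c.action pol) ≤
          ∑ s', P c.state (c.action pol) s' * V c s' := not_lt.1 hrow
      have h6 := rho_le_mean_add (posterior_pos c.epHist c.state (c.action pol))
        (hα0.trans_le (le_schedule δ αlo c.ep c.epHist c.state (c.action pol)))
        (schedule_lt_one hδ hα hc.one_le_ep c.epHist c.state (c.action pol)) hD (lo := 0)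
        (fun s => (hVmem n c hc s).1) (fun s => by simpa using (hVmem n c hc s).2)
      have hn : (0 : ℝ) < epVisits pol c + Fintype.card S := by positivity
      have hsp : ∑ s', posterior c.epHist c.state (c.action pol) s' =
        epVisits pol c + Fintype.card S := sum_posterior _ _ _
      rw [radius, hsp] at h5
      rw [hsp] at h6
      -- Subadditivity of the square root separates the floor level, whose logarithm is constant,
      -- from the adaptive part; the two are summed with different potentials.
      have h7 : Real.sqrt (Real.log (1 / (1 - schedule δ αlo c.ep c.epHist c.state
            (c.action pol))) / (epVisits pol c + Fintype.card S)) ≤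
          Real.sqrt (Real.log (1 / (1 - αlo)) / (epVisits pol c + Fintype.card S)) +
          Real.sqrt (scheduleLog δ pol c / (epVisits pol c + Fintype.card S)) := by
        refine le_trans (Real.sqrt_le_sqrt ?_) (sqrt_add_le_sqrt_add_sqrt (div_nonneg hl1 hn.le)
          (div_nonneg (scheduleLog_nonneg hδ hc.one_le_ep) hn.le))
        rw [← add_div]
        exact div_le_div_of_nonneg_right
          (log_schedule_le hδ hα0 hα hc.one_le_ep _ _ _) hn.le
      have h8 := mul_le_mul_of_nonneg_left h7 hD.le
      simp only [hε]
      rw [← le_div_iff₀' hγ', div_eq_mul_one_div _ (1 - γ)]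
      linarith

/-- Expected accumulated gap between the true and the robust value of the current policy. -/
lemma sum_trueValue_sub_robustValue_le (hγ0 : 0 < γ) (hγ : γ < 1) (hP : IsKernel P)
    (hα0 : 0 < αlo) (hα : αlo < 1) (hr : ∀ s a, 0 ≤ r s a ∧ r s a ≤ 1) (hL : 0 ≤ L)
    (s₁ : S) (m T : ℕ) :
    ∑ t ∈ Finset.range T, (transition γ P pol ^ t)
        (fun c => trueValue γ r P (c.policy pol) c.state - robustValue γ r αlo pol c c.state)
        (AlgState.start s₁) ≤
      γ * m / (1 - γ) * (((T + m : ℕ) : ℝ) * γ ^ m +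
        Fintype.card S * Fintype.card A * (m * Nat.clog 2 m) +
        (Real.sqrt (16 * Fintype.card S * Fintype.card A * ((T + m : ℕ) : ℝ) *
            Real.log (1 / αlo)) +
          Real.sqrt (16 * Fintype.card S * Fintype.card A * ((T + m : ℕ) : ℝ) * L))) +
      γ * m / (1 - γ) *
        ∑ t ∈ Finset.range T, (transition γ P pol ^ t)
          (rowIndicator (highRows γ L (robustValue γ r αlo pol)) P) (AlgState.start s₁) +
      T * (γ ^ m * (γ / (1 - γ))) := by
  have : Nonempty S := ⟨s₁⟩
  have hS : (0 : ℝ) < Fintype.card S := by exact_mod_cast Fintype.card_pos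
  have hD : 0 < 1 / (1 - γ) := one_div_pos.2 (by linarith)
  have hl1 : 0 ≤ Real.log (1 / αlo) := Real.log_nonneg ((one_le_div hα0).2 hα.le)
  set V := robustValue γ r αlo pol with hVdef
  set B := highRows γ L V with hB
  set X : AlgState S A → S → ℝ := fun c s => trueValue γ r P (c.policy pol) s - V c s with hX
  set W : AlgState S A → ℝ := undoubledWidth (fun _ => Real.log (1 / αlo)) pol +
    undoubledWidth (fun _ => L) pol with hW
  -- The mirror image of the optimism error: the quantile is now bounded from below by its level and
  -- P·V from above outside `highRows`. The level is constant, so no schedule logarithm appears.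
  set ε : AlgState S A → ℝ := fun c => (1 - γ) *
    (∑ s', P c.state (c.action pol) s' * V c s' -
      rho (posterior c.epHist c.state (c.action pol)) αlo (V c)) with hε
  have hcancel : ∀ x : ℝ, 1 / (1 - γ) * ((1 - γ) * x) = x := fun x => by
    have : 1 - γ ≠ 0 := by linarith
    field_simp
  have hVeq : ∀ c : AlgState S A, V c c.state = r c.state (c.action pol) + γ *
        rho (posterior c.epHist c.state (c.action pol)) αlo (V c) := fun c =>
    brValue_eq hγ0 hγ (posterior_pos _) (fun _ _ => hα0) (fun _ _ => hα.le) _ _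
  have htv : ∀ c : AlgState S A,
      trueValue γ r P (c.policy pol) c.state = r c.state (c.action pol) +
        γ * ∑ y, P c.state (c.action pol) y * trueValue γ r P (c.policy pol) y := fun c =>
    trueValue_eq hγ0 hγ hP (abs_le_one_of_mem hr) _ _
  have hstep : ∀ c : AlgState S A, X c c.state =
      γ * (1 / (1 - γ) * ε c) + γ * ∑ s', P c.state (c.action pol) s' * X c s' := by
    intro c
    have h1 := hVeq c
    have h2 := htv c
    simp only [hX, hε]
    rw [hcancel]
    simp only [mul_sub, Finset.sum_sub_distrib]
    linarith
  have hVmem : ∀ c s, 0 ≤ V c s ∧ V c s ≤ 1 / (1 - γ) :=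
    robustValue_mem hγ0 hγ hα0 hα hr
  have hrho : ∀ c : AlgState S A,
      0 ≤ rho (posterior c.epHist c.state (c.action pol)) αlo (V c) :=
    fun c => (rho_mem (posterior_pos _ _ _) hα0 hα.le (fun s => (hVmem c s).1)
      (fun s => (hVmem c s).2)).1
  have hW0 : ∀ c, 0 ≤ W c := fun c =>
    add_nonneg (undoubledWidth_nonneg _ c) (undoubledWidth_nonneg _ c)
  have key := sum_transition_pow_valueGap_le (pol := pol) hγ0 hγ hP s₁ (X := X) (ε := ε)
    (F := rowIndicator B P) (W := W) (m := m) (T := T) ?_ ?_ (fun c => rowIndicator_nonneg P c)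
    hW0 ?_ (fun n c hc => (hstep c).le) ?_
  · refine key.trans ?_
    have hcoef : 0 ≤ γ * m / (1 - γ) := div_nonneg (by positivity) (by linarith)
    refine add_le_add (add_le_add (mul_le_mul_of_nonneg_left (add_le_add le_rfl ?_) hcoef) le_rfl)
      le_rfl
    simp only [hW, map_add, Pi.add_apply, Finset.sum_add_distrib]
    exact add_le_add (sum_const_width_le hγ0 hγ hP s₁ (T + m) hl1)
      (sum_const_width_le hγ0 hγ hP s₁ (T + m) hL)
  · intro c c' h1 h2
    ext s
    simp only [hX, hVdef, robustValue_congr c c' h1 h2, AlgState.policy, h1, h2]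
  · exact isEpisodic_rowIndicator (highRows_congr robustValue_congr)
  · intro n c hc
    have h1 := hVeq c
    have h2 := htv c
    have h3 := (linear_mem_of_stdSimplex (hP c.state (c.action pol))
      (fun s => (trueValue_mem hγ0 hγ hP hr (c.policy pol) s).1)
      (fun s => (trueValue_mem hγ0 hγ hP hr (c.policy pol) s).2)).2
    have h4 := hrho c
    simp only [hX]
    nlinarith
  · intro n c hc
    have h0 := (linear_mem_of_stdSimplex (hP c.state (c.action pol))
      (fun s => (hVmem c s).1) (fun s => (hVmem c s).2)).2
    have h1 := hrho c
    have hγ' : 0 < 1 - γ := by linarith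
    refine le_widths_of_le_one (pol := pol)
      (w := fun c => Real.sqrt (Real.log (1 / αlo) / (epVisits pol c + Fintype.card S)) +
        Real.sqrt (L / (epVisits pol c + Fintype.card S))) (W := W) ?_
      (rowIndicator_nonneg P c) hW0 ?_ ?_
    · simp only [hε]
      calc _ ≤ (1 - γ) * (1 / (1 - γ)) := by
            refine mul_le_mul_of_nonneg_left ?_ hγ'.le
            linarith
        _ = 1 := by field_simp
    · intro hund
      simp only [hW, Pi.add_apply, undoubledWidth, if_pos hund]
      exact le_rfl
    · intro hF
      have hrow := not_mem_of_rowIndicator_lt_one hF c.state (c.action pol)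
      have h5 : ∑ s', P c.state (c.action pol) s' * V c s' ≤
          weightedMean (posterior c.epHist c.state (c.action pol)) (V c) +
          1 / (1 - γ) * radius L c c.state (c.action pol) := not_lt.1 hrow
      have h6 := mean_sub_le_rho (posterior_pos c.epHist c.state (c.action pol)) hα0 hα hD
        (lo := 0) (fun s => (hVmem c s).1) (fun s => by simpa using (hVmem c s).2)
      have hsp : ∑ s', posterior c.epHist c.state (c.action pol) s' =
        epVisits pol c + Fintype.card S := sum_posterior _ _ _
      rw [radius, hsp] at h5
      rw [hsp] at h6
      simp only [hε]
      rw [← le_div_iff₀' hγ', div_eq_mul_one_div _ (1 - γ)]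
      linarith

end RunValues

/-! ### Measurability of the values in the kernel -/

section Measurability

variable {S : Type u} {A : Type v}

open Classical in
/-- A function of the kernel, set to zero unless the rows are stochastic. -/
def onKernels [Fintype S] (f : (S → A → S → ℝ) → ℝ) (P : S → A → S → ℝ) : ℝ :=
  if IsKernel P then f P else 0

variable [Fintype S] [DecidableEq S] [Fintype A] [DecidableEq A]
  {γ : ℝ} {r : S → A → ℝ} {pol : ℕ → List (S × A × S) → S → A}

omit [DecidableEq S] [Fintype A] [DecidableEq A] in
lemma onKernels_of_isKernel (f : (S → A → S → ℝ) → ℝ) {P : S → A → S → ℝ} (hP : IsKernel P) :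
    onKernels f P = f P := if_pos hP

omit [DecidableEq S] [DecidableEq A] in
lemma measurableSet_isKernel : MeasurableSet {P : S → A → S → ℝ | IsKernel P} := by
  have : {P : S → A → S → ℝ | IsKernel P} =
      ⋂ s, ⋂ a, (fun P : S → A → S → ℝ => P s a) ⁻¹' stdSimplex ℝ S := by
    ext P; simp [IsKernel]
  rw [this]
  exact MeasurableSet.iInter fun s => MeasurableSet.iInter fun a =>
    (show Measurable fun P : S → A → S → ℝ => P s a by fun_prop)
      (isClosed_stdSimplex ℝ S).measurableSet

omit [DecidableEq S] [DecidableEq A] in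
lemma Measurable.onKernels {f : (S → A → S → ℝ) → ℝ} (hf : Measurable f) :
    Measurable (onKernels f) := by
  classical
  exact Measurable.ite measurableSet_isKernel hf measurable_const

omit [DecidableEq A] in
lemma measurable_stateLaw (π : ℕ → S → A → ℝ) (s : S) (t : ℕ) (x : S) :
    Measurable fun P : S → A → S → ℝ => stateLaw P π s t x := by
  induction t generalizing x with
  | zero => exact measurable_const
  | succ t ih =>
    simp only [stateLaw]
    exact Finset.measurable_fun_sum _ fun y _ => (ih y).mul (by fun_prop)

/-- Partial sums of the discounted series are measurable in the kernel and converge pointwise,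
provided that the rows are stochastic. Elsewhere the `tsum` may take its default value, hence the
cutoff. -/
lemma measurable_onKernels_trueValue (hγ0 : 0 < γ) (hγ : γ < 1)
    (hr : ∀ s a, 0 ≤ r s a ∧ r s a ≤ 1) (π : S → A) (s : S) :
    Measurable (onKernels fun P => trueValue γ r P π s) := by
  set π' : ℕ → S → A → ℝ := fun _ x a => if a = π x then 1 else 0 with hπ'
  set u : ℕ → (S → A → S → ℝ) → ℝ := fun n => onKernels fun P => ∑ t ∈ Finset.range n,
    γ ^ t * ∑ x, stateLaw P π' s t x * ∑ a, π' t x a * r x a with hu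
  refine measurable_of_tendsto_metrizable (f := u) (fun n => ?_) ?_
  · refine Measurable.onKernels (Finset.measurable_fun_sum _ fun t _ => measurable_const.mul ?_)
    exact Finset.measurable_fun_sum _ fun x _ => (measurable_stateLaw π' s t x).mul measurable_const
  · rw [tendsto_pi_nhds]
    intro P
    by_cases hP : IsKernel P
    · simp only [hu, onKernels_of_isKernel _ hP]
      exact (summable_discounted hγ0 hγ hP (fun _ x => pure_mem_stdSimplex π x)
        (abs_le_one_of_mem hr) s).hasSum.tendsto_sum_nat
    · have h0 : ∀ f : (S → A → S → ℝ) → ℝ, onKernels f P = 0 := fun f => if_neg hP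
      simp only [hu, h0]
      exact tendsto_const_nhds

lemma isNice_regret [Nonempty A] (hγ0 : 0 < γ) (hγ : γ < 1)
    (hr : ∀ s a, 0 ≤ r s a ∧ r s a ≤ 1) :
    IsNice fun P (c : AlgState S A) => onKernels (fun P => trueOptValue γ r P c.state -
      trueValue γ r P (c.policy pol) c.state) P := by
  refine ⟨fun c => ?_, fun c => ⟨1 / (1 - γ), fun P hP => ?_⟩⟩
  · have : (onKernels fun P => trueOptValue γ r P c.state -
        trueValue γ r P (c.policy pol) c.state) =
        onKernels fun P => (⨆ π : S → A, onKernels (fun P => trueValue γ r P π c.state) P) -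
          onKernels (fun P => trueValue γ r P (c.policy pol) c.state) P := by
      ext P
      by_cases hP : IsKernel P
      · simp only [onKernels_of_isKernel _ hP]
        rw [trueOptValue_eq_iSup hγ0 hγ hP hr]
      · exact (if_neg hP).trans (if_neg hP).symm
    rw [this]
    exact Measurable.onKernels ((Measurable.iSup fun π =>
      measurable_onKernels_trueValue hγ0 hγ hr π c.state).sub
      (measurable_onKernels_trueValue hγ0 hγ hr _ c.state))
  · rw [onKernels_of_isKernel _ hP]
    have h1 := trueOptValue_mem hγ0 hγ hP hr c.state
    have h2 := trueValue_mem hγ0 hγ hP hr (c.policy pol) c.state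
    rw [abs_le]
    constructor <;> linarith

/-- The gap between the robust optimum and the robust value of the current policy. -/
def robustGap (γ : ℝ) (r : S → A → ℝ) (αlo : ℝ) (pol : ℕ → List (S × A × S) → S → A)
    (c : AlgState S A) : ℝ :=
  brOptValue γ r (posterior c.epHist) (fun _ _ => αlo) c.state -
    brValue γ r (posterior c.epHist) (fun _ _ => αlo) (c.policy pol) c.state

lemma IsNice.sum_transition_pow {f : (S → A → S → ℝ) → AlgState S A → ℝ} (hf : IsNice f)
    (hγ0 : 0 < γ) (hγ : γ < 1) (s₁ : S) (T : ℕ) :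
    Integrable (fun P => ∑ t ∈ Finset.range T, (AQBRMDP.transition γ P pol ^ t) (f P)
      (AlgState.start s₁)) (kernelPrior S A) := by
  rw [← kernelPosterior_nil]
  exact integrable_finsetSum _ fun t _ => (hf.transition_pow hγ0 hγ t).integrable _ _

lemma ae_isKernel_kernelPrior : ∀ᵐ P ∂kernelPrior S A, IsKernel P := by
  rw [← kernelPosterior_nil]
  exact ae_isKernel []

lemma condRegret_eq {P : S → A → S → ℝ} (hP : IsKernel P) (s₁ : S) (T : ℕ) :
    condRegret γ r pol s₁ T P = ∑ t ∈ Finset.range T, (transition γ P pol ^ t)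
      (fun c => trueOptValue γ r P c.state - trueValue γ r P (c.policy pol) c.state)
      (AlgState.start s₁) :=
  sum_pathProb_eq hP
    (fun c => trueOptValue γ r P c.state - trueValue γ r P (c.policy pol) c.state) s₁ T

omit [Fintype A] in
lemma condRobustRegret_eq {αlo : ℝ} {P : S → A → S → ℝ} (hP : IsKernel P) (s₁ : S) (T : ℕ) :
    condRobustRegret γ r αlo pol s₁ T P = ∑ t ∈ Finset.range T, (transition γ P pol ^ t)
      (robustGap γ r αlo pol) (AlgState.start s₁) :=
  sum_pathProb_eq hP (robustGap γ r αlo pol) s₁ T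

lemma integrable_condRegret [Nonempty A] (hγ0 : 0 < γ) (hγ : γ < 1)
    (hr : ∀ s a, 0 ≤ r s a ∧ r s a ≤ 1) (s₁ : S) (T : ℕ) :
    Integrable (condRegret γ r pol s₁ T) (kernelPrior S A) := by
  refine ((isNice_regret (pol := pol) hγ0 hγ hr).sum_transition_pow (pol := pol) hγ0 hγ s₁ T).congr
    ?_
  filter_upwards [ae_isKernel_kernelPrior] with P hP
  rw [condRegret_eq hP]
  simp only [onKernels_of_isKernel _ hP]

lemma integrable_condRobustRegret {αlo : ℝ} (hγ0 : 0 < γ) (hγ : γ < 1) (s₁ : S) (T : ℕ) :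
    Integrable (condRobustRegret γ r αlo pol s₁ T) (kernelPrior S A) := by
  refine ((IsNice.const (robustGap γ r αlo pol)).sum_transition_pow (pol := pol) hγ0 hγ s₁ T).congr
    ?_
  filter_upwards [ae_isKernel_kernelPrior] with P hP
  rw [condRobustRegret_eq hP]

instance isProbabilityMeasure_kernelPrior : IsProbabilityMeasure (kernelPrior S A) := by
  rw [← kernelPosterior_nil]; infer_instance

end Measurability

/-! ### Bayesian probability of the exceptional sets -/

section ExceptionalBounds

variable {S : Type u} {A : Type v} [Fintype S] [DecidableEq S] [Fintype A] [DecidableEq A]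
  {γ : ℝ} {pol : ℕ → List (S × A × S) → S → A} {B : AlgState S A → S → A → Set (S → ℝ)}

/-- The confidence statements refer to the posterior at the start of the pseudo-episode. Only there
does it agree with the posterior given the full history, which is the one that propagates along the
run. -/
lemma integral_transition_pow_atStart_le (hγ0 : 0 < γ) (hγ : γ < 1)
    (hB : ∀ c s a, MeasurableSet (B c s a)) {w : ℕ → ℝ}
    (h : ∀ c : AlgState S A, 1 ≤ c.ep →
      ∑ s, ∑ a, (dirichlet (posterior c.epHist s a)).real (B c s a) ≤ w c.ep)
    (s₁ : S) (n : ℕ) :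
    ∫ P, (transition γ P pol ^ n) (atStart (rowIndicator B P)) (AlgState.start s₁)
        ∂kernelPrior S A ≤
      ∫ P, (transition γ P pol ^ n) (atStart fun c => w c.ep) (AlgState.start s₁)
        ∂kernelPrior S A := by
  rw [← kernelPosterior_nil]
  refine integral_transition_pow_mono (pol := pol) hγ0 hγ (isNice_rowIndicator hB).atStart
    (IsNice.const _) isInvariant_reachable (k := 0) (fun c hc => ?_) (AlgState.start s₁)
    (reachable_start s₁)
  rw [integral_const, smul_eq_mul, probReal_univ, one_mul]
  unfold atStart
  split_ifs with hs
  · refine (integral_rowIndicator_le hB c.hist c).trans ?_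
    rw [← hs]
    exact h c hc.one_le_ep
  · simp

/-- Exceptional sets of constant probability. -/
lemma integral_sum_rowIndicator_le (hγ0 : 0 < γ) (hγ : γ < 1)
    (hB : ∀ c s a, MeasurableSet (B c s a))
    (hBe : ∀ c c' : AlgState S A, c.ep = c'.ep → c.epHist = c'.epHist → B c = B c')
    {b : ℝ} (hb : 0 ≤ b)
    (h : ∀ c : AlgState S A, 1 ≤ c.ep → ∀ s a,
      (dirichlet (posterior c.epHist s a)).real (B c s a) ≤ b)
    (s₁ : S) (T : ℕ) :
    ∫ P, ∑ t ∈ Finset.range T, (transition γ P pol ^ t) (rowIndicator B P) (AlgState.start s₁)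
        ∂kernelPrior S A ≤ (T : ℝ) ^ 2 * (Fintype.card S * Fintype.card A * b) := by
  have hnice : IsNice fun P => atStart (rowIndicator B P) := (isNice_rowIndicator hB).atStart
  have hint : ∀ k, Integrable (fun P => (transition γ P pol ^ k) (atStart (rowIndicator B P))
      (AlgState.start s₁)) (kernelPrior S A) := fun k => by
    rw [← kernelPosterior_nil]
    exact (hnice.transition_pow hγ0 hγ k).integrable _ _
  have hk : ∀ k, ∫ P, (transition γ P pol ^ k) (atStart (rowIndicator B P)) (AlgState.start s₁)
      ∂kernelPrior S A ≤ Fintype.card S * Fintype.card A * b := fun k => by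
    refine (integral_transition_pow_atStart_le hγ0 hγ hB
      (w := fun _ => Fintype.card S * Fintype.card A * b) (fun c hc => ?_) s₁ k).trans ?_
    · refine (Finset.sum_le_sum fun s _ => Finset.sum_le_sum fun a _ => h c hc s a).trans ?_
      simp [mul_assoc]
    · have hle : ∀ᵐ P ∂kernelPrior S A, (transition γ P pol ^ k)
          (atStart fun _ => (Fintype.card S : ℝ) * Fintype.card A * b) (AlgState.start s₁) ≤
            Fintype.card S * Fintype.card A * b := by
        filter_upwards [ae_isKernel_kernelPrior] with P hP
        have := transition_pow_mono (pol := pol) hγ0 hγ hP (I := fun _ _ => True) (k := 0) (n := k)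
          (fun _ _ _ _ => trivial)
          (f := atStart fun _ => (Fintype.card S : ℝ) * Fintype.card A * b)
          (g := fun _ => (Fintype.card S : ℝ) * Fintype.card A * b) (fun c _ => by
            unfold atStart; split_ifs <;> [exact le_rfl; positivity]) (AlgState.start s₁) trivial
        rwa [transition_pow_const hP] at this
      refine (integral_mono_ae ?_ (integrable_const _) hle).trans ?_
      · rw [← kernelPosterior_nil]
        exact ((IsNice.const _).transition_pow hγ0 hγ k).integrable _ _
      · simp
  calc ∫ P, ∑ t ∈ Finset.range T, (transition γ P pol ^ t) (rowIndicator B P)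
        (AlgState.start s₁) ∂kernelPrior S A
      ≤ ∫ P, ∑ _t ∈ Finset.range T, ∑ k ∈ Finset.range T, (transition γ P pol ^ k)
          (atStart (rowIndicator B P)) (AlgState.start s₁) ∂kernelPrior S A := by
        refine integral_mono_ae ((isNice_rowIndicator hB).sum_transition_pow hγ0 hγ s₁ T)
          (integrable_finsetSum _ fun _ _ => integrable_finsetSum _ fun k _ => hint k) ?_
        filter_upwards [ae_isKernel_kernelPrior] with P hP
        -- The pseudo-episode containing a step began at some earlier time; summing over all T
        -- possible starts for each of the T steps gives T².
        refine Finset.sum_le_sum fun t ht => ?_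
        refine (transition_pow_episodic_le hγ0 hγ hP (isEpisodic_rowIndicator hBe)
          (rowIndicator_nonneg P) s₁ t).trans ?_
        refine Finset.sum_le_sum_of_subset_of_nonneg
          (Finset.range_subset_range.2 (Finset.mem_range.1 ht)) fun k _ _ => ?_
        exact transition_pow_nonneg hγ0 hγ hP (atStart_nonneg (rowIndicator_nonneg P)) k _
    _ = ∑ _t ∈ Finset.range T, ∑ k ∈ Finset.range T, ∫ P, (transition γ P pol ^ k)
          (atStart (rowIndicator B P)) (AlgState.start s₁) ∂kernelPrior S A := by
        rw [integral_finsetSum _ fun _ _ => integrable_finsetSum _ fun k _ => hint k]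
        refine Finset.sum_congr rfl fun _ _ => integral_finsetSum _ fun k _ => hint k
    _ ≤ ∑ _t ∈ Finset.range T, ∑ _k ∈ Finset.range T,
          (Fintype.card S * Fintype.card A * b : ℝ) :=
        Finset.sum_le_sum fun _ _ => Finset.sum_le_sum fun k _ => hk k
    _ = _ := by
        simp only [Finset.sum_const, Finset.card_range, nsmul_eq_mul]
        ring

/-- Exceptional sets whose probability depends on the index of the pseudo-episode. -/
lemma integral_sum_rowIndicator_le_sum (hγ0 : 0 < γ) (hγ : γ < 1)
    (hB : ∀ c s a, MeasurableSet (B c s a))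
    (hBe : ∀ c c' : AlgState S A, c.ep = c'.ep → c.epHist = c'.epHist → B c = B c')
    {w : ℕ → ℝ} (hw : ∀ k, 0 ≤ w k)
    (h : ∀ c : AlgState S A, 1 ≤ c.ep →
      ∑ s, ∑ a, (dirichlet (posterior c.epHist s a)).real (B c s a) ≤ w c.ep)
    (s₁ : S) (T : ℕ) :
    ∫ P, ∑ t ∈ Finset.range T, (transition γ P pol ^ t) (rowIndicator B P) (AlgState.start s₁)
        ∂kernelPrior S A ≤ 1 / (1 - γ) * ∑ k ∈ Finset.range T, w (k + 1) := by
  have hnice : IsNice fun P => atStart (rowIndicator B P) := (isNice_rowIndicator hB).atStart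
  have hint : ∀ k, Integrable (fun P => (transition γ P pol ^ k) (atStart (rowIndicator B P))
      (AlgState.start s₁)) (kernelPrior S A) := fun k => by
    rw [← kernelPosterior_nil]
    exact (hnice.transition_pow hγ0 hγ k).integrable _ _
  have hint' : ∀ k, Integrable (fun P => (transition γ P pol ^ k) (atStart fun c => w c.ep)
      (AlgState.start s₁)) (kernelPrior S A) := fun k => by
    rw [← kernelPosterior_nil]
    exact ((IsNice.const _).transition_pow hγ0 hγ k).integrable _ _
  have hD : 0 ≤ 1 / (1 - γ) := one_div_nonneg.2 (by linarith)
  calc ∫ P, ∑ t ∈ Finset.range T, (transition γ P pol ^ t) (rowIndicator B P)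
        (AlgState.start s₁) ∂kernelPrior S A
      ≤ ∫ P, 1 / (1 - γ) * ∑ k ∈ Finset.range T, (transition γ P pol ^ k)
          (atStart (rowIndicator B P)) (AlgState.start s₁) ∂kernelPrior S A := by
        refine integral_mono_ae ((isNice_rowIndicator hB).sum_transition_pow hγ0 hγ s₁ T)
          ((integrable_finsetSum _ fun k _ => hint k).const_mul _) ?_
        filter_upwards [ae_isKernel_kernelPrior] with P hP
        exact sum_transition_pow_episodic_le hγ0 hγ hP (isEpisodic_rowIndicator hBe)
          (rowIndicator_nonneg P) s₁ T
    _ = 1 / (1 - γ) * ∑ k ∈ Finset.range T, ∫ P, (transition γ P pol ^ k)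
          (atStart (rowIndicator B P)) (AlgState.start s₁) ∂kernelPrior S A := by
        rw [integral_const_mul, integral_finsetSum _ fun k _ => hint k]
    _ ≤ 1 / (1 - γ) * ∑ k ∈ Finset.range T, ∫ P, (transition γ P pol ^ k)
          (atStart fun c => w c.ep) (AlgState.start s₁) ∂kernelPrior S A :=
        mul_le_mul_of_nonneg_left (Finset.sum_le_sum fun k _ =>
          integral_transition_pow_atStart_le hγ0 hγ hB h s₁ k) hD
    _ = 1 / (1 - γ) * ∫ P, ∑ k ∈ Finset.range T, (transition γ P pol ^ k)
          (atStart fun c => w c.ep) (AlgState.start s₁) ∂kernelPrior S A := by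
        rw [integral_finsetSum _ fun k _ => hint' k]
    _ ≤ 1 / (1 - γ) * ∑ k ∈ Finset.range T, w (k + 1) := by
        refine mul_le_mul_of_nonneg_left ?_ hD
        refine (integral_mono_ae (integrable_finsetSum _ fun k _ => hint' k) (integrable_const _)
          (?_ : ∀ᵐ P ∂kernelPrior S A, _ ≤ ∑ k ∈ Finset.range T, w (k + 1))).trans ?_
        · filter_upwards [ae_isKernel_kernelPrior] with P hP
          exact sum_transition_pow_atStart_le hγ0 hγ hP s₁ T hw
        · simp

end ExceptionalBounds

lemma integrable_const_add_mul {Ω : Type*} [MeasurableSpace Ω] {μ : Measure Ω}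
    [IsProbabilityMeasure μ] {f : Ω → ℝ} (hf : Integrable f μ) (a b : ℝ) :
    Integrable (fun x => a + b * f x) μ :=
  (integrable_const a).add (hf.const_mul b)

lemma integral_const_add_mul {Ω : Type*} [MeasurableSpace Ω] {μ : Measure Ω}
    [IsProbabilityMeasure μ] {f : Ω → ℝ} (hf : Integrable f μ) (a b : ℝ) :
    ∫ x, (a + b * f x) ∂μ = a + b * ∫ x, f x ∂μ := by
  rw [integral_add (integrable_const a) (hf.const_mul b), integral_const_mul]
  simp

/-! ### Comparison of the regrets with the value gaps -/

section Regret

variable {S : Type u} {A : Type v} [Fintype S] [DecidableEq S] [Fintype A] [DecidableEq A]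
  [Nonempty A] {γ δ αlo L : ℝ} {r : S → A → ℝ} {P : S → A → S → ℝ}
  {pol : ℕ → List (S × A × S) → S → A}

lemma IsAQPolicy.brOptValue_eq (hpol : IsAQPolicy γ r δ αlo pol) (hγ0 : 0 < γ) (hγ : γ < 1)
    (hδ : 0 < δ) (hα0 : 0 < αlo) (hα : αlo < 1) {c : AlgState S A} (hc : 1 ≤ c.ep) :
    brOptValue γ r (posterior c.epHist) (schedule δ αlo c.ep c.epHist) =
      adaptiveValue γ r δ αlo pol c :=
  have : Nonempty S := ⟨c.state⟩
  (hpol c.ep hc c.epHist).brOptValue_eq_brValue hγ0 hγ (posterior_pos _)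
    (fun s a => hα0.trans_le (le_schedule _ _ _ _ s a))
    (fun s a => (schedule_lt_one hδ hα hc _ s a).le)

/-- If no row exceeds its quantile, each risk backup of the adaptive value dominates the true
backup, so that value is a true supersolution and lies above the true optimum. Otherwise the true
optimum is bounded by 1/(1−γ). -/
lemma regret_le (hpol : IsAQPolicy γ r δ αlo pol) (hγ0 : 0 < γ) (hγ : γ < 1) (hP : IsKernel P)
    (hδ : 0 < δ) (hα0 : 0 < αlo) (hα : αlo < 1) (hr : ∀ s a, 0 ≤ r s a ∧ r s a ≤ 1)
    {c : AlgState S A} (hc : 1 ≤ c.ep) :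
    trueOptValue γ r P c.state - trueValue γ r P (c.policy pol) c.state ≤
      (adaptiveValue γ r δ αlo pol c c.state - trueValue γ r P (c.policy pol) c.state) +
        1 / (1 - γ) *
          rowIndicator (aboveQuantileRows δ αlo (adaptiveValue γ r δ αlo pol)) P c := by
  have : Nonempty S := ⟨c.state⟩
  have hV := adaptiveValue_mem (pol := pol) hγ0 hγ hδ hα0 hα hr hc
  have hD : 0 ≤ 1 / (1 - γ) := one_div_nonneg.2 (by linarith)
  by_cases hF : rowIndicator (aboveQuantileRows δ αlo (adaptiveValue γ r δ αlo pol)) P c < 1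
  · have h0 := rowIndicator_nonneg
      (B := aboveQuantileRows δ αlo (adaptiveValue γ r δ αlo pol)) P c
    have hle : trueOptValue γ r P c.state ≤ adaptiveValue γ r δ αlo pol c c.state := by
      refine trueOptValue_le hγ0 hγ hP (abs_le_one_of_mem hr) (fun x a => ?_) c.state
      have hrow := not_mem_of_rowIndicator_lt_one hF x a
      have h1 : ∑ s', P x a s' * adaptiveValue γ r δ αlo pol c s' ≤
          rho (posterior c.epHist x a) (schedule δ αlo c.ep c.epHist x a)
            (adaptiveValue γ r δ αlo pol c) := not_lt.1 hrow
      have h2 := brOptValue_eq (r := r) hγ0 hγ (posterior_pos c.epHist)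
        (fun s a => hα0.trans_le (le_schedule δ αlo c.ep c.epHist s a))
        (fun s a => (schedule_lt_one hδ hα hc _ s a).le) x
      rw [hpol.brOptValue_eq hγ0 hγ hδ hα0 hα hc] at h2
      rw [h2]
      refine le_trans ?_ (le_ciSup (Set.finite_range _).bddAbove a)
      unfold brQ
      have := mul_le_mul_of_nonneg_left h1 hγ0.le
      linarith
    have := mul_nonneg hD h0
    linarith
  · have h1 := mul_le_mul_of_nonneg_left (not_lt.1 hF) hD
    have h2 := (trueOptValue_mem hγ0 hγ hP hr c.state).2
    have h3 := (hV c.state).1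
    linarith

/-- Lowering all levels to the floor lowers the optimal risk value, so the robust optimum is below
the adaptive value for every kernel. The true value is only inserted and cancels. -/
lemma robustGap_le (hpol : IsAQPolicy γ r δ αlo pol) (hγ0 : 0 < γ) (hγ : γ < 1)
    (hδ : 0 < δ) (hα0 : 0 < αlo) (hα : αlo < 1) {c : AlgState S A} (hc : 1 ≤ c.ep) :
    robustGap γ r αlo pol c ≤
      (adaptiveValue γ r δ αlo pol c c.state - trueValue γ r P (c.policy pol) c.state) +
        (trueValue γ r P (c.policy pol) c.state - robustValue γ r αlo pol c c.state) := by
  have : Nonempty S := ⟨c.state⟩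
  have h1 := brOptValue_mono_level (r := r) hγ0 hγ (posterior_pos c.epHist)
    (fun _ _ => hα0) (fun s a => le_schedule δ αlo c.ep c.epHist s a)
    (fun s a => (schedule_lt_one hδ hα hc _ s a).le) c.state
  rw [hpol.brOptValue_eq hγ0 hγ hδ hα0 hα hc] at h1
  unfold robustGap robustValue
  linarith

/-- Proportionality to relative visit counts lets frequently visited pairs take more risk while the
total stays that of a uniform allocation. -/
lemma sum_dirichlet_aboveQuantileRows_le (hδ : 0 < δ) (hα : αlo < 1)
    (V : AlgState S A → S → ℝ) {c : AlgState S A} (hc : 1 ≤ c.ep) :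
    ∑ s, ∑ a, (dirichlet (posterior c.epHist s a)).real (aboveQuantileRows δ αlo V c s a) ≤
      δ * ((Fintype.card S : ℝ) * Fintype.card A) * (Real.log (2 * c.ep) / Real.sqrt c.ep) := by
  have : Nonempty S := ⟨c.state⟩
  rw [← sum_allowance δ c.ep c.epHist]
  refine Finset.sum_le_sum fun s _ => Finset.sum_le_sum fun a _ => ?_
  exact (dirichlet_rho_lt_le (posterior_pos _ _ _) (schedule_lt_one hδ hα hc _ s a).le _).trans
    (one_sub_schedule_le _ _ _ _ _ _)

/-- Two kinds of exceptional rows are integrated differently: those of fixed probability e^{-L}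
crudely, over all starts, and those above the quantile through the mean length of a pseudo-episode.
The two factors 1/(1−γ) of the δ-term are that mean length and the range of the values. -/
lemma bayesRegret_le_of_valueGap (hpol : IsAQPolicy γ r δ αlo pol) (hγ0 : 0 < γ) (hγ : γ < 1)
    (hδ : 0 < δ) (hα0 : 0 < αlo) (hα : αlo < 1) (hr : ∀ s a, 0 ≤ r s a ∧ r s a ≤ 1) (hL : 0 ≤ L)
    (s₁ : S) (T : ℕ) {E κ : ℝ} (hκ : 0 ≤ κ)
    (hE : ∀ P : S → A → S → ℝ, IsKernel P → ∑ t ∈ Finset.range T, (transition γ P pol ^ t)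
        (fun c => adaptiveValue γ r δ αlo pol c c.state - trueValue γ r P (c.policy pol) c.state)
        (AlgState.start s₁) ≤
      E + κ * ∑ t ∈ Finset.range T, (transition γ P pol ^ t)
          (rowIndicator (lowRows γ L (adaptiveValue γ r δ αlo pol)) P) (AlgState.start s₁)) :
    bayesRegret γ r pol s₁ T ≤
      E + κ * ((T : ℝ) ^ 2 * (Fintype.card S * Fintype.card A * Real.exp (-L))) +
        2 * δ * Fintype.card S * Fintype.card A * Real.sqrt T * Real.log (2 * T) /
          (1 - γ) ^ 2 := by
  set V := adaptiveValue γ r δ αlo pol with hVdef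
  have hD : 0 ≤ 1 / (1 - γ) := one_div_nonneg.2 (by linarith)
  have hB1 : ∀ (c : AlgState S A) s a, MeasurableSet (lowRows γ L V c s a) :=
    fun c s a => measurableSet_linear_lt _ _
  have hB2 : ∀ (c : AlgState S A) s a, MeasurableSet (aboveQuantileRows δ αlo V c s a) :=
    fun c s a => measurableSet_lt_linear _ _
  have hi1 := (isNice_rowIndicator hB1).sum_transition_pow (pol := pol) hγ0 hγ s₁ T
  have hi2 := (isNice_rowIndicator hB2).sum_transition_pow (pol := pol) hγ0 hγ s₁ T
  have hlow := integral_sum_rowIndicator_le (pol := pol) hγ0 hγ hB1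
    (lowRows_congr adaptiveValue_congr) (Real.exp_pos (-L)).le (fun c hc s a =>
      dirichlet_lowRows_le hγ hL (adaptiveValue_mem hγ0 hγ hδ hα0 hα hr hc) s a) s₁ T
  have hw : ∀ k : ℕ, 0 ≤ δ * ((Fintype.card S : ℝ) * Fintype.card A) *
      (Real.log (2 * k) / Real.sqrt k) := fun k => by
    rcases Nat.eq_zero_or_pos k with rfl | hk
    · simp
    · have := log_two_mul_pos hk
      positivity
  have habove := integral_sum_rowIndicator_le_sum (pol := pol) hγ0 hγ hB2
    (aboveQuantileRows_congr adaptiveValue_congr) hw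
    (fun c hc => sum_dirichlet_aboveQuantileRows_le hδ hα V hc) s₁ T
  rw [← Finset.mul_sum] at habove
  have hlog := mul_le_mul_of_nonneg_left (sum_log_div_sqrt_le T)
    (by positivity : 0 ≤ δ * ((Fintype.card S : ℝ) * Fintype.card A))
  calc bayesRegret γ r pol s₁ T
      ≤ ∫ P, (E + κ * ∑ t ∈ Finset.range T, (transition γ P pol ^ t)
          (rowIndicator (lowRows γ L V) P) (AlgState.start s₁) +
          1 / (1 - γ) * ∑ t ∈ Finset.range T, (transition γ P pol ^ t)
            (rowIndicator (aboveQuantileRows δ αlo V) P) (AlgState.start s₁))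
          ∂kernelPrior S A := by
        refine integral_mono_ae (integrable_condRegret hγ0 hγ hr s₁ T)
          ((integrable_const_add_mul hi1 E κ).add (hi2.const_mul _)) ?_
        filter_upwards [ae_isKernel_kernelPrior] with P hP
        rw [condRegret_eq hP]
        refine le_trans ?_ (add_le_add (hE P hP) le_rfl)
        rw [Finset.mul_sum, ← Finset.sum_add_distrib]
        refine Finset.sum_le_sum fun t _ => ?_
        rw [← smul_eq_mul, ← Pi.smul_apply, ← map_smul, ← Pi.add_apply, ← map_add]
        exact transition_pow_mono hγ0 hγ hP isInvariant_reachable (k := 0)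
          (fun c hc => regret_le hpol hγ0 hγ hP hδ hα0 hα hr hc.one_le_ep) _ (reachable_start s₁)
    _ = E + κ * ∫ P, ∑ t ∈ Finset.range T, (transition γ P pol ^ t)
          (rowIndicator (lowRows γ L V) P) (AlgState.start s₁) ∂kernelPrior S A +
          1 / (1 - γ) * ∫ P, ∑ t ∈ Finset.range T, (transition γ P pol ^ t)
            (rowIndicator (aboveQuantileRows δ αlo V) P) (AlgState.start s₁)
          ∂kernelPrior S A := by
        rw [integral_add (integrable_const_add_mul hi1 E κ) (hi2.const_mul _),
          integral_const_add_mul hi1, integral_const_mul]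
    _ ≤ E + κ * ((T : ℝ) ^ 2 * (Fintype.card S * Fintype.card A * Real.exp (-L))) +
          1 / (1 - γ) * (1 / (1 - γ) * (δ * ((Fintype.card S : ℝ) * Fintype.card A) *
            (2 * Real.sqrt T * Real.log (2 * T)))) := by
        have h1 := mul_le_mul_of_nonneg_left hlow hκ
        have h2 := mul_le_mul_of_nonneg_left
          (habove.trans (mul_le_mul_of_nonneg_left hlog hD)) hD
        linarith
    _ = _ := by
        have : 1 - γ ≠ 0 := by linarith
        field_simp

lemma bayesRobustRegret_le_of_valueGap (hpol : IsAQPolicy γ r δ αlo pol) (hγ0 : 0 < γ)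
    (hγ : γ < 1) (hδ : 0 < δ) (hα0 : 0 < αlo) (hα : αlo < 1)
    (hr : ∀ s a, 0 ≤ r s a ∧ r s a ≤ 1) (hL : 0 ≤ L)
    (s₁ : S) (T : ℕ) {E E' κ : ℝ} (hκ : 0 ≤ κ)
    (hE : ∀ P : S → A → S → ℝ, IsKernel P → ∑ t ∈ Finset.range T, (transition γ P pol ^ t)
        (fun c => adaptiveValue γ r δ αlo pol c c.state - trueValue γ r P (c.policy pol) c.state)
        (AlgState.start s₁) ≤
      E + κ * ∑ t ∈ Finset.range T, (transition γ P pol ^ t)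
          (rowIndicator (lowRows γ L (adaptiveValue γ r δ αlo pol)) P) (AlgState.start s₁))
    (hE' : ∀ P : S → A → S → ℝ, IsKernel P → ∑ t ∈ Finset.range T, (transition γ P pol ^ t)
        (fun c => trueValue γ r P (c.policy pol) c.state - robustValue γ r αlo pol c c.state)
        (AlgState.start s₁) ≤
      E' + κ * ∑ t ∈ Finset.range T, (transition γ P pol ^ t)
          (rowIndicator (highRows γ L (robustValue γ r αlo pol)) P) (AlgState.start s₁)) :
    bayesRobustRegret γ r αlo pol s₁ T ≤
      E + E' + 2 * (κ * ((T : ℝ) ^ 2 * (Fintype.card S * Fintype.card A * Real.exp (-L)))) := by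
  set V := adaptiveValue γ r δ αlo pol with hVdef
  set V' := robustValue γ r αlo pol with hVdef'
  have hB1 : ∀ (c : AlgState S A) s a, MeasurableSet (lowRows γ L V c s a) :=
    fun c s a => measurableSet_linear_lt _ _
  have hB2 : ∀ (c : AlgState S A) s a, MeasurableSet (highRows γ L V' c s a) :=
    fun c s a => measurableSet_lt_linear _ _
  have hi1 := (isNice_rowIndicator hB1).sum_transition_pow (pol := pol) hγ0 hγ s₁ T
  have hi2 := (isNice_rowIndicator hB2).sum_transition_pow (pol := pol) hγ0 hγ s₁ T
  have hlow := integral_sum_rowIndicator_le (pol := pol) hγ0 hγ hB1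
    (lowRows_congr adaptiveValue_congr) (Real.exp_pos (-L)).le (fun c hc s a =>
      dirichlet_lowRows_le hγ hL (adaptiveValue_mem hγ0 hγ hδ hα0 hα hr hc) s a) s₁ T
  have hhigh := integral_sum_rowIndicator_le (pol := pol) hγ0 hγ hB2
    (highRows_congr robustValue_congr) (Real.exp_pos (-L)).le (fun c _ s a =>
      dirichlet_highRows_le hγ hL (robustValue_mem hγ0 hγ hα0 hα hr c) s a) s₁ T
  calc bayesRobustRegret γ r αlo pol s₁ T
      ≤ ∫ P, (E + κ * ∑ t ∈ Finset.range T, (transition γ P pol ^ t)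
          (rowIndicator (lowRows γ L V) P) (AlgState.start s₁) +
          (E' + κ * ∑ t ∈ Finset.range T, (transition γ P pol ^ t)
            (rowIndicator (highRows γ L V') P) (AlgState.start s₁)))
          ∂kernelPrior S A := by
        refine integral_mono_ae (integrable_condRobustRegret hγ0 hγ s₁ T)
          ((integrable_const_add_mul hi1 E κ).add (integrable_const_add_mul hi2 E' κ)) ?_
        filter_upwards [ae_isKernel_kernelPrior] with P hP
        rw [condRobustRegret_eq hP]
        refine le_trans ?_ (add_le_add (hE P hP) (hE' P hP))
        rw [← Finset.sum_add_distrib]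
        refine Finset.sum_le_sum fun t _ => ?_
        rw [← Pi.add_apply, ← map_add]
        exact transition_pow_mono hγ0 hγ hP isInvariant_reachable (k := 0)
          (fun c hc => robustGap_le hpol hγ0 hγ hδ hα0 hα hc.one_le_ep) _ (reachable_start s₁)
    _ = E + κ * ∫ P, ∑ t ∈ Finset.range T, (transition γ P pol ^ t)
          (rowIndicator (lowRows γ L V) P) (AlgState.start s₁) ∂kernelPrior S A +
          (E' + κ * ∫ P, ∑ t ∈ Finset.range T, (transition γ P pol ^ t)
            (rowIndicator (highRows γ L V') P) (AlgState.start s₁) ∂kernelPrior S A) := by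
        rw [integral_add (integrable_const_add_mul hi1 E κ) (integrable_const_add_mul hi2 E' κ),
          integral_const_add_mul hi1, integral_const_add_mul hi2]
    _ ≤ _ := by
        have h1 := mul_le_mul_of_nonneg_left hlow hκ
        have h2 := mul_le_mul_of_nonneg_left hhigh hκ
        linarith

/-- The regret of a step is at most `1 / (1 - γ)`. -/
lemma bayesRegret_le_trivial (hγ0 : 0 < γ) (hγ : γ < 1)
    (hr : ∀ s a, 0 ≤ r s a ∧ r s a ≤ 1) (s₁ : S) (T : ℕ) :
    bayesRegret γ r pol s₁ T ≤ T * (1 / (1 - γ)) := by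
  refine (integral_mono_ae (integrable_condRegret hγ0 hγ hr s₁ T) (integrable_const _)
    (?_ : ∀ᵐ P ∂kernelPrior S A, _ ≤ T * (1 / (1 - γ)))).trans (by simp)
  filter_upwards [ae_isKernel_kernelPrior] with P hP
  rw [condRegret_eq hP]
  refine (Finset.sum_le_card_nsmul _ _ (1 / (1 - γ)) fun t _ => ?_).trans (by simp)
  have := transition_pow_mono (pol := pol) hγ0 hγ hP (I := fun _ _ => True) (k := 0) (n := t)
    (fun _ _ _ _ => trivial)
    (f := fun c => trueOptValue γ r P c.state - trueValue γ r P (c.policy pol) c.state)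
    (g := fun _ => 1 / (1 - γ)) (fun c _ => by
      have h1 := trueOptValue_mem hγ0 hγ hP hr c.state
      have h2 := trueValue_mem hγ0 hγ hP hr (c.policy pol) c.state
      linarith) (AlgState.start s₁) trivial
  rwa [transition_pow_const hP] at this

lemma bayesRobustRegret_le_trivial (hγ0 : 0 < γ) (hγ : γ < 1) (hα0 : 0 < αlo) (hα : αlo < 1)
    (hr : ∀ s a, 0 ≤ r s a ∧ r s a ≤ 1) (s₁ : S) (T : ℕ) :
    bayesRobustRegret γ r αlo pol s₁ T ≤ T * (1 / (1 - γ)) := by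
  have : Nonempty S := ⟨s₁⟩
  refine (integral_mono_ae (integrable_condRobustRegret hγ0 hγ s₁ T) (integrable_const _)
    (?_ : ∀ᵐ P ∂kernelPrior S A, _ ≤ T * (1 / (1 - γ)))).trans (by simp)
  filter_upwards [ae_isKernel_kernelPrior] with P hP
  rw [condRobustRegret_eq hP]
  refine (Finset.sum_le_card_nsmul _ _ (1 / (1 - γ)) fun t _ => ?_).trans (by simp)
  have := transition_pow_mono (pol := pol) hγ0 hγ hP (I := fun _ _ => True) (k := 0) (n := t)
    (fun _ _ _ _ => trivial) (f := robustGap γ r αlo pol)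
    (g := fun _ => 1 / (1 - γ)) (fun c _ => by
      have h1 := brOptValue_mem hγ0 hγ (posterior_pos c.epHist) (fun _ _ => hα0)
        (fun _ _ => hα.le) hr c.state
      have h2 := brValue_mem hγ0 hγ (posterior_pos c.epHist) (fun _ _ => hα0)
        (fun _ _ => hα.le) hr (c.policy pol) c.state
      unfold robustGap
      linarith) (AlgState.start s₁) trivial
  rwa [transition_pow_const hP] at this

end Regret

/-! ### The horizon of a pseudo-episode -/

section Horizon

variable {γ : ℝ} {T : ℕ}

lemma one_le_log_horizon (γ : ℝ) (T : ℕ) :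
    1 ≤ Real.log (max (Real.exp 1) (T / (1 - γ) ^ 2)) := by
  have := Real.log_le_log (Real.exp_pos 1) (le_max_left (Real.exp 1) (T / (1 - γ) ^ 2))
  rwa [Real.log_exp] at this

lemma one_le_logTerm (γ : ℝ) (T : ℕ) : 1 ≤ logTerm γ T := by
  have h := one_le_log_horizon γ T
  unfold logTerm
  linarith [Real.log_nonneg h]

lemma le_mT (hγ : γ < 1) : logTerm γ T + 2 ≤ (1 - γ) * mT γ T := by
  have h1 : 0 < 1 - γ := by linarith
  have h2 : 1 / (1 - γ) * (logTerm γ T + 2) ≤ mT γ T := Nat.le_ceil _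
  rwa [div_mul_eq_mul_div, one_mul, div_le_iff₀' h1] at h2

lemma mT_le (hγ0 : 0 < γ) (hγ : γ < 1) : (1 - γ) * mT γ T ≤ logTerm γ T + 3 := by
  have h1 : 0 < 1 - γ := by linarith
  have h0 := one_le_logTerm γ T
  have h2 : (mT γ T : ℝ) < 1 / (1 - γ) * (logTerm γ T + 2) + 1 :=
    Nat.ceil_lt_add_one (by positivity)
  have h3 := mul_lt_mul_of_pos_left h2 h1
  have h4 : (1 - γ) * (1 / (1 - γ) * (logTerm γ T + 2) + 1) = logTerm γ T + 2 + (1 - γ) := by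
    field_simp
  linarith

lemma one_le_mT (hγ : γ < 1) : 1 ≤ mT γ T := by
  have h1 : 0 < 1 - γ := by linarith
  have h0 := one_le_logTerm γ T
  exact Nat.one_le_ceil_iff.2 (by positivity)

/-- γ^m ≤ e^{-(1-γ)m} ≤ e^{-(ℓ+2)} by the choice of m, where e^ℓ ≥ T/(1−γ)² and e² ≥ 4. The loglog
term of ℓ is not used here. -/
lemma pow_mT_mul_le (hγ0 : 0 < γ) (hγ : γ < 1) : (T : ℝ) * γ ^ mT γ T ≤ (1 - γ) ^ 2 / 4 := by
  have h1 : 0 < 1 - γ := by linarith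
  set u := max (Real.exp 1) (T / (1 - γ) ^ 2) with hu
  have hu0 : 0 < u := (Real.exp_pos 1).trans_le (le_max_left _ _)
  have hlog : 1 ≤ Real.log u := one_le_log_horizon γ T
  have hpow : γ ^ mT γ T ≤ Real.exp (-(logTerm γ T + 2)) := by
    have h2 : γ ≤ Real.exp (-(1 - γ)) := by linarith [Real.add_one_le_exp (-(1 - γ))]
    calc γ ^ mT γ T ≤ Real.exp (-(1 - γ)) ^ mT γ T := pow_le_pow_left₀ hγ0.le h2 _
      _ = Real.exp (-((1 - γ) * mT γ T)) := by rw [← Real.exp_nat_mul]; ring_nf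
      _ ≤ _ := Real.exp_le_exp.2 (neg_le_neg (le_mT hγ))
  have hexp2 : (4 : ℝ) ≤ Real.exp 2 := by
    have := Real.add_one_le_exp (1 : ℝ)
    have h3 : Real.exp 2 = Real.exp 1 * Real.exp 1 := by rw [← Real.exp_add]; norm_num
    nlinarith
  have hexp : u * 4 ≤ Real.exp (logTerm γ T + 2) := by
    have h3 : u ≤ Real.exp (logTerm γ T) := by
      have h4 : Real.log u ≤ logTerm γ T := by
        have := Real.log_nonneg hlog
        unfold logTerm
        linarith
      calc u = Real.exp (Real.log u) := (Real.exp_log hu0).symm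
        _ ≤ _ := Real.exp_le_exp.2 h4
    rw [Real.exp_add]
    exact mul_le_mul h3 hexp2 (by norm_num) (Real.exp_pos _).le
  have hTu : (T : ℝ) ≤ u * (1 - γ) ^ 2 := by
    have : T / (1 - γ) ^ 2 ≤ u := le_max_right _ _
    rwa [div_le_iff₀ (by positivity)] at this
  calc (T : ℝ) * γ ^ mT γ T ≤ u * (1 - γ) ^ 2 * Real.exp (-(logTerm γ T + 2)) :=
        mul_le_mul hTu hpow (by positivity) (by positivity)
    _ = u * (1 - γ) ^ 2 / Real.exp (logTerm γ T + 2) := by rw [Real.exp_neg, ← div_eq_mul_inv]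
    _ ≤ u * (1 - γ) ^ 2 / (u * 4) := by gcongr
    _ = _ := by field_simp

/-- Collects the late steps, for which the horizon T + m produces an m² term, and the residual of
the unrolling. Multiplying γ^m by m² is harmless because (1−γ)m ≤ ℓ + 3. -/
lemma truncation_le_tailT (hγ0 : 0 < γ) (hγ : γ < 1) (hT : 1 ≤ T) :
    γ * mT γ T / (1 - γ) * (((T + mT γ T : ℕ) : ℝ) * γ ^ mT γ T) +
      T * (γ ^ mT γ T * (γ / (1 - γ))) ≤ tailT γ T := by
  have h1 : 0 < 1 - γ := by linarith
  have hT1 : (1 : ℝ) ≤ T := by exact_mod_cast hT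
  have hx := pow_mT_mul_le (T := T) hγ0 hγ
  have hm := mT_le (T := T) hγ0 hγ
  have hℓ := one_le_logTerm γ T
  set m : ℝ := (mT γ T : ℝ) with hmdef
  set x : ℝ := γ ^ mT γ T with hxdef
  have hx0 : 0 < x := by positivity
  have hm0 : 0 ≤ m := by positivity
  set ℓ := logTerm γ T with hℓdef
  have hx' : x ≤ (1 - γ) ^ 2 / 4 := by nlinarith
  have hmx : m * (T * x) ≤ (ℓ + 3) / 4 := by
    calc m * (T * x) ≤ m * ((1 - γ) ^ 2 / 4) := mul_le_mul_of_nonneg_left hx hm0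
      _ = (1 - γ) * m * (1 - γ) / 4 := by ring
      _ ≤ (ℓ + 3) * 1 / 4 := by
          have := mul_le_mul hm (by linarith : 1 - γ ≤ 1) h1.le (by linarith)
          linarith
      _ = _ := by ring
  have hmmx : m * (m * x) ≤ (ℓ + 3) ^ 2 / 4 := by
    calc m * (m * x) ≤ m * (m * ((1 - γ) ^ 2 / 4)) := by gcongr
      _ = ((1 - γ) * m) ^ 2 / 4 := by ring
      _ ≤ _ := by gcongr
  have hTx : T * x ≤ 1 / 4 := hx.trans (by nlinarith)
  have hc : 0 < γ / (1 - γ) := by positivity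
  unfold tailT
  push_cast
  calc γ * m / (1 - γ) * ((T + m) * x) + T * (x * (γ / (1 - γ)))
      = γ / (1 - γ) * (m * (T * x) + m * (m * x) + T * x) := by ring
    _ ≤ γ / (1 - γ) * (4 * (ℓ + 4) ^ 2) := by
        refine mul_le_mul_of_nonneg_left ?_ hc.le
        nlinarith
    _ = _ := by ring

lemma ceil_logb_eq_clog (m : ℕ) : ((⌈Real.logb 2 m⌉ : ℤ) : ℝ) = (Nat.clog 2 m : ℝ) := by
  have h : ⌈Real.logb 2 m⌉ = Int.clog 2 (m : ℝ) := by
    exact_mod_cast Real.ceil_logb_natCast (b := 2) (r := (m : ℝ)) (by positivity)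
  rw [h, Int.clog_natCast, Int.cast_natCast]

/-- With e^{-L} = 1/(2SA·T³m) the left side is γ/(2T(1−γ)); the π² is generous. -/
lemma failure_le (hγ0 : 0 < γ) (hγ : γ < 1) (hT : 1 ≤ T) {nS nA : ℝ} (hS : 0 < nS)
    (hA : 0 < nA) :
    γ * mT γ T / (1 - γ) * ((T : ℝ) ^ 2 * (nS * nA *
      Real.exp (-Real.log (2 * nS * nA * (T : ℝ) ^ 3 * mT γ T)))) ≤
      Real.pi ^ 2 / (6 * (1 - γ)) := by
  have h1 : 0 < 1 - γ := by linarith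
  have hT1 : (1 : ℝ) ≤ T := by exact_mod_cast hT
  have hm : (1 : ℝ) ≤ mT γ T := by exact_mod_cast one_le_mT hγ
  rw [Real.exp_neg, Real.exp_log (by positivity)]
  have hpi := Real.pi_gt_three
  calc _ = γ / (2 * T * (1 - γ)) := by field_simp
    _ ≤ 1 / (2 * 1 * (1 - γ)) := by gcongr
    _ ≤ _ := by
        rw [div_le_div_iff₀ (by positivity) (by positivity)]
        have hpi2 : 3 ≤ Real.pi ^ 2 := by nlinarith
        have := mul_le_mul_of_nonneg_right hpi2 h1.le
        linarith

lemma log_level_nonneg (hγ : γ < 1) (hT : 1 ≤ T) {nS nA : ℝ} (hS : 1 ≤ nS)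
    (hA : 1 ≤ nA) : 0 ≤ Real.log (2 * nS * nA * (T : ℝ) ^ 3 * mT γ T) := by
  have hT1 : (1 : ℝ) ≤ T := by exact_mod_cast hT
  have hm : (1 : ℝ) ≤ mT γ T := by exact_mod_cast one_le_mT hγ
  refine Real.log_nonneg ?_
  have h1 : 1 ≤ nS * nA := one_le_mul_of_one_le_of_one_le hS hA
  have h2 : 1 ≤ nS * nA * (T : ℝ) ^ 3 := one_le_mul_of_one_le_of_one_le h1 (one_le_pow₀ hT1)
  have h3 : 1 ≤ nS * nA * (T : ℝ) ^ 3 * mT γ T := one_le_mul_of_one_le_of_one_le h2 hm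
  linarith

end Horizon

/-! ### The explicit bounds -/

section ExplicitBounds

variable {S : Type u} {A : Type v} [Fintype S] [DecidableEq S] [Fintype A] [DecidableEq A]
  [Nonempty A] {γ δ αlo : ℝ} {r : S → A → ℝ} {pol : ℕ → List (S × A × S) → S → A}

theorem bayesRegret_le_regretBound (hpol : IsAQPolicy γ r δ αlo pol) (hγ0 : 0 < γ) (hγ : γ < 1)
    (hδ : 0 < δ) (hα0 : 0 < αlo) (hα : αlo < 1) (hr : ∀ s a, 0 ≤ r s a ∧ r s a ≤ 1)
    (s₁ : S) {T : ℕ} (hT : 1 ≤ T) :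
    bayesRegret γ r pol s₁ T ≤ regretBound (Fintype.card S) (Fintype.card A) γ δ αlo T := by
  have : Nonempty S := ⟨s₁⟩
  have hS : (1 : ℝ) ≤ Fintype.card S := by exact_mod_cast Fintype.card_pos
  have hA : (1 : ℝ) ≤ Fintype.card A := by exact_mod_cast Fintype.card_pos
  have hL := log_level_nonneg hγ hT hS hA
  have hκ : 0 ≤ γ * mT γ T / (1 - γ) := div_nonneg (by positivity) (by linarith)
  have hfail := failure_le (γ := γ) hγ0 hγ hT (by linarith : (0 : ℝ) < Fintype.card S)
    (by linarith : (0 : ℝ) < Fintype.card A)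
  have htail := truncation_le_tailT hγ0 hγ hT
  have key := bayesRegret_le_of_valueGap hpol hγ0 hγ hδ hα0 hα hr hL s₁ T hκ fun P hP =>
    (sum_adaptiveValue_sub_trueValue_le (pol := pol) hγ0 hγ hP hδ hα0 hα hr hL s₁ (mT γ T) T
      hT).trans_eq (add_right_comm _ _ _)
  unfold regretBound Tbar MT
  rw [ceil_logb_eq_clog]
  unfold Tbar
  push_cast at key htail
  refine key.trans ?_
  linear_combination hfail + htail

theorem bayesRobustRegret_le_robustRegretBound (hpol : IsAQPolicy γ r δ αlo pol) (hγ0 : 0 < γ)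
    (hγ : γ < 1) (hδ : 0 < δ) (hα0 : 0 < αlo) (hα : αlo < 1)
    (hr : ∀ s a, 0 ≤ r s a ∧ r s a ≤ 1) (s₁ : S) {T : ℕ} (hT : 1 ≤ T) :
    bayesRobustRegret γ r αlo pol s₁ T ≤
      robustRegretBound (Fintype.card S) (Fintype.card A) γ δ αlo T := by
  have : Nonempty S := ⟨s₁⟩
  have hS : (1 : ℝ) ≤ Fintype.card S := by exact_mod_cast Fintype.card_pos
  have hA : (1 : ℝ) ≤ Fintype.card A := by exact_mod_cast Fintype.card_pos
  have hL := log_level_nonneg hγ hT hS hA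
  have hκ : 0 ≤ γ * mT γ T / (1 - γ) := div_nonneg (by positivity) (by linarith)
  have hfail := failure_le (γ := γ) hγ0 hγ hT (by linarith : (0 : ℝ) < Fintype.card S)
    (by linarith : (0 : ℝ) < Fintype.card A)
  have htail := truncation_le_tailT hγ0 hγ hT
  have key := bayesRobustRegret_le_of_valueGap hpol hγ0 hγ hδ hα0 hα hr hL s₁ T hκ (fun P hP =>
    (sum_adaptiveValue_sub_trueValue_le (pol := pol) hγ0 hγ hP hδ hα0 hα hr hL s₁ (mT γ T) T
      hT).trans_eq (add_right_comm _ _ _)) fun P hP =>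
    (sum_trueValue_sub_robustValue_le (pol := pol) hγ0 hγ hP hα0 hα hr hL s₁ (mT γ T)
      T).trans_eq (add_right_comm _ _ _)
  unfold robustRegretBound Tbar MT
  rw [ceil_logb_eq_clog]
  unfold Tbar
  push_cast at key htail
  refine key.trans ?_
  have hpi : Real.pi ^ 2 / (3 * (1 - γ)) = 2 * (Real.pi ^ 2 / (6 * (1 - γ))) := by
    have : 1 - γ ≠ 0 := by linarith
    field_simp
    norm_num
  rw [hpi]
  linear_combination 2 * hfail + 2 * htail

end ExplicitBounds

/-! ### Orders of magnitude -/

section Order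

variable {nS nA γ δ q l : ℝ} {T : ℕ}

lemma logFactor_bounds (hS : 1 ≤ nS) (hA : 1 ≤ nA) (hγ0 : 0 < γ) (hγ : γ < 1) (hδ : 0 < δ)
    (hT : 1 ≤ T) :
    0 ≤ Real.log nS ∧ 0 ≤ Real.log nA ∧ 0 ≤ Real.log T ∧ 0 ≤ Real.log (1 + 1 / δ) ∧
      0 ≤ Real.log (1 / (1 - γ)) := by
  have hT1 : (1 : ℝ) ≤ T := by exact_mod_cast hT
  have h1 : 0 < 1 - γ := by linarith
  exact ⟨Real.log_nonneg hS, Real.log_nonneg hA, Real.log_nonneg hT1,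
    Real.log_nonneg (by linarith [one_div_pos.2 hδ]),
    Real.log_nonneg ((one_le_div h1).2 (by linarith))⟩

/-- log u ≤ 2Λ and log log u ≤ log u − 1; the saved unit is used for the constants of `mT` and
`tailT`. -/
lemma logTerm_le_logFactor (hS : 1 ≤ nS) (hA : 1 ≤ nA) (hγ0 : 0 < γ) (hγ : γ < 1) (hδ : 0 < δ)
    (hT : 1 ≤ T) : logTerm γ T ≤ 4 * logFactor nS nA γ δ T - 1 := by
  obtain ⟨h1, h2, h3, h4, h5⟩ := logFactor_bounds hS hA hγ0 hγ hδ hT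
  have hg : 0 < 1 - γ := by linarith
  have hT1 : (0 : ℝ) < T := by exact_mod_cast hT
  have hone := one_le_log_horizon γ T
  have hlog : Real.log (max (Real.exp 1) (T / (1 - γ) ^ 2)) ≤ 2 * logFactor nS nA γ δ T := by
    unfold logFactor
    rcases max_choice (Real.exp 1) (T / (1 - γ) ^ 2) with h | h
    · rw [h, Real.log_exp]; linarith
    · rw [h, Real.log_div hT1.ne' (by positivity), Real.log_pow]
      have h6 : Real.log (1 / (1 - γ)) = -Real.log (1 - γ) := by rw [one_div, Real.log_inv]
      push_cast
      linarith
  unfold logTerm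
  have := Real.log_le_sub_one_of_pos (by linarith :
    0 < Real.log (max (Real.exp 1) (T / (1 - γ) ^ 2)))
  linarith

lemma one_le_logFactor (hS : 1 ≤ nS) (hA : 1 ≤ nA) (hγ0 : 0 < γ) (hγ : γ < 1) (hδ : 0 < δ)
    (hT : 1 ≤ T) : 1 ≤ logFactor nS nA γ δ T := by
  obtain ⟨h1, h2, h3, h4, h5⟩ := logFactor_bounds hS hA hγ0 hγ hδ hT
  unfold logFactor
  linarith

lemma mT_le_logFactor (hS : 1 ≤ nS) (hA : 1 ≤ nA) (hγ0 : 0 < γ) (hγ : γ < 1) (hδ : 0 < δ)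
    (hT : 1 ≤ T) : (mT γ T : ℝ) ≤ 6 * logFactor nS nA γ δ T / (1 - γ) := by
  have hg : 0 < 1 - γ := by linarith
  rw [le_div_iff₀' hg]
  linarith [mT_le (T := T) hγ0 hγ, logTerm_le_logFactor hS hA hγ0 hγ hδ hT,
    one_le_logFactor hS hA hγ0 hγ hδ hT]

lemma tailT_le_logFactor (hS : 1 ≤ nS) (hA : 1 ≤ nA) (hγ0 : 0 < γ) (hγ : γ < 1) (hδ : 0 < δ)
    (hT : 1 ≤ T) : tailT γ T ≤ 196 * logFactor nS nA γ δ T ^ 2 / (1 - γ) := by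
  have hg : 0 < 1 - γ := by linarith
  have h1 := logTerm_le_logFactor hS hA hγ0 hγ hδ hT
  have h2 := one_le_logFactor hS hA hγ0 hγ hδ hT
  have h3 := one_le_logTerm γ T
  unfold tailT
  calc 4 * γ / (1 - γ) * (logTerm γ T + 4) ^ 2
      ≤ 4 * 1 / (1 - γ) * (7 * logFactor nS nA γ δ T) ^ 2 := by
        gcongr
        linarith
    _ = _ := by ring

lemma Tbar_le (hTm : mT γ T ≤ T) : Tbar γ T ≤ 2 * T := by
  have : (mT γ T : ℝ) ≤ T := by exact_mod_cast hTm
  unfold Tbar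
  linarith

lemma sqrt_width_le (hS : 1 ≤ nS) (hA : 1 ≤ nA) (hq : 0 ≤ q) (hl : l ≤ q)
    (hTm : mT γ T ≤ T) :
    Real.sqrt (16 * nS * nA * Tbar γ T * l) ≤ 6 * Real.sqrt (nS * nA * T * q) := by
  have h1 := Tbar_le hTm
  have h0 : 0 ≤ Tbar γ T := by unfold Tbar; positivity
  refine Real.sqrt_le_iff.2 ⟨by positivity, ?_⟩
  rw [mul_pow, Real.sq_sqrt (by positivity)]
  calc 16 * nS * nA * Tbar γ T * l ≤ 16 * nS * nA * Tbar γ T * q := by gcongr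
    _ ≤ 16 * nS * nA * (2 * T) * q := by gcongr
    _ ≤ 6 ^ 2 * (nS * nA * T * q) := by
        have : 0 ≤ nS * nA * T * q := by positivity
        linarith

lemma sqrt_log_width_le (hS : 1 ≤ nS) (hA : 1 ≤ nA) (hγ0 : 0 < γ) (hγ : γ < 1) (hδ : 0 < δ)
    (hT : 1 ≤ T) (hq : 1 / 2 ≤ q) (hTm : mT γ T ≤ T) (hST : nS ^ 2 * nA ≤ T) :
    Real.sqrt (16 * nS * nA * (Tbar γ T + nS ^ 2 * nA) *
        (Real.log (1 + nS * nA * MT nS nA γ δ T / (Tbar γ T + nS ^ 2 * nA)) + 2)) ≤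
      24 * logFactor nS nA γ δ T * Real.sqrt (nS * nA * T * q) := by
  obtain ⟨h1, h2, h3, h4, h5⟩ := logFactor_bounds hS hA hγ0 hγ hδ hT
  have hΛ := one_le_logFactor hS hA hγ0 hγ hδ hT
  have hT1 : (1 : ℝ) ≤ T := by exact_mod_cast hT
  have hTb := Tbar_le hTm
  have hTb1 : 1 ≤ Tbar γ T := by
    unfold Tbar
    linarith [(Nat.cast_nonneg (mT γ T) : (0 : ℝ) ≤ _)]
  have hl2 := Real.log_two_gt_d9
  set Y := Tbar γ T with hY
  have hsq : Real.sqrt Y ≤ 3 / 2 * T := by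
    refine Real.sqrt_le_iff.2 ⟨by positivity, ?_⟩
    nlinarith
  have hden : 0 < Y + nS ^ 2 * nA := by positivity
  have hM0 : 0 ≤ MT nS nA γ δ T := by
    unfold MT
    rw [← hY]
    positivity
  -- 9 = 2·2·(3/2)·(3/2), from S + 1 ≤ 2S, √Y ≤ 3T/2 and 1/ln 2 ≤ 3/2; the sum Y + SA cancels
  -- against the denominator.
  have hM : nS * nA * MT nS nA γ δ T / (Y + nS ^ 2 * nA) ≤ 9 * nS * T * (1 / δ) := by
    unfold MT
    rw [← hY, div_le_iff₀ hden]
    calc nS * nA * (2 * (nS + 1) * (Y + nS * nA) * Real.sqrt Y / (nS * nA * δ * Real.log 2))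
        = 2 * (nS + 1) * (Y + nS * nA) * Real.sqrt Y * (1 / δ) * (1 / Real.log 2) := by
          field_simp
      _ ≤ 2 * (2 * nS) * (Y + nS ^ 2 * nA) * (3 / 2 * T) * (1 / δ) * (3 / 2) := by
          have ha : nS + 1 ≤ 2 * nS := by linarith
          have hb : nS * nA ≤ nS ^ 2 * nA := by
            have : nS ≤ nS ^ 2 := le_self_pow₀ hS (by norm_num)
            gcongr
          have hc : 1 / Real.log 2 ≤ 3 / 2 := by
            rw [div_le_iff₀ (by linarith)]; linarith
          gcongr
      _ = _ := by ring
  have hlog : Real.log (1 + nS * nA * MT nS nA γ δ T / (Y + nS ^ 2 * nA)) ≤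
      3 + logFactor nS nA γ δ T := by
    have hST1 : 1 ≤ nS * T := one_le_mul_of_one_le_of_one_le hS hT1
    have h9 : Real.log 9 ≤ 3 := by
      have : Real.log 9 = 2 * Real.log 3 := by
        rw [show (9 : ℝ) = 3 ^ 2 by norm_num, Real.log_pow]; norm_num
      have h3 : Real.log 3 ≤ 3 / 2 := by
        have h := Real.log_le_sub_one_of_pos (by norm_num : (0 : ℝ) < 3 / 2)
        have : Real.log 3 = Real.log (3 / 2) + Real.log 2 := by
          rw [← Real.log_mul (by norm_num) (by norm_num)]; norm_num
        linarith [Real.log_two_lt_d9]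
      linarith
    calc Real.log (1 + nS * nA * MT nS nA γ δ T / (Y + nS ^ 2 * nA))
        ≤ Real.log (9 * (nS * T * (1 + 1 / δ))) := by
          refine Real.log_le_log (by positivity) ?_
          have : 0 < 1 / δ := by positivity
          nlinarith
      _ = Real.log 9 + (Real.log nS + Real.log T + Real.log (1 + 1 / δ)) := by
          rw [Real.log_mul (by norm_num) (by positivity), Real.log_mul (by positivity)
            (by positivity), Real.log_mul (by positivity) (by positivity)]
      _ ≤ _ := by
          unfold logFactor
          linarith
  refine Real.sqrt_le_iff.2 ⟨by positivity, ?_⟩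
  rw [mul_pow, Real.sq_sqrt (by positivity)]
  set Λ := logFactor nS nA γ δ T with hΛdef
  -- T ≥ S²A enters here, as Y + S²A ≤ 3T. Then 16·3·6·2 = 24², the last 2 coming from 1 ≤ 2q, which
  -- inserts the level logarithm q under the root.
  calc _ ≤ 16 * nS * nA * (3 * T) * (6 * Λ) := by
        have hb : Y + nS ^ 2 * nA ≤ 3 * T := by linarith
        have hc : Real.log (1 + nS * nA * MT nS nA γ δ T / (Y + nS ^ 2 * nA)) + 2 ≤ 6 * Λ := by
          linarith
        have hd : 0 ≤ nS * nA * MT nS nA γ δ T / (Y + nS ^ 2 * nA) := by positivity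
        have he := Real.log_nonneg (le_add_of_nonneg_right hd)
        gcongr
    _ ≤ 16 * nS * nA * (3 * T) * (6 * Λ ^ 2 * (2 * q)) := by
        have : Λ ≤ Λ ^ 2 := by nlinarith
        have : Λ ^ 2 ≤ Λ ^ 2 * (2 * q) := le_mul_of_one_le_right (by positivity) (by linarith)
        exact mul_le_mul_of_nonneg_left (by linarith) (by positivity)
    _ = _ := by ring

lemma sqrt_level_width_le (hS : 1 ≤ nS) (hA : 1 ≤ nA) (hγ0 : 0 < γ) (hγ : γ < 1) (hδ : 0 < δ)
    (hT : 1 ≤ T) (hq : 1 / 2 ≤ q) (hTm : mT γ T ≤ T) :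
    Real.sqrt (16 * nS * nA * Tbar γ T * Real.log (2 * nS * nA * (T : ℝ) ^ 3 * mT γ T)) ≤
      16 * logFactor nS nA γ δ T * Real.sqrt (nS * nA * T * q) := by
  obtain ⟨h1, h2, h3, h4, h5⟩ := logFactor_bounds hS hA hγ0 hγ hδ hT
  have hΛ := one_le_logFactor hS hA hγ0 hγ hδ hT
  have hT1 : (1 : ℝ) ≤ T := by exact_mod_cast hT
  have hm1 : (1 : ℝ) ≤ mT γ T := by exact_mod_cast one_le_mT hγ
  have hmT : (mT γ T : ℝ) ≤ T := by exact_mod_cast hTm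
  have hTb := Tbar_le hTm
  have hTb0 : 0 ≤ Tbar γ T := by unfold Tbar; positivity
  have hlog : Real.log (2 * nS * nA * (T : ℝ) ^ 3 * mT γ T) ≤ 4 * logFactor nS nA γ δ T := by
    calc Real.log (2 * nS * nA * (T : ℝ) ^ 3 * mT γ T)
        ≤ Real.log (2 * nS * nA * (T : ℝ) ^ 3 * T) := by
          refine Real.log_le_log (by positivity) (by gcongr)
      _ = Real.log 2 + Real.log nS + Real.log nA + 3 * Real.log T + Real.log T := by
          rw [Real.log_mul (by positivity) (by positivity), Real.log_mul (by positivity)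
            (by positivity), Real.log_mul (by positivity) (by positivity),
            Real.log_mul (by positivity) (by positivity), Real.log_pow]
          norm_num
      _ ≤ _ := by
          unfold logFactor
          linarith [Real.log_two_lt_d9]
  refine Real.sqrt_le_iff.2 ⟨by positivity, ?_⟩
  rw [mul_pow, Real.sq_sqrt (by positivity)]
  set Λ := logFactor nS nA γ δ T with hΛdef
  have hL := log_level_nonneg hγ hT hS hA
  calc _ ≤ 16 * nS * nA * (2 * T) * (4 * Λ) := by gcongr
    _ ≤ 16 * nS * nA * (2 * T) * (4 * Λ ^ 2 * (2 * q)) := by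
        have : Λ ≤ Λ ^ 2 := by nlinarith
        have : Λ ^ 2 ≤ Λ ^ 2 * (2 * q) := le_mul_of_one_le_right (by positivity) (by linarith)
        exact mul_le_mul_of_nonneg_left (by linarith) (by positivity)
    _ = _ := by ring

lemma ceil_logb_mT_le (hS : 1 ≤ nS) (hA : 1 ≤ nA) (hγ0 : 0 < γ) (hγ : γ < 1) (hδ : 0 < δ)
    (hT : 1 ≤ T) (hTm : mT γ T ≤ T) :
    ((⌈Real.logb 2 (mT γ T)⌉ : ℤ) : ℝ) ≤ 2 * logFactor nS nA γ δ T := by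
  obtain ⟨h1, h2, h3, h4, h5⟩ := logFactor_bounds hS hA hγ0 hγ hδ hT
  have hm1 : (1 : ℝ) ≤ mT γ T := by exact_mod_cast one_le_mT hγ
  have hmT : (mT γ T : ℝ) ≤ T := by exact_mod_cast hTm
  have hlog := Real.log_le_log (by linarith) hmT
  have hl2 := Real.log_two_gt_d9
  have : Real.logb 2 (mT γ T) ≤ 2 * Real.log T := by
    unfold Real.logb
    rw [div_le_iff₀ (by linarith)]
    nlinarith
  have := Int.ceil_lt_add_one (Real.logb 2 (mT γ T))
  unfold logFactor
  linarith

lemma log_two_mul_le_logFactor (hS : 1 ≤ nS) (hA : 1 ≤ nA) (hγ0 : 0 < γ) (hγ : γ < 1)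
    (hδ : 0 < δ) (hT : 1 ≤ T) : Real.log (2 * T) ≤ logFactor nS nA γ δ T := by
  obtain ⟨h1, h2, h3, h4, h5⟩ := logFactor_bounds hS hA hγ0 hγ hδ hT
  have hT1 : (0 : ℝ) < T := by exact_mod_cast hT
  rw [Real.log_mul (by norm_num) hT1.ne']
  unfold logFactor
  linarith [Real.log_two_lt_d9]

/-- A leading term of the regret bounds in terms of `logFactor`. -/
lemma leading_le {m R w Λ : ℝ} (hγ0 : 0 < γ) (hγ : γ < 1) (hΛ : 1 ≤ Λ) (hR : 0 ≤ R)
    (hm0 : 0 ≤ m) (hm : m ≤ 6 * Λ / (1 - γ)) (hw : w ≤ 100 * Λ * R) :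
    γ * m / (1 - γ) * w ≤ 600 * Λ ^ 3 * (γ * R / (1 - γ) ^ 2) := by
  have hg : 0 < 1 - γ := by linarith
  have hΛ3 : Λ ^ 2 ≤ Λ ^ 3 := pow_le_pow_right₀ hΛ (by norm_num)
  calc γ * m / (1 - γ) * w ≤ γ * m / (1 - γ) * (100 * Λ * R) := by gcongr
    _ ≤ γ * (6 * Λ / (1 - γ)) / (1 - γ) * (100 * Λ * R) := by gcongr
    _ = 600 * Λ ^ 2 * (γ * R / (1 - γ) ^ 2) := by field_simp; ring
    _ ≤ _ := by gcongr

lemma doubling_le {m L N Λ : ℝ} (hγ0 : 0 < γ) (hγ : γ < 1) (hN : 0 ≤ N)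
    (hm0 : 0 ≤ m) (hm : m ≤ 6 * Λ / (1 - γ)) (hΛ : 0 ≤ Λ) (hL : L ≤ 2 * Λ) :
    γ * N / (1 - γ) * m ^ 2 * L ≤ 72 * Λ ^ 3 * (N / (1 - γ) ^ 3) := by
  have hg : 0 < 1 - γ := by linarith
  calc γ * N / (1 - γ) * m ^ 2 * L ≤ γ * N / (1 - γ) * m ^ 2 * (2 * Λ) := by gcongr
    _ ≤ 1 * N / (1 - γ) * (6 * Λ / (1 - γ)) ^ 2 * (2 * Λ) := by gcongr
    _ = _ := by field_simp; ring

lemma one_div_le_order (hγ0 : 0 < γ) (hγ : γ < 1) {N Λ : ℝ} (hN : 1 ≤ N) {k : ℕ} (hΛ : 1 ≤ Λ)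
    (hk : k ≤ 3) : Λ ^ k * (1 / (1 - γ)) ≤ Λ ^ 3 * (N / (1 - γ) ^ 3) := by
  have hg : 0 < 1 - γ := by linarith
  have h1 : Λ ^ k ≤ Λ ^ 3 := pow_le_pow_right₀ hΛ hk
  have h2 : 1 / (1 - γ) ≤ N / (1 - γ) ^ 3 :=
    div_le_div₀ (by linarith) hN (by positivity)
      (by simpa using pow_le_pow_of_le_one hg.le (by linarith) (by norm_num : 1 ≤ 3))
  gcongr

variable {αlo : ℝ}

lemma regretBound_le_order (hS : 1 ≤ nS) (hA : 1 ≤ nA) (hγ0 : 0 < γ) (hγ : γ < 1) (hδ : 0 < δ)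
    (hα0 : 0 < αlo) (hα : αlo < 1) (hT : 1 ≤ T) (hTm : mT γ T ≤ T) (hST : nS ^ 2 * nA ≤ T) :
    regretBound nS nA γ δ αlo T ≤ 1000 * logFactor nS nA γ δ T ^ 3 *
      (γ * Real.sqrt (nS * nA * T * Real.log (Real.exp 1 / (1 - αlo))) / (1 - γ) ^ 2 +
        δ * nS * nA * Real.sqrt T / (1 - γ) ^ 2 + nS * nA / (1 - γ) ^ 3) := by
  have hg : 0 < 1 - γ := by linarith
  -- The e in the numerator keeps q ≥ 1 when the floor level is small, so the widths without a level
  -- logarithm can be absorbed into √q.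
  have hq : Real.log (Real.exp 1 / (1 - αlo)) = 1 + Real.log (1 / (1 - αlo)) := by
    rw [div_eq_mul_one_div, Real.log_mul (Real.exp_pos 1).ne' (by
      have : 0 < 1 - αlo := by linarith
      positivity), Real.log_exp]
  have hl : 0 ≤ Real.log (1 / (1 - αlo)) :=
    Real.log_nonneg ((one_le_div (by linarith)).2 (by linarith))
  set q := Real.log (Real.exp 1 / (1 - αlo)) with hqdef
  have hΛ := one_le_logFactor hS hA hγ0 hγ hδ hT
  have hm := mT_le_logFactor hS hA hγ0 hγ hδ hT
  have htail := tailT_le_logFactor hS hA hγ0 hγ hδ hT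
  have hw1 := sqrt_width_le (γ := γ) hS hA (by linarith : 0 ≤ q)
    (by linarith : Real.log (1 / (1 - αlo)) ≤ q) hTm
  have hw2 := sqrt_log_width_le hS hA hγ0 hγ hδ hT (by linarith : 1 / 2 ≤ q) hTm hST
  have hw3 := sqrt_level_width_le hS hA hγ0 hγ hδ hT (by linarith : 1 / 2 ≤ q) hTm
  have hceil := ceil_logb_mT_le hS hA hγ0 hγ hδ hT hTm
  have hlog2 := log_two_mul_le_logFactor hS hA hγ0 hγ hδ hT
  set Λ := logFactor nS nA γ δ T with hΛdef
  set R := Real.sqrt (nS * nA * T * q) with hR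
  have hR0 : 0 ≤ R := Real.sqrt_nonneg _
  have hΛR : R ≤ Λ * R := le_mul_of_one_le_left hR0 hΛ
  have hN : 1 ≤ nS * nA := one_le_mul_of_one_le_of_one_le hS hA
  have hlead := leading_le (m := mT γ T) (R := R) hγ0 hγ hΛ hR0 (Nat.cast_nonneg _) hm
    ((add_le_add (add_le_add hw1 hw2) hw3).trans
      (by linarith : 6 * R + 24 * Λ * R + 16 * Λ * R ≤ 100 * Λ * R))
  have hdoub := doubling_le (N := nS * nA) hγ0 hγ (by linarith) (Nat.cast_nonneg _) hm
    (by linarith) hceil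
  have h0 := one_div_le_order hγ0 hγ hN hΛ (by norm_num : 0 ≤ 3)
  have h2 := one_div_le_order hγ0 hγ hN hΛ (by norm_num : 2 ≤ 3)
  have hpi : Real.pi ^ 2 / (6 * (1 - γ)) ≤ 3 * (Λ ^ 0 * (1 / (1 - γ))) := by
    have hp : Real.pi ^ 2 ≤ 4 ^ 2 := pow_le_pow_left₀ Real.pi_pos.le Real.pi_le_four 2
    have hp' := mul_le_mul_of_nonneg_right hp hg.le
    rw [pow_zero, one_mul, mul_one_div, div_le_div_iff₀ (by positivity) hg]
    linarith
  have htail' : tailT γ T ≤ 196 * (Λ ^ 2 * (1 / (1 - γ))) := htail.trans_eq (by ring)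
  have hδterm : 2 * δ * nS * nA * Real.sqrt T * Real.log (2 * T) / (1 - γ) ^ 2 ≤
      2 * Λ ^ 3 * (δ * nS * nA * Real.sqrt T / (1 - γ) ^ 2) := by
    have h13 : Λ ≤ Λ ^ 3 := le_self_pow₀ hΛ (by norm_num)
    calc _ ≤ 2 * δ * nS * nA * Real.sqrt T * Λ ^ 3 / (1 - γ) ^ 2 := by
          have := hlog2.trans h13
          gcongr
      _ = _ := by ring
  have hX : 0 ≤ Λ ^ 3 * (γ * R / (1 - γ) ^ 2) := by positivity
  have hY : 0 ≤ Λ ^ 3 * (δ * nS * nA * Real.sqrt T / (1 - γ) ^ 2) := by positivity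
  have hZ : 0 ≤ Λ ^ 3 * (nS * nA / (1 - γ) ^ 3) := by positivity
  unfold regretBound
  rw [show γ * nS * nA / (1 - γ) = γ * (nS * nA) / (1 - γ) by ring]
  linarith

lemma robustRegretBound_le_order (hS : 1 ≤ nS) (hA : 1 ≤ nA) (hγ0 : 0 < γ) (hγ : γ < 1)
    (hδ : 0 < δ) (hα0 : 0 < αlo) (hα : αlo < 1) (hT : 1 ≤ T) (hTm : mT γ T ≤ T)
    (hST : nS ^ 2 * nA ≤ T) :
    robustRegretBound nS nA γ δ αlo T ≤ 1000 * logFactor nS nA γ δ T ^ 3 *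
      (γ * Real.sqrt (nS * nA * T * Real.log (1 / min αlo (1 - αlo))) / (1 - γ) ^ 2 +
        nS * nA / (1 - γ) ^ 3) := by
  have hg : 0 < 1 - γ := by linarith
  have hmin : 0 < min αlo (1 - αlo) := lt_min hα0 (by linarith)
  set q := Real.log (1 / min αlo (1 - αlo)) with hqdef
  have hq1 : Real.log (1 / (1 - αlo)) ≤ q :=
    Real.log_le_log (one_div_pos.2 (by linarith)) (one_div_le_one_div_of_le hmin (min_le_right _ _))
  have hq2 : Real.log (1 / αlo) ≤ q :=
    Real.log_le_log (one_div_pos.2 hα0) (one_div_le_one_div_of_le hmin (min_le_left _ _))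
  -- No extra e is needed here: one of the two levels is at most 1/2, so q ≥ ln 2.
  have hq : 1 / 2 ≤ q := by
    have hhalf : min αlo (1 - αlo) ≤ 1 / 2 := by
      rcases le_total αlo (1 / 2) with h | h
      · exact (min_le_left _ _).trans h
      · exact (min_le_right _ _).trans (by linarith)
    have h2 : Real.log 2 ≤ q := by
      refine Real.log_le_log (by norm_num) ?_
      rw [le_div_iff₀ hmin]
      linarith
    linarith [Real.log_two_gt_d9]
  have hΛ := one_le_logFactor hS hA hγ0 hγ hδ hT
  have hm := mT_le_logFactor hS hA hγ0 hγ hδ hT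
  have htail := tailT_le_logFactor hS hA hγ0 hγ hδ hT
  have hw1 := sqrt_width_le (γ := γ) hS hA (by linarith : 0 ≤ q) hq1 hTm
  have hw2 := sqrt_log_width_le hS hA hγ0 hγ hδ hT hq hTm hST
  have hw3 := sqrt_width_le (γ := γ) hS hA (by linarith : 0 ≤ q) hq2 hTm
  have hw4 := sqrt_level_width_le hS hA hγ0 hγ hδ hT hq hTm
  have hceil := ceil_logb_mT_le hS hA hγ0 hγ hδ hT hTm
  set Λ := logFactor nS nA γ δ T with hΛdef
  set R := Real.sqrt (nS * nA * T * q) with hR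
  have hR0 : 0 ≤ R := Real.sqrt_nonneg _
  have hΛR : R ≤ Λ * R := le_mul_of_one_le_left hR0 hΛ
  have hN : 1 ≤ nS * nA := one_le_mul_of_one_le_of_one_le hS hA
  have hlead := leading_le (m := mT γ T) (R := R) hγ0 hγ hΛ hR0 (Nat.cast_nonneg _) hm
    ((add_le_add (add_le_add (add_le_add hw1 hw2) hw3)
      (mul_le_mul_of_nonneg_left hw4 zero_le_two)).trans
      (by linarith : 6 * R + 24 * Λ * R + 6 * R + 2 * (16 * Λ * R) ≤ 100 * Λ * R))
  have hdoub := doubling_le (N := nS * nA) hγ0 hγ (by linarith) (Nat.cast_nonneg _) hm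
    (by linarith) hceil
  have h0 := one_div_le_order hγ0 hγ hN hΛ (by norm_num : 0 ≤ 3)
  have h2 := one_div_le_order hγ0 hγ hN hΛ (by norm_num : 2 ≤ 3)
  have hpi : Real.pi ^ 2 / (3 * (1 - γ)) ≤ 6 * (Λ ^ 0 * (1 / (1 - γ))) := by
    have hp : Real.pi ^ 2 ≤ 4 ^ 2 := pow_le_pow_left₀ Real.pi_pos.le Real.pi_le_four 2
    have hp' := mul_le_mul_of_nonneg_right hp hg.le
    rw [pow_zero, one_mul, mul_one_div, div_le_div_iff₀ (by positivity) hg]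
    linarith
  have htail' : tailT γ T ≤ 196 * (Λ ^ 2 * (1 / (1 - γ))) := htail.trans_eq (by ring)
  have hX : 0 ≤ Λ ^ 3 * (γ * R / (1 - γ) ^ 2) := by positivity
  have hZ : 0 ≤ Λ ^ 3 * (nS * nA / (1 - γ) ^ 3) := by positivity
  unfold robustRegretBound
  rw [show 2 * γ * nS * nA / (1 - γ) * (mT γ T : ℝ) ^ 2 * (⌈Real.logb 2 (mT γ T)⌉ : ℝ) =
    2 * (γ * (nS * nA) / (1 - γ) * (mT γ T : ℝ) ^ 2 * (⌈Real.logb 2 (mT γ T)⌉ : ℝ)) by ring]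
  linarith

/-- Few interactions compared with the horizon have a regret of the order of the last term. -/
lemma trivial_le_order (hS : 1 ≤ nS) (hA : 1 ≤ nA) (hγ0 : 0 < γ) (hγ : γ < 1) (hδ : 0 < δ)
    (hT : 1 ≤ T) (hTm : T ≤ mT γ T) :
    T * (1 / (1 - γ)) ≤ 1000 * logFactor nS nA γ δ T ^ 3 * (nS * nA / (1 - γ) ^ 3) := by
  have hg : 0 < 1 - γ := by linarith
  have hΛ := one_le_logFactor hS hA hγ0 hγ hδ hT
  have hm := mT_le_logFactor hS hA hγ0 hγ hδ hT
  have hTm' : (T : ℝ) ≤ mT γ T := by exact_mod_cast hTm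
  have hN : 1 ≤ nS * nA := one_le_mul_of_one_le_of_one_le hS hA
  set Λ := logFactor nS nA γ δ T with hΛdef
  have h13 : Λ ≤ Λ ^ 3 := le_self_pow₀ hΛ (by norm_num)
  calc T * (1 / (1 - γ)) ≤ 6 * Λ / (1 - γ) * (1 / (1 - γ)) := by
        have := hTm'.trans hm
        gcongr
    _ = 6 * Λ * (1 / (1 - γ) ^ 2) := by field_simp
    _ ≤ 1000 * Λ ^ 3 * (nS * nA / (1 - γ) ^ 3) := by
        have h23 : (1 - γ) ^ 3 ≤ (1 - γ) ^ 2 :=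
          pow_le_pow_of_le_one hg.le (by linarith) (by norm_num)
        have : 6 * Λ ≤ 1000 * Λ ^ 3 := by linarith
        gcongr

end Order

end AQBRMDP

end

/-! ### The explicit and the order bounds together -/

theorem theorem2 :
    ∃ C : ℝ, 0 < C ∧ ∃ p : ℕ,
      ∀ (S : Type u) (A : Type v) [Fintype S] [DecidableEq S] [Fintype A] [DecidableEq A]
        [Nonempty A] (γ δ αlo : ℝ) (r : S → A → ℝ) (pol : ℕ → List (S × A × S) → S → A)
        (s₁ : S) (T : ℕ) (nS nA : ℝ),
        nS = Fintype.card S → nA = Fintype.card A →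
        0 < γ → γ < 1 → 0 < δ → 0 < αlo → αlo < 1 →
        (∀ s a, 0 ≤ r s a ∧ r s a ≤ 1) →
        AQBRMDP.IsAQPolicy γ r δ αlo pol →
        1 ≤ T →
        Integrable (AQBRMDP.condRegret γ r pol s₁ T) (AQBRMDP.kernelPrior S A) ∧
        Integrable (AQBRMDP.condRobustRegret γ r αlo pol s₁ T) (AQBRMDP.kernelPrior S A) ∧
        AQBRMDP.bayesRegret γ r pol s₁ T ≤ AQBRMDP.regretBound nS nA γ δ αlo T ∧
        AQBRMDP.bayesRobustRegret γ r αlo pol s₁ T ≤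
          AQBRMDP.robustRegretBound nS nA γ δ αlo T ∧
        (nS ^ 2 * nA ≤ T →
          AQBRMDP.bayesRegret γ r pol s₁ T ≤
            C * AQBRMDP.logFactor nS nA γ δ T ^ p *
              (γ * Real.sqrt (nS * nA * T * Real.log (Real.exp 1 / (1 - αlo))) / (1 - γ) ^ 2 +
                δ * nS * nA * Real.sqrt T / (1 - γ) ^ 2 +
                nS * nA / (1 - γ) ^ 3) ∧
          AQBRMDP.bayesRobustRegret γ r αlo pol s₁ T ≤
            C * AQBRMDP.logFactor nS nA γ δ T ^ p *
              (γ * Real.sqrt (nS * nA * T * Real.log (1 / min αlo (1 - αlo))) / (1 - γ) ^ 2 +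
                nS * nA / (1 - γ) ^ 3)) := by
  -- The leading terms need 600, the δ-term 2, and the last term 72+3+196 or, for the robust regret,
  -- 144+6+392. The exponent 3 comes from the doubling term: m² gives Λ² and ⌈log₂ m⌉ another Λ.
  refine ⟨1000, by norm_num, 3, ?_⟩
  intro S A _ _ _ _ _ γ δ αlo r pol s₁ T nS nA hnS hnA hγ0 hγ hδ hα0 hα hr hpol hT
  subst hnS hnA
  have : Nonempty S := ⟨s₁⟩
  have hS : (1 : ℝ) ≤ Fintype.card S := by exact_mod_cast Fintype.card_pos
  have hA : (1 : ℝ) ≤ Fintype.card A := by exact_mod_cast Fintype.card_pos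
  have hg : 0 < 1 - γ := by linarith
  have h1 := AQBRMDP.bayesRegret_le_regretBound hpol hγ0 hγ hδ hα0 hα hr s₁ hT
  have h2 := AQBRMDP.bayesRobustRegret_le_robustRegretBound hpol hγ0 hγ hδ hα0 hα hr s₁ hT
  refine ⟨AQBRMDP.integrable_condRegret hγ0 hγ hr s₁ T,
    AQBRMDP.integrable_condRobustRegret hγ0 hγ s₁ T, h1, h2, fun hST => ?_⟩
  -- For T below m_T the estimate T̄ ≤ 2T is lost, but then T/(1−γ) ≤ m_T/(1−γ) is already of the
  -- order of the last term.
  rcases le_total (AQBRMDP.mT γ T) T with hTm | hTm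
  · exact ⟨h1.trans (AQBRMDP.regretBound_le_order hS hA hγ0 hγ hδ hα0 hα hT hTm hST),
      h2.trans (AQBRMDP.robustRegretBound_le_order hS hA hγ0 hγ hδ hα0 hα hT hTm hST)⟩
  · have h3 := AQBRMDP.trivial_le_order hS hA hγ0 hγ hδ hT hTm
    have hΛ := AQBRMDP.one_le_logFactor hS hA hγ0 hγ hδ hT
    refine ⟨(AQBRMDP.bayesRegret_le_trivial hγ0 hγ hr s₁ T).trans (h3.trans ?_),
      (AQBRMDP.bayesRobustRegret_le_trivial hγ0 hγ hα0 hα hr s₁ T).trans (h3.trans ?_)⟩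
    · refine mul_le_mul_of_nonneg_left (le_add_of_nonneg_left ?_) (by positivity)
      positivity
    · refine mul_le_mul_of_nonneg_left (le_add_of_nonneg_left ?_) (by positivity)
      positivity
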